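/- Logarithms and exponentials are natural. Let $\mathcal A,\mathcal B$ be measurable spaces, the $\sigma$-algebra of $\mathcal B$ being countably generated (e.g. $\mathcal B$ standard Borel), let $P_{\mathsf Y|\mathsf X}\colon\mathcal A\to\mathcal B$ be a Markov kernel and let $\mathsf b\colon\mathcal A\to[0,\infty]$ be measurable. Consider the stationary memoryless channel $P_{Y^n|X^n}=P_{\mathsf Y|\mathsf X}\times\cdots\times P_{\mathsf Y|\mathsf X}$ with separable cost $\mathsf b_n(x^n)=\frac1n\sum_{i=1}^n\mathsf b(x_i)$. An $(n,M,\epsilon,\beta)$ code is a pair of a stochastic encoder $P_{X^n|S}$ and a stochastic decoder $P_{Z|Y^n}$ such that $\mathbb P[S\ne Z]\le\epsilon$ when $S$ is equiprobable on $M$ messages, and such that $\mathsf b_n(X^n)\le\beta$ almost surely for every message; $M^\star(n,\epsilon,\beta)$ is the largest such $M$. Let $C(\gamma)=\sup\{I(\mathsf X;\mathsf Y)\colon\mathbb E[\mathsf b(\mathsf X)]\le\gamma\}$ be the capacity-cost function, and let $$V(\beta)=\lim_{\epsilon\to0}\limsup_{n\to\infty}\frac1n\,\frac{(nC(\beta)-\log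 M^\star(n,\epsilon,\beta))^2}{2\log\frac1\epsilon}$$ be the dispersion-cost function. Let $Q(t)=\mathbb P[N(0,1)>t]$. Fix a finite $\beta>\inf_{\mathsf x}\mathsf b(\mathsf x)$ with $C(\beta)<\infty$, and assume that $C(\beta)$ is attained by an input distribution $P_{\mathsf X^\star}$ with $\mathbb E[\mathsf b(\mathsf X^\star)]=\beta$. Let $P_{\mathsf Y^\star}$ be the corresponding output distribution, $P_{Y^{n\star}}=P_{\mathsf Y^\star}\times\cdots\times P_{\mathsf Y^\star}$, and write $\imath_{Y\|\bar Y}=\log\frac{dP_Y}{dP_{\bar Y}}$, $\imath_{X;\bar Y}(x;y)=\log\frac{dP_{Y|X=x}}{dP_{\bar Y}}(y)$, $\jmath(\mathsf x;\mathsf y)=\imath_{\mathsf X;\mathsf Y^\star}(\mathsf x;\mathsf y)-C'(\beta)(\mathsf b(\mathsf x)-\beta)$ and $\mathcal F_n=\{x^n\in\mathcal A^n\colon\mathsf b_n(x^n)=\beta\}$. Assume: (a) for every $\gamma\in[\beta,\infty)$ there is $\mathsf x\in\mathcal A$ with $\mathsf b(\mathsf x)=\gamma$; (b) for every $n\ge1$,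 the distribution of $\imath_{X^n;Y^{n\star}}(x^n;Y^n)$ under $Y^n\sim P_{Y^n|X^n=x^n}$ is the same for all $x^n\in\mathcal F_n$; (c) $\mathbb E\big[|\jmath(\mathsf x;\mathsf Y)-C(\beta)|^3\,\big|\,\mathsf X=\mathsf x\big]<\infty$ for every $\mathsf x$ that is a coordinate of some $x^n\in\mathcal F_n$, $n\ge1$; (d) there is a sequence $f_n=o(\sqrt n)$ such that for every $n\ge1$ there is a distribution $P_{X^n}$ supported on $\mathcal F_n$ whose output distribution $P_{Y^n}$ satisfies $P_{Y^n}\ll P_{Y^{n\star}}$ and $\imath_{Y^n\|Y^{n\star}}(Y^n)\le f_n$ almost surely under $P_{Y^n}$. Then the limit defining $V(\beta)$ exists and is finite; for every $\mathsf x$ with $\mathsf b(\mathsf x)=\beta$, $$C(\beta)=D(P_{\mathsf Y|\mathsf X=\mathsf x}\,\|\,P_{\mathsf Y^\star}),\qquad V(\beta)=\mathrm{Var}\big[\imath_{\mathsf X;\mathsf Y^\star}(\mathsf x;\mathsf Y)\,\big|\,\mathsf X=\mathsf x\big]$$ (the latter with a finite second moment); and for every $\epsilon\in(0,1)$, $M^\star(n,\epsilon,\beta)$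 is finite for all $n\ge1$ and $$\log M^\star(n,\epsilon,\beta)=nC(\beta)-\sqrt{nV(\beta)}\,Q^{-1}(\epsilon)+\theta(n),\qquad -f_n+O(1)\le\theta(n)\le\tfrac12\log n+O(1),$$ where the $O(1)$ terms may depend on $\epsilon$. -/

import Mathlib

open MeasureTheory ProbabilityTheory Filter Topology Set InformationTheory Asymptotics
open scoped ENNReal NNReal

noncomputable section

/-- The stationary memoryless extension `P_{Y|X} × ⋯ × P_{Y|X}` (`n` factors) of a channel. -/
def memorylessChannel {A B : Type*} [MeasurableSpace A] [MeasurableSpace B]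
    (κ : Kernel A B) [IsMarkovKernel κ] (n : ℕ) : Kernel (Fin n → A) (Fin n → B) where
  toFun x := Measure.pi fun i => κ (x i)
  measurable' := by
    refine Measurable.measure_of_isPiSystem_of_isProbabilityMeasure
      generateFrom_pi.symm isPiSystem_pi ?_
    rintro s ⟨t, ht, rfl⟩
    have ht' : ∀ i, MeasurableSet (t i) := fun i => ht i (mem_univ i)
    simp only [Measure.pi_pi]
    exact Finset.measurable_prod _ fun i _ =>
      (κ.measurable_coe (ht' i)).comp (measurable_pi_apply i)

/-- Separable cost `b_n(x^n) = (1/n) ∑ b(x_i)`. -/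
def blockCost {A : Type*} (b : A → ℝ≥0∞) (n : ℕ) (x : Fin n → A) : ℝ≥0∞ :=
  (∑ i, b (x i)) / (n : ℝ≥0∞)

/-- An `(M, ε, β)` code for a channel `W` with cost function `c`: a stochastic encoder and a
stochastic decoder, with `M` equiprobable messages, average error probability
`P[S ≠ Z] ≤ ε`, and every codeword of cost at most `β` almost surely. -/
def HasCode {X Y : Type*} [MeasurableSpace X] [MeasurableSpace Y]
    (W : Kernel X Y) (c : X → ℝ≥0∞) (M : ℕ) (ε : ℝ) (β : ℝ≥0∞) : Prop :=
  0 < M ∧ ∃ (enc : Kernel (Fin M) X) (dec : Kernel Y (Fin M)),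
    IsMarkovKernel enc ∧ IsMarkovKernel dec ∧
    (∀ m, ∀ᵐ x ∂(enc m), c x ≤ β) ∧
    (M : ℝ≥0∞)⁻¹ * ∑ m, (dec ∘ₖ (W ∘ₖ enc)) m {m}ᶜ ≤ ENNReal.ofReal ε

/-- `M*(n, ε, β)`, the maximum size of an `(n, M, ε, β)` code (`⊤` if unbounded). -/
def maxCodeSize {A B : Type*} [MeasurableSpace A] [MeasurableSpace B]
    (κ : Kernel A B) [IsMarkovKernel κ] (b : A → ℝ≥0∞) (n : ℕ) (ε : ℝ) (β : ℝ≥0∞) : ℕ∞ :=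
  ⨆ (M : ℕ) (_ : HasCode (memorylessChannel κ n) (blockCost b n) M ε β), (M : ℕ∞)

/-- `log M*(n, ε, β)` in nats (meaningful when `M*` is finite). -/
def logMaxCodeSize {A B : Type*} [MeasurableSpace A] [MeasurableSpace B]
    (κ : Kernel A B) [IsMarkovKernel κ] (b : A → ℝ≥0∞) (n : ℕ) (ε : ℝ) (β : ℝ≥0∞) : ℝ :=
  Real.log ((maxCodeSize κ b n ε β).toNat : ℝ)

/-- Mutual information `I(X;Y) = E[log dP_{Y|X}/dP_Y (Y)]` for input law `P` and channel `κ`,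
as the average over the input of the relative entropy between `P_{Y|X=x}` and the output law. -/
def channelMutualInfo {A B : Type*} [MeasurableSpace A] [MeasurableSpace B]
    (P : Measure A) (κ : Kernel A B) : ℝ≥0∞ :=
  ∫⁻ x, klDiv (κ x) (κ ∘ₘ P) ∂P

/-- Capacity-cost function `C(γ) = sup {I(X;Y) : E[b(X)] ≤ γ}`. -/
def capacityCost {A B : Type*} [MeasurableSpace A] [MeasurableSpace B]
    (κ : Kernel A B) (b : A → ℝ≥0∞) (γ : ℝ≥0∞) : ℝ≥0∞ :=
  ⨆ (P : Measure A) (_ : IsProbabilityMeasure P) (_ : ∫⁻ x, b x ∂P ≤ γ), channelMutualInfo P κ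

/-- `λ* = C'(β)`. -/
def lambdaStar {A B : Type*} [MeasurableSpace A] [MeasurableSpace B]
    (κ : Kernel A B) (b : A → ℝ≥0∞) (β : ℝ) : ℝ :=
  deriv (fun γ : ℝ => (capacityCost κ b (ENNReal.ofReal γ)).toReal) β

/-- The function `j(x; y, β) = log (dP_{Y|X=x}/dν)(y) - λ* (b(x) - β)`; it is the `b`-tilted
information density when `ν` is the capacity-cost achieving output law. It is used only at
inputs `x` of finite cost. -/
def bTilted {A B : Type*} [MeasurableSpace A] [MeasurableSpace B]
    (κ : Kernel A B) (b : A → ℝ≥0∞) (ν : Measure B) (β : ℝ) (x : A) (y : B) : ℝ :=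
  llr (κ x) ν y - lambdaStar κ b β * ((b x).toReal - β)

/-- `F_n`, the set of input blocks of cost exactly `β`. -/
def costShell {A : Type*} (b : A → ℝ≥0∞) (β : ℝ≥0∞) (n : ℕ) : Set (Fin n → A) :=
  {x | blockCost b n x = β}

/-- `Q⁻¹`, the inverse of the standard Gaussian complementary cdf `Q(t) = P[N(0,1) > t]`. -/
def gaussianQInv (ε : ℝ) : ℝ :=
  sInf {t : ℝ | (gaussianReal 0 1).real (Ioi t) ≤ ε}

/-- `V` is the dispersion-cost function at `β`:
`V = lim_{ε → 0} limsup_{n → ∞} (1/n) (n C(β) - log M*(n, ε, β))² / (2 log (1/ε))`. -/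
def IsDispersionCost {A B : Type*} [MeasurableSpace A] [MeasurableSpace B]
    (κ : Kernel A B) [IsMarkovKernel κ] (b : A → ℝ≥0∞) (β : ℝ≥0∞) (V : ℝ) : Prop :=
  Tendsto (fun ε : ℝ => limsup (fun n : ℕ =>
      (((1 / (n : ℝ)) * ((n * (capacityCost κ b β).toReal - logMaxCodeSize κ b n ε β) ^ 2
        / (2 * Real.log (1 / ε))) : ℝ) : EReal)) atTop)
    (𝓝[>] 0) (𝓝 (V : EReal))

end

/-! Let `ν` be the capacity-achieving output law. By (b) the information density against `ν^n` has
one law on the whole cost shell, and by (a) the shell contains the constant block `(x₁, …, x₁)` with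
`b x₁ = β`. That law is therefore the `n`-fold convolution power of the law `μ` of the single-letter
density at `x₁`. Coding on the shell thus reduces to tails of sums of independent copies of `μ`,
whose mean is `C(β)` and whose variance is `V`.

Mean. Mixing a weight `exp (-a)` of another admissible input into the optimal one would gain about
`a * exp (-a)` of mutual information for each unit of output mass outside the support of `ν`.
Optimality excludes this as `a → ∞`, so `κ x ≪ ν` for every `x` of finite cost
(`bind_absolutelyContinuous_of_optimal`, `kernel_absolutelyContinuous_of_optimal`). The divergence
`D(x)` of `κ x` from `ν` then has a constant sum over each shell. A Cauchy functional equation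
forces `D` to be affine in the cost (`exists_integral_llr_affine`), and averaging over `PX`, whose
mean cost is `β`, gives `D(x₁) = C(β)` (`klDiv_eq_capacityCost`).

Converse. A block of cost at most `β` reaches the shell of length `n + 1` by one extra letter, so
every code can be tested against `ν^n` at the price of one more summand (`hasCode_converse`). The
threshold `log M - (1/2) log (n + 1)` leads to the term `(1/2) log n`.

Achievability. Feinstein's maximal code is built inside the shell. The input law of (d) compares its
output law with `ν^n` at the price of a factor `exp (f n)` (`exists_hasCode_le`). A unit interval
has mass `O(1/√n)` under the law of the sum, and this cancels the slack `1/√n` left in the error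
probability, so that no logarithm is lost (`measure_likelySet_le`, `exists_le_log`).

Both directions rest on the Berry–Esseen theorem (`exists_berry_esseen`). It is proved by
Lindeberg's exchange of summands under an additional Gaussian smoothing, by induction on the number
of summands: the smoothed third derivative of the law of `k` summands is controlled by the bound
already known for that `k`. The dispersion follows from `Q⁻¹(ε)² ~ 2 log (1/ε)` as `ε → 0`. -/

namespace CostDispersion


/-! ### The standard Gaussian density, its derivatives and its distribution function -/

/-- The standard Gaussian density. -/
noncomputable def stdPDF (x : ℝ) : ℝ := gaussianPDFReal 0 1 x

/-- The standard Gaussian distribution function. -/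
noncomputable def stdCDF (x : ℝ) : ℝ := (gaussianReal 0 1).real (Iic x)

lemma stdPDF_eq (x : ℝ) : stdPDF x = (Real.sqrt (2 * Real.pi))⁻¹ * Real.exp (-x ^ 2 / 2) := by
  simp [stdPDF, gaussianPDFReal]

lemma stdPDF_pos (x : ℝ) : 0 < stdPDF x := gaussianPDFReal_pos _ _ _ one_ne_zero

lemma inv_sqrt_two_pi_le_one : (Real.sqrt (2 * Real.pi))⁻¹ ≤ 1 := by
  apply inv_le_one_of_one_le₀
  rw [Real.one_le_sqrt]
  linarith [Real.pi_gt_three]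

lemma stdPDF_le_one (x : ℝ) : stdPDF x ≤ 1 := by
  rw [stdPDF_eq]
  have h2 : Real.exp (-x ^ 2 / 2) ≤ 1 := by
    rw [Real.exp_le_one_iff]; nlinarith [sq_nonneg x]
  exact mul_le_one₀ inv_sqrt_two_pi_le_one (Real.exp_pos _).le h2

lemma sq_mul_stdPDF_le (x : ℝ) : x ^ 2 * stdPDF x ≤ 2 := by
  rw [stdPDF_eq]
  have h1 : x ^ 2 / 2 * Real.exp (-x ^ 2 / 2) ≤ 1 := by
    have := Real.add_one_le_exp (x ^ 2 / 2)
    rw [show -x ^ 2 / 2 = -(x ^ 2 / 2) by ring, Real.exp_neg]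
    rw [mul_inv_le_iff₀ (Real.exp_pos _)]
    linarith
  have h3 := inv_sqrt_two_pi_le_one
  have h4 : 0 ≤ (Real.sqrt (2 * Real.pi))⁻¹ := by positivity
  have h5 : 0 ≤ x ^ 2 / 2 * Real.exp (-x ^ 2 / 2) := by positivity
  nlinarith

lemma hasDerivAt_stdPDF (x : ℝ) : HasDerivAt stdPDF (-x * stdPDF x) x := by
  have h : HasDerivAt (fun x : ℝ => (Real.sqrt (2 * Real.pi))⁻¹ * Real.exp (-x ^ 2 / 2))
      ((Real.sqrt (2 * Real.pi))⁻¹ * (Real.exp (-x ^ 2 / 2) * (-(2 * x) / 2))) x := by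
    have := (((hasDerivAt_pow 2 x).neg.div_const 2).exp).const_mul (Real.sqrt (2 * Real.pi))⁻¹
    simpa using this
  have e : stdPDF = fun x : ℝ => (Real.sqrt (2 * Real.pi))⁻¹ * Real.exp (-x ^ 2 / 2) :=
    funext stdPDF_eq
  rw [e]
  convert h using 1
  ring

lemma continuous_stdPDF : Continuous stdPDF :=
  continuous_iff_continuousAt.2 fun x => (hasDerivAt_stdPDF x).continuousAt

lemma hasDerivAt_stdPDF_two (x : ℝ) :
    HasDerivAt (fun x => -x * stdPDF x) ((x ^ 2 - 1) * stdPDF x) x := by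
  convert! (hasDerivAt_neg x).mul (hasDerivAt_stdPDF x) using 1
  ring

lemma hasDerivAt_stdPDF_three (x : ℝ) :
    HasDerivAt (fun x => (x ^ 2 - 1) * stdPDF x) ((3 * x - x ^ 3) * stdPDF x) x := by
  convert! ((hasDerivAt_pow 2 x).sub_const 1).mul (hasDerivAt_stdPDF x) using 1
  simp
  ring

lemma abs_stdPDF_two_le (x : ℝ) : |-x * stdPDF x| ≤ 3 := by
  have h1 := stdPDF_le_one x
  have h2 := sq_mul_stdPDF_le x
  have h3 := stdPDF_pos x
  rw [abs_le]
  constructor <;> nlinarith [mul_nonneg (sq_nonneg (x - 1)) h3.le, mul_nonneg (sq_nonneg (x + 1)) h3.le]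

lemma abs_stdPDF_three_le (x : ℝ) : |(x ^ 2 - 1) * stdPDF x| ≤ 2 := by
  have h1 := stdPDF_le_one x
  have h2 := sq_mul_stdPDF_le x
  have h3 := stdPDF_pos x
  have h4 : 0 ≤ x ^ 2 * stdPDF x := by positivity
  rw [abs_le]
  constructor <;> nlinarith

lemma integrable_stdPDF_four : Integrable (fun x : ℝ => (3 * x - x ^ 3) * stdPDF x) := by
  have h1 : Integrable (fun x : ℝ => (3 * x - x ^ 3)) (gaussianReal 0 1) := by
    have a : Integrable (fun x : ℝ => x) (gaussianReal 0 1) :=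
      (memLp_id_gaussianReal' 1 (by simp)).integrable le_rfl
    have c : MemLp (fun x : ℝ => x) 3 (gaussianReal 0 1) := memLp_id_gaussianReal' 3 (by simp)
    have c' : Integrable (fun x : ℝ => x ^ 3) (gaussianReal 0 1) := by
      have := c.integrable_norm_pow (by norm_num)
      refine this.mono' (by fun_prop) (ae_of_all _ fun x => ?_)
      simp
    exact (a.const_mul 3).sub c'
  rw [gaussianReal_of_var_ne_zero _ one_ne_zero,
    integrable_withDensity_iff_integrable_smul' (measurable_gaussianPDF 0 1)
      (ae_of_all _ fun _ => gaussianPDF_lt_top)] at h1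
  refine h1.congr (ae_of_all _ fun x => ?_)
  simp [stdPDF, toReal_gaussianPDF, mul_comm]

lemma hasDerivAt_stdCDF (x : ℝ) : HasDerivAt stdCDF (stdPDF x) x := by
  have hI : Integrable stdPDF := integrable_gaussianPDFReal 0 1
  have e : stdCDF = fun x => (∫ y in Iic (0 : ℝ), stdPDF y) + ∫ y in (0 : ℝ)..x, stdPDF y := by
    funext x
    rw [stdCDF, Measure.real, gaussianReal_apply_eq_integral _ one_ne_zero,
      ENNReal.toReal_ofReal (integral_nonneg fun y => gaussianPDFReal_nonneg _ _ y)]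
    have := intervalIntegral.integral_Iic_sub_Iic (hI.integrableOn (s := Iic 0))
      (hI.integrableOn (s := Iic x))
    rw [← this]; simp [stdPDF]
  rw [e]
  exact (intervalIntegral.integral_hasDerivAt_right hI.intervalIntegrable
    continuous_stdPDF.stronglyMeasurable.stronglyMeasurableAtFilter
    continuous_stdPDF.continuousAt).const_add _

lemma continuous_stdCDF : Continuous stdCDF :=
  continuous_iff_continuousAt.2 fun x => (hasDerivAt_stdCDF x).continuousAt

lemma stdCDF_nonneg (x : ℝ) : 0 ≤ stdCDF x := measureReal_nonneg

lemma stdCDF_le_one (x : ℝ) : stdCDF x ≤ 1 := measureReal_le_one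

lemma strictMono_stdCDF : StrictMono stdCDF :=
  strictMono_of_deriv_pos fun x => by rw [(hasDerivAt_stdCDF x).deriv]; exact stdPDF_pos x

lemma abs_stdCDF_sub_le (x y : ℝ) : |stdCDF y - stdCDF x| ≤ |y - x| := by
  have := Convex.norm_image_sub_le_of_norm_hasDerivWithin_le (f := stdCDF) (f' := stdPDF)
    (s := univ) (x := x) (y := y) (C := 1)
    (fun x _ => (hasDerivAt_stdCDF x).hasDerivWithinAt)
    (fun x _ => by rw [Real.norm_of_nonneg (stdPDF_pos x).le]; exact stdPDF_le_one x)
    convex_univ (mem_univ _) (mem_univ _)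
  simpa using this

lemma gaussianReal_real_Iic {v : ℝ≥0} (hv : v ≠ 0) (x : ℝ) :
    (gaussianReal 0 v).real (Iic x) = stdCDF (x / Real.sqrt v) := by
  have hs : 0 < Real.sqrt v := Real.sqrt_pos.2 (by exact_mod_cast pos_iff_ne_zero.2 hv)
  have h := gaussianReal_map_const_mul (μ := 0) (v := 1) (Real.sqrt v)
  have e : (NNReal.mk (Real.sqrt v ^ 2) (by positivity)) * 1 = v := by
    ext; simp
  rw [mul_zero] at h
  rw [stdCDF, Measure.real, Measure.real]
  congr 1
  have h2 : gaussianReal 0 v = (gaussianReal 0 1).map (fun y => Real.sqrt v * y) := by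
    rw [h]; congr 1; exact e.symm
  rw [h2, Measure.map_apply (by fun_prop) measurableSet_Iic]
  congr 1
  ext y
  simp [le_div_iff₀ hs, mul_comm]


/-! ### Convolutions and Gaussian smoothing of distribution functions -/

lemma conv_real_Iic (μ ρ : Measure ℝ) [IsProbabilityMeasure μ] [IsProbabilityMeasure ρ] (x : ℝ) :
    (μ ∗ ρ).real (Iic x) = ∫ y, ρ.real (Iic (x - y)) ∂μ := by
  have h : (μ ∗ ρ) (Iic x) = ∫⁻ y, ρ (Iic (x - y)) ∂μ := by
    rw [Measure.conv, Measure.map_apply measurable_add measurableSet_Iic,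
      Measure.prod_apply (measurable_add measurableSet_Iic)]
    refine lintegral_congr fun y => ?_
    congr 1
    ext z
    simp [le_sub_iff_add_le, add_comm]
  rw [Measure.real, h, integral_eq_lintegral_of_nonneg_ae (ae_of_all _ fun _ => measureReal_nonneg)]
  · congr 1
    refine lintegral_congr fun y => ?_
    rw [ofReal_measureReal]
  · have : Antitone fun y => ρ.real (Iic (x - y)) := fun a b hab =>
      measureReal_mono (Iic_subset_Iic.2 (by linarith))
    exact this.measurable.aestronglyMeasurable

/-- `i`-th scaled Gaussian smoothing of a function `g` against `L`. -/
noncomputable def smooth (g : ℝ → ℝ) (i : ℕ) (L : Measure ℝ) (s x : ℝ) : ℝ :=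
  (s⁻¹) ^ i * ∫ w, g ((x - w) / s) ∂L

/-- Differentiation under the integral sign; each derivative in `x` brings out one factor `s⁻¹`,
which the index `i` counts. -/
lemma hasDerivAt_smooth {g g' : ℝ → ℝ} (hg : ∀ x, HasDerivAt g (g' x) x) {B B' : ℝ}
    (hB : ∀ x, |g x| ≤ B) (hg' : Measurable g') (hB' : ∀ x, |g' x| ≤ B') (i : ℕ)
    (L : Measure ℝ) [IsProbabilityMeasure L] (s x : ℝ) :
    HasDerivAt (smooth g i L s) (smooth g' (i + 1) L s x) x := by
  have hgc : Continuous g := continuous_iff_continuousAt.2 fun x => (hg x).continuousAt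
  have key := (hasDerivAt_integral_of_dominated_loc_of_deriv_le (μ := L) (𝕜 := ℝ)
    (F := fun x w => g ((x - w) / s)) (F' := fun x w => g' ((x - w) / s) * s⁻¹) (x₀ := x)
    (s := univ) (bound := fun _ => B' * |s⁻¹|) univ_mem
    (Eventually.of_forall fun y => by
      exact (hgc.comp (by fun_prop)).aestronglyMeasurable)
    (Integrable.of_bound (hgc.comp (by fun_prop)).aestronglyMeasurable B
      (ae_of_all _ fun w => hB _))
    (((hg'.comp (by fun_prop)).mul_const _).aestronglyMeasurable)
    (ae_of_all _ fun w y _ => by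
      rw [norm_mul]
      exact mul_le_mul_of_nonneg_right (hB' _) (norm_nonneg _))
    (integrable_const _)
    (ae_of_all _ fun w y _ => by
      have h1 : HasDerivAt (fun y : ℝ => (y - w) / s) s⁻¹ y := by
        simpa [div_eq_mul_inv] using ((hasDerivAt_id y).sub_const w).div_const s
      exact (hg _).comp y h1)).2
  have := key.const_mul ((s⁻¹) ^ i)
  convert! this using 1
  rw [smooth, integral_mul_const, pow_succ]
  ring

lemma smooth_stdCDF_eq (L : Measure ℝ) [IsProbabilityMeasure L] {v : ℝ≥0} (hv : v ≠ 0) (x : ℝ) :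
    smooth stdCDF 0 L (Real.sqrt v) x = (L ∗ gaussianReal 0 v).real (Iic x) := by
  simp [smooth, conv_real_Iic, gaussianReal_real_Iic hv]

lemma abs_stdCDF_le (x : ℝ) : |stdCDF x| ≤ 1 := by
  rw [abs_of_nonneg (stdCDF_nonneg x)]; exact stdCDF_le_one x

lemma abs_stdPDF_le (x : ℝ) : |stdPDF x| ≤ 1 := by
  rw [abs_of_nonneg (stdPDF_pos x).le]; exact stdPDF_le_one x

lemma measurable_stdPDF_two : Measurable (fun x => -x * stdPDF x) :=
  (continuous_id.neg.mul continuous_stdPDF).measurable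

lemma measurable_stdPDF_three : Measurable (fun x => (x ^ 2 - 1) * stdPDF x) :=
  (((continuous_id.pow 2).sub continuous_const).mul continuous_stdPDF).measurable

lemma hasDerivAt_smooth_zero (L : Measure ℝ) [IsProbabilityMeasure L] (s x : ℝ) :
    HasDerivAt (smooth stdCDF 0 L s) (smooth stdPDF 1 L s x) x :=
  hasDerivAt_smooth hasDerivAt_stdCDF abs_stdCDF_le continuous_stdPDF.measurable abs_stdPDF_le 0 L s x

lemma hasDerivAt_smooth_one (L : Measure ℝ) [IsProbabilityMeasure L] (s x : ℝ) :
    HasDerivAt (smooth stdPDF 1 L s) (smooth (fun x => -x * stdPDF x) 2 L s x) x :=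
  hasDerivAt_smooth hasDerivAt_stdPDF abs_stdPDF_le measurable_stdPDF_two abs_stdPDF_two_le 1 L s x

lemma hasDerivAt_smooth_two (L : Measure ℝ) [IsProbabilityMeasure L] (s x : ℝ) :
    HasDerivAt (smooth (fun x => -x * stdPDF x) 2 L s)
      (smooth (fun x => (x ^ 2 - 1) * stdPDF x) 3 L s x) x :=
  hasDerivAt_smooth hasDerivAt_stdPDF_two abs_stdPDF_two_le measurable_stdPDF_three
    abs_stdPDF_three_le 2 L s x

/-- The third derivative of a smoothed distribution function is determined by the smoothed
function. -/
lemma smooth_three_congr {L L' : Measure ℝ} [IsProbabilityMeasure L] [IsProbabilityMeasure L']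
    {s s' : ℝ} (h : smooth stdCDF 0 L s = smooth stdCDF 0 L' s') (x : ℝ) :
    smooth (fun x => (x ^ 2 - 1) * stdPDF x) 3 L s x =
      smooth (fun x => (x ^ 2 - 1) * stdPDF x) 3 L' s' x := by
  have h1 : smooth stdPDF 1 L s = smooth stdPDF 1 L' s' := funext fun x =>
    (hasDerivAt_smooth_zero L s x).unique (h ▸ hasDerivAt_smooth_zero L' s' x)
  have h2 : smooth (fun x => -x * stdPDF x) 2 L s = smooth (fun x => -x * stdPDF x) 2 L' s' :=
    funext fun x => (hasDerivAt_smooth_one L s x).unique (h1 ▸ hasDerivAt_smooth_one L' s' x)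
  exact (hasDerivAt_smooth_two L s x).unique (h2 ▸ hasDerivAt_smooth_two L' s' x)

/-- Smoothing a Gaussian of variance `v` by one of variance `w` is the same as smoothing a point
mass with variance `v + w`. The third derivative depends only on the resulting function, so the
bound improves from `w` to `v + w`. -/
lemma abs_smooth_three_gaussian_le {v w : ℝ≥0} (hw : w ≠ 0) (x : ℝ) :
    |smooth (fun x => (x ^ 2 - 1) * stdPDF x) 3 (gaussianReal 0 v) (Real.sqrt w) x| ≤
      2 * ((Real.sqrt (v + w : ℝ≥0))⁻¹) ^ 3 := by
  have hvw : v + w ≠ 0 := by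
    intro h; exact hw (by simpa using (add_eq_zero.1 h).2)
  have h : smooth stdCDF 0 (gaussianReal 0 v) (Real.sqrt w) =
      smooth stdCDF 0 (Measure.dirac 0) (Real.sqrt (v + w : ℝ≥0)) := by
    funext y
    rw [smooth_stdCDF_eq _ hw, smooth_stdCDF_eq _ hvw, gaussianReal_conv_gaussianReal,
      Measure.dirac_zero_conv, add_zero]
  rw [smooth_three_congr h, smooth, integral_dirac, abs_mul, abs_pow, abs_inv,
    abs_of_nonneg (Real.sqrt_nonneg _), mul_comm]
  exact mul_le_mul_of_nonneg_right (abs_stdPDF_three_le _) (by positivity)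

/-- If the distribution functions of `L` and `G` are uniformly `δ`-close, then the integrals of a
function of finite variation vanishing at infinity are close. -/
lemma abs_integral_sub_integral_le {g g' : ℝ → ℝ} (hg : ∀ x, HasDerivAt g (g' x) x)
    (hg' : Integrable g') (h0 : Tendsto g atTop (𝓝 0))
    (L G : Measure ℝ) [IsProbabilityMeasure L] [IsProbabilityMeasure G] {δ : ℝ}
    (hδ : ∀ x, |L.real (Iic x) - G.real (Iic x)| ≤ δ) :
    |∫ w, g w ∂L - ∫ w, g w ∂G| ≤ δ * ∫ u, |g' u| := by
  -- Integration by parts: `g w` is minus the integral of `g'` over `[w, ∞)`, and Fubini turns the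
  -- integral of `g` into one of `g'` against the distribution function.
  have key : ∀ (M : Measure ℝ) [IsProbabilityMeasure M],
      ∫ w, g w ∂M = -∫ u, g' u * M.real (Iic u) := by
    intro M _
    have e1 : ∀ w, g w = -∫ u, (Ici w).indicator g' u := by
      intro w
      rw [integral_indicator measurableSet_Ici, integral_Ici_eq_integral_Ioi,
        integral_Ioi_of_hasDerivAt_of_tendsto (hg w).continuousAt.continuousWithinAt
          (fun x _ => hg x) hg'.integrableOn h0]
      ring
    rw [integral_congr_ae (ae_of_all _ e1), integral_neg]
    congr 1
    have hmeas : MeasurableSet {p : ℝ × ℝ | p.1 ≤ p.2} := measurableSet_le measurable_fst measurable_snd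
    have hint : Integrable (Function.uncurry fun w u => (Ici w).indicator g' u) (M.prod volume) := by
      have h1 : Integrable (fun p : ℝ × ℝ => g' p.2) (M.prod volume) := hg'.comp_snd M
      refine (h1.indicator hmeas).congr (ae_of_all _ fun p => ?_)
      simp [Function.uncurry, indicator]
    rw [integral_integral_swap hint]
    refine integral_congr_ae (ae_of_all _ fun u => ?_)
    have : (fun w => (Ici w).indicator g' u) = (Iic u).indicator fun _ => g' u := by
      funext w; simp [indicator]
    simp only [this]
    rw [integral_indicator measurableSet_Iic, setIntegral_const, smul_eq_mul, mul_comm]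
  have hi : ∀ (M : Measure ℝ) [IsProbabilityMeasure M],
      Integrable fun u => g' u * M.real (Iic u) := by
    intro M _
    have hm : Monotone fun u => M.real (Iic u) := fun a b hab =>
      measureReal_mono (Iic_subset_Iic.2 hab)
    exact hg'.mul_bdd (c := 1) hm.measurable.aestronglyMeasurable (ae_of_all _ fun u => by
      rw [Real.norm_of_nonneg measureReal_nonneg]; exact measureReal_le_one)
  rw [key L, key G, neg_sub_neg, ← integral_sub (hi G) (hi L), ← integral_const_mul]
  refine (abs_integral_le_integral_abs).trans (integral_mono ((hi G).sub (hi L)).abs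
    (hg'.abs.const_mul δ) fun u => ?_)
  simp only [← mul_sub, abs_mul]
  rw [mul_comm, abs_sub_comm]
  exact mul_le_mul_of_nonneg_right (hδ u) (abs_nonneg _)


lemma tendsto_stdPDF_three : Tendsto (fun x : ℝ => (x ^ 2 - 1) * stdPDF x) atTop (𝓝 0) := by
  have hI : Integrable (fun x : ℝ => (x ^ 2 - 1) * stdPDF x) := by
    have h1 : Integrable (fun x : ℝ => (x ^ 2 - 1)) (gaussianReal 0 1) := by
      have c : MemLp (fun x : ℝ => x) 2 (gaussianReal 0 1) := memLp_id_gaussianReal' 2 (by simp)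
      exact c.integrable_sq.sub (integrable_const 1)
    rw [gaussianReal_of_var_ne_zero _ one_ne_zero,
      integrable_withDensity_iff_integrable_smul' (measurable_gaussianPDF 0 1)
        (ae_of_all _ fun _ => gaussianPDF_lt_top)] at h1
    refine h1.congr (ae_of_all _ fun x => ?_)
    simp [stdPDF, toReal_gaussianPDF, mul_comm]
  exact tendsto_zero_of_hasDerivAt_of_integrableOn_Ioi (a := 0)
    (fun x _ => hasDerivAt_stdPDF_three x) integrable_stdPDF_four.integrableOn hI.integrableOn

/-- The total variation of the third derivative of the Gaussian distribution function. -/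
noncomputable def fourthConst : ℝ := ∫ x, |(3 * x - x ^ 3) * stdPDF x|

lemma fourthConst_nonneg : 0 ≤ fourthConst := integral_nonneg fun _ => abs_nonneg _

/-- The exact Gaussian contributes the scale `(v + w)^(-3/2)`. Only the deviation `δ` from it is
paid at the worse scale `w^(-3/2)`. In the induction `δ` is already of order `1/√k`. -/
lemma abs_smooth_three_le {L : Measure ℝ} [IsProbabilityMeasure L] {v w : ℝ≥0} (hw : w ≠ 0) {δ : ℝ}
    (hδ : ∀ x, |L.real (Iic x) - (gaussianReal 0 v).real (Iic x)| ≤ δ) (x : ℝ) :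
    |smooth (fun x => (x ^ 2 - 1) * stdPDF x) 3 L (Real.sqrt w) x| ≤
      2 * ((Real.sqrt (v + w : ℝ≥0))⁻¹) ^ 3 + ((Real.sqrt w)⁻¹) ^ 3 * (δ * fourthConst) := by
  have hs : 0 < Real.sqrt w := Real.sqrt_pos.2 (by exact_mod_cast pos_iff_ne_zero.2 hw)
  set s := Real.sqrt w with hsdef
  set g : ℝ → ℝ := fun u => (((u - x) / s) ^ 2 - 1) * stdPDF ((u - x) / s) with hgdef
  set g' : ℝ → ℝ := fun u => (3 * ((u - x) / s) - ((u - x) / s) ^ 3) * stdPDF ((u - x) / s) * s⁻¹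
    with hg'def
  have hg : ∀ u, HasDerivAt g (g' u) u := fun u => by
    have h1 : HasDerivAt (fun y : ℝ => (y - x) / s) s⁻¹ u := by
      simpa [div_eq_mul_inv] using ((hasDerivAt_id u).sub_const x).div_const s
    exact HasDerivAt.comp (h₂ := fun x => (x ^ 2 - 1) * stdPDF x) u
      (hasDerivAt_stdPDF_three ((u - x) / s)) h1
  have hg'i : Integrable g' :=
    ((integrable_stdPDF_four.comp_div hs.ne').comp_sub_right x).mul_const _
  have h0 : Tendsto g atTop (𝓝 0) := by
    refine tendsto_stdPDF_three.comp ?_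
    exact (tendsto_atTop_add_const_right _ (-x) tendsto_id).atTop_div_const hs
  -- The third derivative of the Gaussian distribution function is even, so `x - u` may be replaced
  -- by `u - x`.
  have hsymm : ∀ M : Measure ℝ, smooth (fun x => (x ^ 2 - 1) * stdPDF x) 3 M s x =
      (s⁻¹) ^ 3 * ∫ u, g u ∂M := by
    intro M
    rw [smooth]
    congr 1
    refine integral_congr_ae (ae_of_all _ fun u => ?_)
    simp only [hgdef]
    rw [show (x - u) / s = -((u - x) / s) by ring, stdPDF_eq, stdPDF_eq]
    simp
  have hvar : ∫ u, |g' u| = fourthConst := by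
    have e : (fun u => |g' u|) = fun u => s⁻¹ * (fun y =>
        (fun z : ℝ => |(3 * z - z ^ 3) * stdPDF z|) (y / s)) (u - x) := by
      funext u
      simp only [hg'def]
      rw [abs_mul _ s⁻¹, abs_of_pos (inv_pos.2 hs), mul_comm]
    rw [e, integral_const_mul, integral_sub_right_eq_self (fun y =>
        (fun z : ℝ => |(3 * z - z ^ 3) * stdPDF z|) (y / s)) x,
      Measure.integral_comp_div (fun z : ℝ => |(3 * z - z ^ 3) * stdPDF z|) s,
      abs_of_pos hs, smul_eq_mul, ← mul_assoc, inv_mul_cancel₀ hs.ne', one_mul]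
    rfl
  have h1 := abs_integral_sub_integral_le hg hg'i h0 L (gaussianReal 0 v) hδ
  have h2 := abs_smooth_three_gaussian_le (v := v) hw x
  rw [← hsdef, hsymm] at h2
  rw [hsymm]
  have hs3 : 0 ≤ (s⁻¹) ^ 3 := by positivity
  have e3 : (s⁻¹) ^ 3 * ∫ u, g u ∂L = (s⁻¹) ^ 3 * ∫ u, g u ∂(gaussianReal 0 v) +
      (s⁻¹) ^ 3 * (∫ u, g u ∂L - ∫ u, g u ∂(gaussianReal 0 v)) := by ring
  rw [e3]
  refine (abs_add_le _ _).trans (add_le_add h2 ?_)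
  rw [abs_mul, abs_of_nonneg hs3, ← hvar]
  exact mul_le_mul_of_nonneg_left h1 hs3

/-! ### The swapping step -/

lemma abs_le_mul_of_hasDerivAt {g g' : ℝ → ℝ} (hg : ∀ x, HasDerivAt g (g' x) x) (h0 : g 0 = 0)
    {C h : ℝ} (hC : ∀ u, |u| ≤ |h| → |g' u| ≤ C) (u : ℝ) (hu : |u| ≤ |h|) : |g u| ≤ C * |h| := by
  have hC0 : 0 ≤ C := (abs_nonneg _).trans (hC 0 (by simp))
  have := Convex.norm_image_sub_le_of_norm_hasDerivWithin_le (f := g) (f' := g')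
    (s := Icc (-|h|) |h|) (x := 0) (y := u) (C := C)
    (fun x _ => (hg x).hasDerivWithinAt) (fun x hx => hC x (abs_le.2 hx)) (convex_Icc _ _)
    ⟨by simp, by simp⟩ (abs_le.1 hu)
  simp only [h0, sub_zero, Real.norm_eq_abs] at this
  exact this.trans (mul_le_mul_of_nonneg_left hu hC0)

/-- Three mean value inequalities in a row; the constant `1` in place of `1/6` is good enough. -/
lemma abs_taylor_two_le {f f1 f2 f3 : ℝ → ℝ} (h1 : ∀ x, HasDerivAt f (f1 x) x)
    (h2 : ∀ x, HasDerivAt f1 (f2 x) x) (h3 : ∀ x, HasDerivAt f2 (f3 x) x) {B : ℝ}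
    (hB : ∀ x, |f3 x| ≤ B) (a h : ℝ) :
    |f (a + h) - f a - f1 a * h - f2 a * (h ^ 2 / 2)| ≤ B * |h| ^ 3 := by
  have sh : ∀ {g g' : ℝ → ℝ}, (∀ x, HasDerivAt g (g' x) x) → ∀ u,
      HasDerivAt (fun u => g (a + u)) (g' (a + u)) u := fun hg u => by
    simpa using (hg (a + u)).comp_const_add a u
  have A : ∀ u, |u| ≤ |h| → |f2 (a + u) - f2 a| ≤ B * |h| := fun u hu =>
    abs_le_mul_of_hasDerivAt (g := fun u => f2 (a + u) - f2 a) (g' := fun u => f3 (a + u))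
      (fun u => (sh h3 u).sub_const _) (by simp) (fun u _ => hB _) u hu
  have A2 : ∀ u, |u| ≤ |h| → |f1 (a + u) - f1 a - f2 a * u| ≤ B * |h| * |h| := fun u hu =>
    abs_le_mul_of_hasDerivAt (g := fun u => f1 (a + u) - f1 a - f2 a * u)
      (g' := fun u => f2 (a + u) - f2 a)
      (fun u => by
        convert! ((sh h2 u).sub_const (f1 a)).sub ((hasDerivAt_id u).const_mul (f2 a)) using 1
        simp)
      (by simp) A u hu
  have A3 := abs_le_mul_of_hasDerivAt
      (g := fun u => f (a + u) - f a - f1 a * u - f2 a * (u ^ 2 / 2))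
      (g' := fun u => f1 (a + u) - f1 a - f2 a * u) (h := h)
      (fun u => by
        have e := (((sh h1 u).sub_const (f a)).sub ((hasDerivAt_id u).const_mul (f1 a))).sub
          (((hasDerivAt_pow 2 u).div_const 2).const_mul (f2 a))
        convert! e using 1
        simp)
      (by simp) A2 h le_rfl
  refine A3.trans_eq ?_
  ring

/-- Replacing a summand by another one with the same first two moments. -/
lemma abs_integral_sub_le_of_moments {f f1 f2 f3 : ℝ → ℝ} (h1 : ∀ x, HasDerivAt f (f1 x) x)
    (h2 : ∀ x, HasDerivAt f1 (f2 x) x) (h3 : ∀ x, HasDerivAt f2 (f3 x) x) {B : ℝ}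
    (hB : ∀ x, |f3 x| ≤ B) {M : ℝ} (hM : ∀ x, |f x| ≤ M)
    (μ γ : Measure ℝ) [IsProbabilityMeasure μ] [IsProbabilityMeasure γ]
    (hμ3 : MemLp (fun x : ℝ => x) 3 μ) (hγ3 : MemLp (fun x : ℝ => x) 3 γ)
    (hm1 : ∫ y, y ∂μ = ∫ y, y ∂γ) (hm2 : ∫ y, y ^ 2 ∂μ = ∫ y, y ^ 2 ∂γ) (x : ℝ) :
    |∫ y, f (x - y) ∂μ - ∫ y, f (x - y) ∂γ| ≤
      B * (∫ y, |y| ^ 3 ∂μ + ∫ y, |y| ^ 3 ∂γ) := by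
  have hfc : Continuous f := continuous_iff_continuousAt.2 fun x => (h1 x).continuousAt
  -- The second-order Taylor polynomial at `x` integrates to an expression in the first two moments
  -- only, so it cancels between `μ` and `γ`.
  have key : ∀ (ρ : Measure ℝ) [IsProbabilityMeasure ρ], MemLp (fun x : ℝ => x) 3 ρ →
      |∫ y, f (x - y) ∂ρ - (f x - f1 x * ∫ y, y ∂ρ + f2 x / 2 * ∫ y, y ^ 2 ∂ρ)| ≤
        B * ∫ y, |y| ^ 3 ∂ρ := by
    intro ρ _ hρ
    have i1 : Integrable (fun y : ℝ => y) ρ := hρ.integrable (by norm_num)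
    have i2 : Integrable (fun y : ℝ => y ^ 2) ρ := (hρ.mono_exponent (by norm_num)).integrable_sq
    have i3 : Integrable (fun y : ℝ => |y| ^ 3) ρ := by
      simpa using hρ.integrable_norm_pow (by norm_num)
    have i0 : Integrable (fun y : ℝ => f (x - y)) ρ :=
      Integrable.of_bound (hfc.comp (by fun_prop)).aestronglyMeasurable M (ae_of_all _ fun y => hM _)
    have j1 : Integrable (fun y : ℝ => f x - f1 x * y) ρ := (integrable_const _).sub (i1.const_mul _)
    have j2 : Integrable (fun y : ℝ => f x - f1 x * y + f2 x / 2 * y ^ 2) ρ :=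
      j1.add (i2.const_mul _)
    have e : ∫ y, f (x - y) ∂ρ - (f x - f1 x * ∫ y, y ∂ρ + f2 x / 2 * ∫ y, y ^ 2 ∂ρ) =
        ∫ y, (f (x - y) - ((f x - f1 x * y) + f2 x / 2 * y ^ 2)) ∂ρ := by
      rw [integral_sub i0 j2, integral_add j1 (i2.const_mul _),
        integral_sub (integrable_const _) (i1.const_mul _), integral_const_mul, integral_const_mul]
      simp
    rw [e, ← integral_const_mul]
    refine abs_integral_le_integral_abs.trans (integral_mono
      (i0.sub j2).abs (i3.const_mul _) fun y => ?_)
    have := abs_taylor_two_le h1 h2 h3 hB x (-y)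
    rw [abs_neg] at this
    refine le_trans (le_of_eq ?_) this
    congr 1
    ring_nf
  have a := key μ hμ3
  have c := key γ hγ3
  rw [hm1, hm2] at a
  rw [mul_add]
  rw [abs_le] at *
  constructor <;> linarith [a.1, a.2, c.1, c.2]


/-! ### Removing the smoothing -/

lemma gaussianReal_real_abs_lt {a : ℝ≥0} (ha : a ≠ 0) :
    3 / 4 ≤ (gaussianReal 0 a).real {z | |z| < 2 * Real.sqrt a} := by
  have hs : 0 < Real.sqrt a := Real.sqrt_pos.2 (by exact_mod_cast pos_iff_ne_zero.2 ha)
  have h := meas_ge_le_variance_div_sq (μ := gaussianReal 0 a) (X := id)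
    (memLp_id_gaussianReal' 2 (by simp)) (c := 2 * Real.sqrt a) (by positivity)
  rw [variance_id_gaussianReal] at h
  simp only [id, integral_id_gaussianReal, sub_zero] at h
  have e : (a : ℝ) / (2 * Real.sqrt a) ^ 2 = 1 / 4 := by
    rw [mul_pow, Real.sq_sqrt a.coe_nonneg]
    have : (a : ℝ) ≠ 0 := by exact_mod_cast ha
    field_simp
    norm_num
  rw [e] at h
  have hc : {z : ℝ | |z| < 2 * Real.sqrt a} = {z : ℝ | 2 * Real.sqrt a ≤ |z|}ᶜ := by
    ext z; simp
  have hm : MeasurableSet {z : ℝ | 2 * Real.sqrt a ≤ |z|} :=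
    measurableSet_le measurable_const measurable_id.abs
  rw [hc, probReal_compl_eq_one_sub hm]
  have : (gaussianReal 0 a).real {z : ℝ | 2 * Real.sqrt a ≤ |z|} ≤ 1 / 4 :=
    ENNReal.toReal_le_of_le_ofReal (by norm_num) h
  linarith

/-- `D` decreases at rate at most `ℓ`, so it is at least `d` on `[t, t + 2h]`. The Gaussian average
of `D` at `t + h` sees this interval with mass at least `3/4`, and elsewhere `D ≥ -Δ`; hence `(3/4)
(d + Δ) - Δ ≤ η`. -/
lemma le_of_smoothed_le {D : ℝ → ℝ} (hD : Measurable D) {ℓ Δ η : ℝ}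
    (hmono : ∀ x y, x ≤ y → D x - ℓ * (y - x) ≤ D y) (hℓ : 0 ≤ ℓ)
    (hΔ : ∀ x, |D x| ≤ Δ) {a : ℝ≥0} (ha : a ≠ 0)
    (hη : ∀ x, |∫ z, D (x - z) ∂(gaussianReal 0 a)| ≤ η) (t : ℝ) :
    D t ≤ 4 / 3 * η + Δ / 3 + 4 * Real.sqrt a * ℓ := by
  have hs : 0 ≤ Real.sqrt a := Real.sqrt_nonneg _
  have hΔ0 : 0 ≤ Δ := (abs_nonneg _).trans (hΔ 0)
  have hη0 : 0 ≤ η := (abs_nonneg _).trans (hη 0)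
  set h := 2 * Real.sqrt a with hh
  set d := D t - 2 * h * ℓ with hd
  by_cases hd0 : d ≤ 0
  · have : D t ≤ 4 * Real.sqrt a * ℓ := by rw [hd, hh] at hd0; linarith
    linarith
  push Not at hd0
  have hm : MeasurableSet {z : ℝ | |z| < h} := measurableSet_lt measurable_id.abs measurable_const
  have i1 : Integrable (fun z => {z : ℝ | |z| < h}.indicator (fun _ => d + Δ) z - Δ)
      (gaussianReal 0 a) := ((integrable_const _).indicator hm).sub (integrable_const _)
  have i2 : Integrable (fun z => D (t + h - z)) (gaussianReal 0 a) :=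
    Integrable.of_bound (hD.comp (by fun_prop)).aestronglyMeasurable Δ (ae_of_all _ fun z => hΔ _)
  have hle : ∫ z, ({z : ℝ | |z| < h}.indicator (fun _ => d + Δ) z - Δ) ∂(gaussianReal 0 a) ≤
      ∫ z, D (t + h - z) ∂(gaussianReal 0 a) := by
    refine integral_mono i1 i2 fun z => ?_
    by_cases hz : |z| < h
    · simp only [mem_ofPred_eq, hz, indicator_of_mem, add_sub_cancel_right]
      have hz' := abs_lt.1 hz
      refine le_trans ?_ (hmono t (t + h - z) (by linarith))
      rw [hd]
      nlinarith
    · simp only [mem_ofPred_eq, hz, not_false_eq_true, indicator_of_notMem, zero_sub]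
      exact (abs_le.1 (hΔ _)).1
  rw [integral_sub ((integrable_const _).indicator hm) (integrable_const _),
    integral_indicator hm, setIntegral_const] at hle
  simp only [smul_eq_mul, integral_const, probReal_univ, one_mul] at hle
  have hp := gaussianReal_real_abs_lt ha
  rw [← hh] at hp
  have h2 := (abs_le.1 (hη (t + h))).2
  have h3 := mul_le_mul_of_nonneg_right hp (by linarith : 0 ≤ d + Δ)
  have h4 : D t = d + 4 * Real.sqrt a * ℓ := by rw [hd, hh]; ring
  rw [h4]
  linarith

/-- Esseen-type unsmoothing: a distribution function is close to a Lipschitz one as soon as their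
Gaussian smoothings are. -/
lemma abs_sub_le_of_smoothed_le (L : Measure ℝ) [IsProbabilityMeasure L] {G : ℝ → ℝ} {ℓ : ℝ}
    (hG : ∀ x y, |G y - G x| ≤ ℓ * |y - x|) (hG1 : ∀ x, |G x| ≤ 1) (hGm : Measurable G)
    {a : ℝ≥0} (ha : a ≠ 0) {η : ℝ}
    (hη : ∀ x, |∫ z, (L.real (Iic (x - z)) - G (x - z)) ∂(gaussianReal 0 a)| ≤ η) (t : ℝ) :
    |L.real (Iic t) - G t| ≤ 2 * η + 6 * Real.sqrt a * ℓ := by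
  set D : ℝ → ℝ := fun x => L.real (Iic x) - G x with hD
  have hFm : Monotone fun x => L.real (Iic x) := fun a b hab => measureReal_mono (Iic_subset_Iic.2 hab)
  have hDm : Measurable D := hFm.measurable.sub hGm
  have hℓ : 0 ≤ ℓ := by simpa using (abs_nonneg _).trans (hG 0 1)
  have hD2 : ∀ x, |D x| ≤ 2 := fun x => by
    refine (abs_sub _ _).trans ?_
    have : |L.real (Iic x)| ≤ 1 := by
      rw [abs_of_nonneg measureReal_nonneg]; exact measureReal_le_one
    linarith [hG1 x]
  have hbdd : BddAbove (range fun x => |D x|) := ⟨2, by rintro _ ⟨x, rfl⟩; exact hD2 x⟩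
  set Δ := ⨆ x, |D x| with hΔ
  have hΔle : ∀ x, |D x| ≤ Δ := fun x => le_ciSup hbdd x
  have hmono : ∀ x y, x ≤ y → D x - ℓ * (y - x) ≤ D y := by
    intro x y hxy
    have h1 := hFm hxy
    have h2 := (abs_le.1 (hG x y)).2
    rw [abs_of_nonneg (by linarith)] at h2
    simp only [hD]
    simp only at h1
    linarith
  have up := le_of_smoothed_le hDm hmono hℓ hΔle ha hη
  -- The reflection `x ↦ -D (-x)` obeys the same one-sided bound, and the centred Gaussian is
  -- symmetric, so the lower estimate is the upper one for the reflection.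
  have low := le_of_smoothed_le (D := fun x => -D (-x)) (hDm.comp measurable_neg).neg
    (fun x y hxy => by have := hmono (-y) (-x) (by linarith); linarith) hℓ
    (fun x => by rw [abs_neg]; exact hΔle _) ha (η := η)
    (fun x => by
      rw [integral_neg, abs_neg]
      refine le_trans (le_of_eq ?_) (hη (-x))
      congr 1
      have hmap : (gaussianReal 0 a).map (fun x => -x) = gaussianReal 0 a := by
        rw [gaussianReal_map_neg, neg_zero]
      conv_rhs => rw [← hmap]
      rw [integral_map (by fun_prop)]
      · refine integral_congr_ae (ae_of_all _ fun z => ?_)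
        simp only [hD]
        rw [show -(x - z) = -x - -z by ring]
      · exact (hDm.comp (by fun_prop : Measurable fun z => -x - z)).aestronglyMeasurable)
  -- The supremum `Δ` returns on the right with coefficient `1/3` and is absorbed; this yields the
  -- constants `2` and `6`.
  have hfin : Δ ≤ 4 / 3 * η + Δ / 3 + 4 * Real.sqrt a * ℓ := by
    refine ciSup_le fun x => abs_le.2 ⟨?_, up x⟩
    have := low (-x)
    simp only [neg_neg] at this
    linarith
  exact (hΔle t).trans (by linarith)

/-! ### Sums -/

/-- Telescoping: `u^(-3/2)` is at most six times the decrease of `u^(-1/2)` over a unit step, for `u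
≥ 1`. -/
lemma sum_inv_sqrt_cube_le {a : ℝ} (ha : 1 ≤ a) (n : ℕ) :
    ∑ j ∈ Finset.range n, ((Real.sqrt (j + a))⁻¹) ^ 3 ≤
      6 * ((Real.sqrt a)⁻¹ - (Real.sqrt (n + a))⁻¹) := by
  induction n with
  | zero => simp
  | succ n ih =>
    rw [Finset.sum_range_succ]
    have hx1 : 1 ≤ Real.sqrt (n + a) := by
      rw [Real.one_le_sqrt]; linarith [(Nat.cast_nonneg n : (0 : ℝ) ≤ n)]
    have hxy : Real.sqrt (n + a) ≤ Real.sqrt ((n + 1 : ℕ) + a) :=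
      Real.sqrt_le_sqrt (by push_cast; linarith)
    have hx2 : Real.sqrt (n + a) ^ 2 = n + a := Real.sq_sqrt (by positivity)
    have hy2 : Real.sqrt ((n + 1 : ℕ) + a) ^ 2 = n + 1 + a := by
      rw [Real.sq_sqrt (by positivity)]; push_cast; ring
    set x := Real.sqrt (n + a)
    set y := Real.sqrt ((n + 1 : ℕ) + a)
    have hyx : y ^ 2 = x ^ 2 + 1 := by rw [hy2, hx2]; ring
    have hy : y ≤ 2 * x := by nlinarith
    have hx0 : 0 < x := by linarith
    have hy0 : 0 < y := by linarith
    have key : (x⁻¹) ^ 3 ≤ 6 * (x⁻¹ - y⁻¹) := by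
      have e : x⁻¹ - y⁻¹ = (x * y * (x + y))⁻¹ := by
        field_simp
        nlinarith
      rw [e, inv_pow, ← div_eq_mul_inv, inv_eq_one_div, div_le_div_iff₀ (by positivity) (by positivity)]
      have : y * (x + y) ≤ 6 * x ^ 2 := by nlinarith
      nlinarith
    linarith

lemma sum_inv_sqrt_le (n : ℕ) :
    ∑ k ∈ Finset.range n, (Real.sqrt ((k : ℝ) + 1))⁻¹ ≤ 2 * Real.sqrt n := by
  induction n with
  | zero => simp
  | succ n ih =>
    rw [Finset.sum_range_succ]
    have hx2 : Real.sqrt n ^ 2 = n := Real.sq_sqrt (by positivity)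
    have hy2 : Real.sqrt ((n : ℝ) + 1) ^ 2 = n + 1 := Real.sq_sqrt (by positivity)
    have hy0 : 0 < Real.sqrt ((n : ℝ) + 1) := by positivity
    have hx0 : 0 ≤ Real.sqrt n := by positivity
    push_cast
    have : (Real.sqrt ((n : ℝ) + 1))⁻¹ ≤ 2 * (Real.sqrt ((n : ℝ) + 1) - Real.sqrt n) := by
      rw [inv_le_iff_one_le_mul₀ hy0]
      nlinarith [sq_nonneg (Real.sqrt ((n : ℝ) + 1) - Real.sqrt n)]
    linarith

/-- One of `m` and `u` is at least `n / 2`, and the corresponding factor is replaced by its bound.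
-/
lemma inv_sqrt_cube_mul_inv_sqrt_le {a u m n : ℝ} (ha : 1 ≤ a) (hu : a ≤ u) (hm : 1 ≤ m)
    (hn : 0 < n) (h : n ≤ u + m) :
    ((Real.sqrt u)⁻¹) ^ 3 * (Real.sqrt m)⁻¹ ≤
      2 / Real.sqrt n * ((Real.sqrt u)⁻¹) ^ 3 + 2 / (n * Real.sqrt a) * (Real.sqrt m)⁻¹ := by
  have hu0 : 0 < Real.sqrt u := Real.sqrt_pos.2 (by linarith)
  have hm0 : 0 < Real.sqrt m := Real.sqrt_pos.2 (by linarith)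
  have ha0 : 0 < Real.sqrt a := Real.sqrt_pos.2 (by linarith)
  have hn0 : 0 < Real.sqrt n := Real.sqrt_pos.2 hn
  rcases le_or_gt (n / 2) m with hc | hc
  · have h1 : (Real.sqrt m)⁻¹ ≤ 2 / Real.sqrt n := by
      rw [inv_eq_one_div, div_le_div_iff₀ hm0 hn0, one_mul,
        show (2 : ℝ) = Real.sqrt 4 by rw [show (4 : ℝ) = 2 ^ 2 by norm_num]; simp,
        ← Real.sqrt_mul (by norm_num)]
      exact Real.sqrt_le_sqrt (by linarith)
    have h2 : 0 ≤ ((Real.sqrt u)⁻¹) ^ 3 := by positivity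
    have h3 : 0 ≤ 2 / (n * Real.sqrt a) * (Real.sqrt m)⁻¹ := by positivity
    nlinarith
  · have h1 : ((Real.sqrt u)⁻¹) ^ 3 ≤ 2 / (n * Real.sqrt a) := by
      rw [inv_pow, inv_eq_one_div, div_le_div_iff₀ (by positivity) (by positivity)]
      have e : Real.sqrt u ^ 3 = u * Real.sqrt u := by
        rw [pow_succ, Real.sq_sqrt (by linarith)]
      rw [e]
      have := Real.sqrt_le_sqrt hu
      nlinarith
    have h2 : 0 ≤ (Real.sqrt m)⁻¹ := by positivity
    have h3 : 0 ≤ 2 / Real.sqrt n * ((Real.sqrt u)⁻¹) ^ 3 := by positivity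
    nlinarith

/-- This is the part of the Lindeberg error that carries the inductive constant. The factor `1/√a`
makes it small for strong smoothing and lets the induction close. -/
lemma sum_inv_sqrt_cube_mul_inv_sqrt_le {a : ℝ} (ha : 1 ≤ a) {n : ℕ} (hn : 1 ≤ n) :
    ∑ k ∈ Finset.range n,
      ((Real.sqrt ((n - 1 - k : ℕ) + a))⁻¹) ^ 3 * (Real.sqrt ((k : ℝ) + 1))⁻¹ ≤
        16 / (Real.sqrt a * Real.sqrt n) := by
  have hn0 : (0 : ℝ) < n := by exact_mod_cast hn
  have ha0 : 0 < Real.sqrt a := Real.sqrt_pos.2 (by linarith)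
  have hsn : 0 < Real.sqrt n := Real.sqrt_pos.2 hn0
  have h1 : ∑ k ∈ Finset.range n,
      ((Real.sqrt ((n - 1 - k : ℕ) + a))⁻¹) ^ 3 * (Real.sqrt ((k : ℝ) + 1))⁻¹ ≤
      ∑ k ∈ Finset.range n, (2 / Real.sqrt n * ((Real.sqrt ((n - 1 - k : ℕ) + a))⁻¹) ^ 3 +
        2 / (n * Real.sqrt a) * (Real.sqrt ((k : ℝ) + 1))⁻¹) := by
    refine Finset.sum_le_sum fun k hk => ?_
    have hk' := Finset.mem_range.1 hk
    refine inv_sqrt_cube_mul_inv_sqrt_le ha (by linarith [(Nat.cast_nonneg (n - 1 - k) : (0 : ℝ) ≤ _)])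
      (by linarith [(Nat.cast_nonneg k : (0 : ℝ) ≤ k)]) hn0 ?_
    have : ((n - 1 - k : ℕ) : ℝ) + k + 1 = n := by exact_mod_cast (by omega : n - 1 - k + k + 1 = n)
    linarith
  refine h1.trans ?_
  rw [Finset.sum_add_distrib, ← Finset.mul_sum, ← Finset.mul_sum,
    Finset.sum_range_reflect (fun j : ℕ => ((Real.sqrt ((j : ℝ) + a))⁻¹) ^ 3) n]
  have h2 : ∑ j ∈ Finset.range n, ((Real.sqrt (j + a))⁻¹) ^ 3 ≤ 6 * (Real.sqrt a)⁻¹ := by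
    refine (sum_inv_sqrt_cube_le ha n).trans ?_
    have : 0 ≤ (Real.sqrt (n + a))⁻¹ := by positivity
    linarith
  have h3 := sum_inv_sqrt_le n
  calc _ ≤ 2 / Real.sqrt n * (6 * (Real.sqrt a)⁻¹) + 2 / (n * Real.sqrt a) * (2 * Real.sqrt n) := by
        gcongr
    _ = 16 / (Real.sqrt a * Real.sqrt n) := by
        have e : (n : ℝ) = Real.sqrt n * Real.sqrt n := (Real.mul_self_sqrt hn0.le).symm
        rw [e, Real.sqrt_mul_self hsn.le]
        field_simp
        norm_num


/-! ### The Berry–Esseen theorem -/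

/-- The law of the sum of `n` independent copies. -/
noncomputable def convPow (μ : Measure ℝ) : ℕ → Measure ℝ
  | 0 => Measure.dirac 0
  | n + 1 => μ ∗ convPow μ n

instance isProbabilityMeasure_convPow (μ : Measure ℝ) [IsProbabilityMeasure μ] (n : ℕ) :
    IsProbabilityMeasure (convPow μ n) := by
  induction n with
  | zero => rw [convPow]; infer_instance
  | succ n ih => rw [convPow]; infer_instance

/-- One Lindeberg exchange: a copy of `μ` is traded for a standard Gaussian with the same first two
moments, so only the third derivative of the smoothed distribution function enters. -/
lemma abs_conv_swap_le (μ L : Measure ℝ) [IsProbabilityMeasure μ] [IsProbabilityMeasure L]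
    (h3 : MemLp (fun x : ℝ => x) 3 μ) (hm : ∫ x, x ∂μ = 0) (hv : ∫ x, x ^ 2 ∂μ = 1)
    {v w : ℝ≥0} (hw : w ≠ 0) {δ : ℝ}
    (hδ : ∀ x, |L.real (Iic x) - (gaussianReal 0 v).real (Iic x)| ≤ δ) (x : ℝ) :
    |((μ ∗ L) ∗ gaussianReal 0 w).real (Iic x) - (L ∗ gaussianReal 0 (1 + w)).real (Iic x)| ≤
      (2 * ((Real.sqrt (v + w : ℝ≥0))⁻¹) ^ 3 + ((Real.sqrt w)⁻¹) ^ 3 * (δ * fourthConst)) *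
        (∫ y, |y| ^ 3 ∂μ + ∫ y, |y| ^ 3 ∂(gaussianReal 0 1)) := by
  have e1 : ((μ ∗ L) ∗ gaussianReal 0 w).real (Iic x) =
      ∫ y, smooth stdCDF 0 L (Real.sqrt w) (x - y) ∂μ := by
    rw [Measure.conv_assoc, conv_real_Iic]
    simp_rw [smooth_stdCDF_eq L hw]
  have e2 : (L ∗ gaussianReal 0 (1 + w)).real (Iic x) =
      ∫ y, smooth stdCDF 0 L (Real.sqrt w) (x - y) ∂(gaussianReal 0 1) := by
    have : L ∗ gaussianReal 0 (1 + w) = gaussianReal 0 1 ∗ (L ∗ gaussianReal 0 w) := by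
      have h : gaussianReal 0 (1 + w) = gaussianReal 0 1 ∗ gaussianReal 0 w := by
        rw [gaussianReal_conv_gaussianReal, add_zero]
      rw [h, ← Measure.conv_assoc, Measure.conv_comm L, Measure.conv_assoc]
    rw [this, conv_real_Iic]
    simp_rw [smooth_stdCDF_eq L hw]
  rw [e1, e2]
  have hv1 : ∫ x, x ^ 2 ∂(gaussianReal 0 1) = 1 := by
    have := variance_fun_id_gaussianReal (μ := 0) (v := 1)
    rw [variance_eq_integral (by fun_prop), integral_id_gaussianReal] at this
    simpa using this
  exact abs_integral_sub_le_of_moments (hasDerivAt_smooth_zero L _) (hasDerivAt_smooth_one L _)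
    (hasDerivAt_smooth_two L _) (abs_smooth_three_le hw hδ) (M := 1)
    (fun y => by
      rw [smooth_stdCDF_eq L hw, abs_of_nonneg measureReal_nonneg]; exact measureReal_le_one)
    μ (gaussianReal 0 1) h3 (memLp_id_gaussianReal' 3 (by simp))
    (by rw [hm, integral_id_gaussianReal]) (by rw [hv, hv1]) x

lemma abs_convPow_smoothed_le (μ : Measure ℝ) [IsProbabilityMeasure μ]
    (h3 : MemLp (fun x : ℝ => x) 3 μ) (hm : ∫ x, x ∂μ = 0) (hv : ∫ x, x ^ 2 ∂μ = 1)
    {a : ℝ≥0} (ha : 1 ≤ a) {n : ℕ} (hn : 1 ≤ n) {K : ℝ}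
    (hK : ∀ k < n, ∀ x, |(convPow μ k).real (Iic x) - (gaussianReal 0 k).real (Iic x)| ≤
      K / Real.sqrt (k + 1)) (x : ℝ) :
    |(convPow μ n ∗ gaussianReal 0 a).real (Iic x) - (gaussianReal 0 (n + a)).real (Iic x)| ≤
      (∫ y, |y| ^ 3 ∂μ + ∫ y, |y| ^ 3 ∂(gaussianReal 0 1)) *
        (2 + 16 * K * fourthConst / Real.sqrt a) / Real.sqrt n := by
  set ρ := ∫ y, |y| ^ 3 ∂μ + ∫ y, |y| ^ 3 ∂(gaussianReal 0 1) with hρ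
  have hρ0 : 0 ≤ ρ := add_nonneg (integral_nonneg fun _ => by positivity)
    (integral_nonneg fun _ => by positivity)
  have ha' : (1 : ℝ) ≤ a := by exact_mod_cast ha
  have hn0 : (0 : ℝ) < n := by exact_mod_cast hn
  have hsn : 0 < Real.sqrt n := Real.sqrt_pos.2 hn0
  -- `T k` has `k` genuine summands and Gaussian variance `n - k + a`: it interpolates between the
  -- Gaussian of variance `n + a` and the smoothed law of the sum.
  set T : ℕ → ℝ := fun k => (convPow μ k ∗ gaussianReal 0 ((n - k : ℕ) + a)).real (Iic x) with hT
  have hTn : T n = (convPow μ n ∗ gaussianReal 0 a).real (Iic x) := by simp [hT]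
  have hT0 : T 0 = (gaussianReal 0 (n + a)).real (Iic x) := by
    simp [hT, convPow, Measure.dirac_zero_conv]
  have step : ∀ k ∈ Finset.range n, |T (k + 1) - T k| ≤
      (2 * ((Real.sqrt n)⁻¹) ^ 3 + ((Real.sqrt ((n - 1 - k : ℕ) + (a : ℝ)))⁻¹) ^ 3 *
        (Real.sqrt ((k : ℝ) + 1))⁻¹ * (K * fourthConst)) * ρ := by
    intro k hk
    have hk' := Finset.mem_range.1 hk
    have hw : ((n - 1 - k : ℕ) + a : ℝ≥0) ≠ 0 := by positivity
    have h := abs_conv_swap_le μ (convPow μ k) h3 hm hv hw (v := k) (hK k hk') x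
    have e1 : T (k + 1) =
        ((μ ∗ convPow μ k) ∗ gaussianReal 0 ((n - 1 - k : ℕ) + a)).real (Iic x) := by
      simp only [hT, convPow]
      rw [show n - (k + 1) = n - 1 - k by omega]
    have e2 : T k = (convPow μ k ∗ gaussianReal 0 (1 + ((n - 1 - k : ℕ) + a))).real (Iic x) := by
      simp only [hT]
      rw [← add_assoc]
      have : ((n - k : ℕ) : ℝ≥0) = 1 + ((n - 1 - k : ℕ) : ℝ≥0) := by
        exact_mod_cast (by omega : n - k = 1 + (n - 1 - k))
      rw [this]
    rw [e1, e2]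
    refine h.trans (mul_le_mul_of_nonneg_right (add_le_add ?_ (le_of_eq ?_)) hρ0)
    -- The total variance `k + (n - 1 - k) + a` is at least `n` because `a ≥ 1`. Each exchange then
    -- costs `2 n^(-3/2)` in the main term, and all `n` of them cost `2/√n`.
    · have : Real.sqrt n ≤ Real.sqrt ((k : ℝ≥0) + ((n - 1 - k : ℕ) + a) : ℝ≥0) := by
        apply Real.sqrt_le_sqrt
        simp only [NNReal.coe_add, NNReal.coe_natCast]
        have : ((n - 1 - k : ℕ) : ℝ) + k + 1 = n := by
          exact_mod_cast (by omega : n - 1 - k + k + 1 = n)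
        linarith
      gcongr
    · simp only [NNReal.coe_add, NNReal.coe_natCast]
      rw [div_eq_mul_inv]
      ring
  have tel : T n - T 0 = ∑ k ∈ Finset.range n, (T (k + 1) - T k) := (Finset.sum_range_sub T n).symm
  rw [← hTn, ← hT0, tel]
  have hK0 : 0 ≤ K := by
    have := (abs_nonneg _).trans (hK 0 (by omega) 0)
    simpa using this
  refine (Finset.abs_sum_le_sum_abs _ _).trans ((Finset.sum_le_sum step).trans ?_)
  rw [← Finset.sum_mul, Finset.sum_add_distrib, Finset.sum_const, Finset.card_range, nsmul_eq_mul,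
    ← Finset.sum_mul]
  have hs := sum_inv_sqrt_cube_mul_inv_sqrt_le ha' hn
  have hc := fourthConst_nonneg
  have e3 : (n : ℝ) * (2 * ((Real.sqrt n)⁻¹) ^ 3) = 2 / Real.sqrt n := by
    have e : (n : ℝ) = Real.sqrt n * Real.sqrt n := (Real.mul_self_sqrt hn0.le).symm
    rw [e, Real.sqrt_mul_self hsn.le]
    field_simp
  rw [e3]
  have h5 := mul_le_mul_of_nonneg_right hs (mul_nonneg hK0 hc)
  have h6 : (2 / Real.sqrt n + 16 / (Real.sqrt a * Real.sqrt n) * (K * fourthConst)) * ρ =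
      ρ * (2 + 16 * K * fourthConst / Real.sqrt a) / Real.sqrt n := by
    have : 0 < Real.sqrt (a : ℝ) := Real.sqrt_pos.2 (by linarith)
    field_simp
  rw [← h6]
  exact mul_le_mul_of_nonneg_right (by linarith) hρ0

/-- **Berry–Esseen theorem** for sums of independent copies of a standardized law with a finite
third absolute moment. -/
theorem exists_berry_esseen_standard (μ : Measure ℝ) [IsProbabilityMeasure μ]
    (h3 : MemLp (fun x : ℝ => x) 3 μ) (hm : ∫ x, x ∂μ = 0) (hv : ∫ x, x ^ 2 ∂μ = 1) :
    ∃ K : ℝ, ∀ n : ℕ, ∀ x : ℝ,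
      |(convPow μ n).real (Iic x) - (gaussianReal 0 n).real (Iic x)| ≤ K / Real.sqrt (n + 1) := by
  set ρ := ∫ y, |y| ^ 3 ∂μ + ∫ y, |y| ^ 3 ∂(gaussianReal 0 1) with hρ
  have hρ0 : 0 ≤ ρ := add_nonneg (integral_nonneg fun _ => by positivity)
    (integral_nonneg fun _ => by positivity)
  have hc := fourthConst_nonneg
  set c := fourthConst
  -- `A` is the standard deviation of the smoothing. The bound `128 ρ c ≤ A` makes the inductive
  -- contribution `32 ρ c K / A` at most `K / 4`.
  obtain ⟨A, hA1, hA2⟩ : ∃ A : ℝ, 1 ≤ A ∧ 128 * ρ * c ≤ A :=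
    ⟨max 1 (128 * ρ * c), le_max_left _ _, le_max_right _ _⟩
  set a : ℝ≥0 := Real.toNNReal (A ^ 2) with ha
  have haA : (a : ℝ) = A ^ 2 := Real.coe_toNNReal _ (by positivity)
  have hsa : Real.sqrt a = A := by rw [haA, Real.sqrt_sq (by linarith)]
  have ha1 : 1 ≤ a := by
    rw [← NNReal.coe_le_coe, haA]; push_cast; nlinarith
  -- With this choice the remaining terms `4 ρ + 6 A` equal `K / 4`. The total is at most `K / 2`,
  -- and the last factor `2` pays for passing from `√n` to `√(n + 1)`.
  set K := 16 * ρ + 24 * A with hKdef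
  have hK0 : 0 ≤ K := by positivity
  refine ⟨K, fun n => ?_⟩
  induction n using Nat.strong_induction_on with
  | _ n ih =>
  intro x
  rcases Nat.eq_zero_or_pos n with rfl | hn
  · simp [convPow, hK0]
  have hn0 : (0 : ℝ) < n := by exact_mod_cast hn
  have hn1 : (1 : ℝ) ≤ n := by exact_mod_cast hn
  have hsn : 0 < Real.sqrt n := Real.sqrt_pos.2 hn0
  have hnn : (n : ℝ≥0) ≠ 0 := by positivity
  have ha0 : a ≠ 0 := by positivity
  have hsm := abs_convPow_smoothed_le μ h3 hm hv ha1 hn ih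
  rw [← hρ] at hsm
  set η := ρ * (2 + 16 * K * c / Real.sqrt a) / Real.sqrt n with hη
  have hG : ∀ y, (gaussianReal 0 n).real (Iic y) = stdCDF (y / Real.sqrt n) := fun y =>
    gaussianReal_real_Iic hnn y
  have hmono : ∀ (M : Measure ℝ) [IsProbabilityMeasure M] (y : ℝ),
      Integrable (fun z => M.real (Iic (y - z))) (gaussianReal 0 a) := by
    intro M _ y
    have : Antitone fun z => M.real (Iic (y - z)) := fun a b hab =>
      measureReal_mono (Iic_subset_Iic.2 (by linarith))
    exact Integrable.of_bound this.measurable.aestronglyMeasurable 1 (ae_of_all _ fun z => by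
      rw [Real.norm_of_nonneg measureReal_nonneg]; exact measureReal_le_one)
  have un := abs_sub_le_of_smoothed_le (convPow μ n) (G := fun y => stdCDF (y / Real.sqrt n))
    (ℓ := (Real.sqrt n)⁻¹)
    (fun x y => by
      refine (abs_stdCDF_sub_le _ _).trans_eq ?_
      rw [← sub_div, abs_div, abs_of_pos hsn, div_eq_inv_mul])
    (fun x => abs_stdCDF_le _) (continuous_stdCDF.comp (by fun_prop)).measurable ha0 (η := η)
    (fun y => by
      simp only [← hG]
      rw [integral_sub (hmono _ y) (hmono _ y), ← conv_real_Iic, ← conv_real_Iic,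
        gaussianReal_conv_gaussianReal, zero_add, Measure.conv_comm, add_comm a]
      exact hsm y) x
  rw [hG]
  refine un.trans ?_
  rw [hsa] at *
  have hA0 : 0 < A := by linarith
  have h1 : 2 * η + 6 * A * (Real.sqrt n)⁻¹ =
      (4 * ρ + 32 * ρ * c * K / A + 6 * A) / Real.sqrt n := by
    rw [hη]; field_simp; ring
  have h2 : 32 * ρ * c * K / A ≤ K / 4 := by
    rw [div_le_div_iff₀ hA0 (by norm_num)]
    nlinarith
  have h3' : 4 * ρ + 32 * ρ * c * K / A + 6 * A ≤ K / 2 := by linarith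
  have h4 : Real.sqrt (n + 1) ≤ 2 * Real.sqrt n := by
    rw [show (2 : ℝ) = Real.sqrt 4 by rw [show (4 : ℝ) = 2 ^ 2 by norm_num]; simp,
      ← Real.sqrt_mul (by norm_num)]
    exact Real.sqrt_le_sqrt (by linarith)
  rw [h1, div_le_div_iff₀ hsn (by positivity)]
  nlinarith [Real.sqrt_nonneg ((n : ℝ) + 1)]

/-- The law of the image of a sum of `n` independent copies under the affine standardization. -/
lemma convPow_map_affine (μ : Measure ℝ) [IsProbabilityMeasure μ] (c d : ℝ) (n : ℕ) :
    convPow (μ.map fun x => d * (x - c)) n = (convPow μ n).map fun x => d * (x - n * c) := by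
  have : IsProbabilityMeasure (μ.map fun x => d * (x - c)) :=
    Measure.isProbabilityMeasure_map (by fun_prop)
  induction n with
  | zero => simp [convPow]
  | succ n ih =>
    rw [convPow, convPow, ih, Measure.conv, Measure.conv,
      Measure.map_prod_map μ (convPow μ n) (f := fun x => d * (x - c))
        (g := fun x => d * (x - n * c)) (by fun_prop) (by fun_prop),
      Measure.map_map (by fun_prop) (by fun_prop), Measure.map_map (by fun_prop) (by fun_prop)]
    congr 1
    funext p
    simp
    ring

/-- **Berry–Esseen theorem** for sums of independent copies of a nondegenerate law with a finite
third absolute moment. -/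
theorem exists_berry_esseen (μ : Measure ℝ) [IsProbabilityMeasure μ]
    (h3 : MemLp (fun x : ℝ => x) 3 μ) {C V : ℝ} (hC : ∫ x, x ∂μ = C) (hV : Var[fun x => x; μ] = V)
    (hV0 : 0 < V) :
    ∃ K : ℝ, 0 ≤ K ∧ ∀ n : ℕ, 1 ≤ n → ∀ t : ℝ,
      |(convPow μ n).real (Iic t) - stdCDF ((t - n * C) / Real.sqrt (n * V))| ≤ K / Real.sqrt n := by
  set d := (Real.sqrt V)⁻¹ with hd
  have hsV : 0 < Real.sqrt V := Real.sqrt_pos.2 hV0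
  have hd0 : 0 < d := inv_pos.2 hsV
  set μ' := μ.map fun x => d * (x - C) with hμ'
  have : IsProbabilityMeasure μ' := Measure.isProbabilityMeasure_map (by fun_prop)
  have h2 : MemLp (fun x : ℝ => x) 2 μ := h3.mono_exponent (by norm_num)
  have i1 : Integrable (fun x : ℝ => x) μ := h3.integrable (by norm_num)
  have h3' : MemLp (fun x : ℝ => x) 3 μ' := by
    rw [hμ', memLp_map_measure_iff (by fun_prop) (by fun_prop)]
    exact (h3.sub (memLp_const C)).const_mul d
  have hm' : ∫ x, x ∂μ' = 0 := by
    rw [hμ', integral_map (by fun_prop) (by fun_prop), integral_const_mul,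
      integral_sub i1 (integrable_const _), hC]
    simp
  have hv' : ∫ x, x ^ 2 ∂μ' = 1 := by
    rw [hμ', integral_map (by fun_prop) (by fun_prop)]
    simp_rw [mul_pow]
    rw [integral_const_mul, hd, inv_pow, Real.sq_sqrt hV0.le]
    rw [variance_eq_integral (by fun_prop), hC] at hV
    rw [hV, inv_mul_cancel₀ hV0.ne']
  obtain ⟨K, hK⟩ := exists_berry_esseen_standard μ' h3' hm' hv'
  have hK0 : 0 ≤ K := by
    have := (abs_nonneg _).trans (hK 0 0)
    simpa using this
  refine ⟨K, hK0, fun n hn t => ?_⟩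
  have hn0 : (0 : ℝ) < n := by exact_mod_cast hn
  have hnn : (n : ℝ≥0) ≠ 0 := by positivity
  have h := hK n (d * (t - n * C))
  rw [hμ', convPow_map_affine, gaussianReal_real_Iic hnn, Measure.real,
    Measure.map_apply (by fun_prop) measurableSet_Iic] at h
  have e1 : (fun x => d * (x - n * C)) ⁻¹' Iic (d * (t - n * C)) = Iic t := by
    ext x
    simp [mul_le_mul_iff_right₀ hd0]
  have e2 : d * (t - n * C) / Real.sqrt ((n : ℝ≥0) : ℝ) = (t - n * C) / Real.sqrt (n * V) := by
    rw [hd, NNReal.coe_natCast, Real.sqrt_mul hn0.le]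
    have : 0 < Real.sqrt n := Real.sqrt_pos.2 hn0
    field_simp
  rw [e1, e2] at h
  refine h.trans (div_le_div_of_nonneg_left hK0 (Real.sqrt_pos.2 hn0)
    (Real.sqrt_le_sqrt (by linarith)))


/-! ### Log-likelihood ratios of product measures and changes of measure -/

lemma lintegral_pi_prod {ι : Type*} [Fintype ι] {X : ι → Type*} [∀ i, MeasurableSpace (X i)]
    (μ : ∀ i, Measure (X i)) [∀ i, IsProbabilityMeasure (μ i)] {g : ∀ i, X i → ℝ≥0∞}
    (hg : ∀ i, Measurable (g i)) :
    ∫⁻ y, ∏ i, g i (y i) ∂(Measure.pi μ) = ∏ i, ∫⁻ z, g i z ∂(μ i) := by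
  have h := iIndepFun_pi (μ := μ) (X := g) fun i => (hg i).aemeasurable
  have h2 := lintegral_prod_eq_prod_lintegral_of_indepFun (μ := Measure.pi μ) Finset.univ
    (fun i (y : ∀ i, X i) => g i (y i)) h fun i => (hg i).comp (measurable_pi_apply i)
  rw [h2]
  refine Finset.prod_congr rfl fun i _ => ?_
  exact (measurePreserving_eval μ i).lintegral_comp (hg i)

lemma pi_eq_withDensity {ι : Type*} [Fintype ι] {X : ι → Type*} [∀ i, MeasurableSpace (X i)]
    (P Q : ∀ i, Measure (X i)) [∀ i, IsProbabilityMeasure (P i)] [∀ i, IsProbabilityMeasure (Q i)]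
    (h : ∀ i, P i ≪ Q i) :
    Measure.pi P = (Measure.pi Q).withDensity fun y => ∏ i, (P i).rnDeriv (Q i) (y i) := by
  refine Measure.pi_eq fun s hs => ?_
  rw [withDensity_apply _ (MeasurableSet.univ_pi hs), ← lintegral_indicator (MeasurableSet.univ_pi hs)]
  have e : ∀ y : ∀ i, X i, (univ.pi s).indicator (fun y => ∏ i, (P i).rnDeriv (Q i) (y i)) y =
      ∏ i, (s i).indicator ((P i).rnDeriv (Q i)) (y i) := by
    intro y
    by_cases hy : y ∈ univ.pi s
    · rw [indicator_of_mem hy]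
      exact Finset.prod_congr rfl fun i _ => by rw [indicator_of_mem (hy i (mem_univ i))]
    · rw [indicator_of_notMem hy]
      simp only [Set.mem_pi, mem_univ, forall_const, not_forall] at hy
      obtain ⟨i, hi⟩ := hy
      exact (Finset.prod_eq_zero (Finset.mem_univ i) (indicator_of_notMem hi _)).symm
  simp_rw [e]
  rw [lintegral_pi_prod Q fun i => (Measure.measurable_rnDeriv _ _).indicator (hs i)]
  refine Finset.prod_congr rfl fun i _ => ?_
  rw [lintegral_indicator (hs i), Measure.setLIntegral_rnDeriv (h i)]

lemma pi_absolutelyContinuous {ι : Type*} [Fintype ι] {X : ι → Type*} [∀ i, MeasurableSpace (X i)]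
    (P Q : ∀ i, Measure (X i)) [∀ i, IsProbabilityMeasure (P i)] [∀ i, IsProbabilityMeasure (Q i)]
    (h : ∀ i, P i ≪ Q i) : Measure.pi P ≪ Measure.pi Q := by
  rw [pi_eq_withDensity P Q h]
  exact withDensity_absolutelyContinuous _ _

lemma llr_pi {ι : Type*} [Fintype ι] {X : ι → Type*} [∀ i, MeasurableSpace (X i)]
    (P Q : ∀ i, Measure (X i)) [∀ i, IsProbabilityMeasure (P i)] [∀ i, IsProbabilityMeasure (Q i)]
    (h : ∀ i, P i ≪ Q i) :
    llr (Measure.pi P) (Measure.pi Q) =ᵐ[Measure.pi P] fun y => ∑ i, llr (P i) (Q i) (y i) := by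
  have hac := pi_absolutelyContinuous P Q h
  have h1 : (Measure.pi P).rnDeriv (Measure.pi Q) =ᵐ[Measure.pi Q]
      fun y => ∏ i, (P i).rnDeriv (Q i) (y i) := by
    conv_lhs => rw [pi_eq_withDensity P Q h]
    exact Measure.rnDeriv_withDensity _ (Finset.measurable_prod _ fun i _ =>
      (Measure.measurable_rnDeriv _ _).comp (measurable_pi_apply i))
  have h2 : ∀ᵐ y ∂(Measure.pi P), ∀ i, (P i).rnDeriv (Q i) (y i) ≠ 0 ∧
      (P i).rnDeriv (Q i) (y i) ≠ ∞ := by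
    rw [ae_all_iff]
    intro i
    have a : ∀ᵐ z ∂(P i), (P i).rnDeriv (Q i) z ≠ 0 ∧ (P i).rnDeriv (Q i) z ≠ ∞ := by
      filter_upwards [Measure.rnDeriv_pos (h i), (h i).ae_le (Measure.rnDeriv_lt_top (P i) (Q i))]
        with z h1 h2 using ⟨h1.ne', h2.ne⟩
    exact (measurePreserving_eval P i).quasiMeasurePreserving.ae a
  filter_upwards [hac.ae_le h1, h2] with y hy1 hy2
  simp only [llr_def]
  rw [hy1, ENNReal.toReal_prod, Real.log_prod]
  intro i _
  exact ENNReal.toReal_ne_zero.2 (hy2 i)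

lemma map_sum_pi_eq_convPow {Y : Type*} [MeasurableSpace Y] (ρ : Measure Y) [IsProbabilityMeasure ρ]
    {g : Y → ℝ} (hg : Measurable g) (n : ℕ) :
    (Measure.pi fun _ : Fin n => ρ).map (fun y => ∑ i, g (y i)) = convPow (ρ.map g) n := by
  have : IsProbabilityMeasure (ρ.map g) := Measure.isProbabilityMeasure_map hg.aemeasurable
  induction n with
  | zero => simp [convPow, Measure.map_const]
  | succ n ih =>
    have hmp := measurePreserving_piFinSuccAbove (fun _ : Fin (n + 1) => ρ) 0
    have hs : Measurable fun y : Fin n → Y => ∑ i, g (y i) :=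
      Finset.measurable_sum _ fun i _ => hg.comp (measurable_pi_apply i)
    rw [convPow, ← ih, Measure.conv, Measure.map_prod_map _ _ hg hs,
      Measure.map_map measurable_add (hg.prodMap hs), ← hmp.map_eq,
      Measure.map_map (measurable_add.comp (hg.prodMap hs)) hmp.measurable]
    congr 1
    funext y
    simp [Fin.sum_univ_succ, MeasurableEquiv.piFinSuccAbove, Fin.insertNthEquiv, Fin.tail]

lemma measure_mul_le_of_le_rnDeriv {Ω : Type*} [MeasurableSpace Ω] {P Q : Measure Ω}
    [IsProbabilityMeasure P] [IsProbabilityMeasure Q] (h : P ≪ Q) {S : Set Ω} {c : ℝ≥0∞} (hc : ∀ y ∈ S, c ≤ P.rnDeriv Q y) : c * Q S ≤ P S := by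
  rw [← Measure.setLIntegral_rnDeriv h, ← setLIntegral_const]
  exact setLIntegral_mono (Measure.measurable_rnDeriv _ _) hc

/-- The easy half of Neyman–Pearson: `d ≤ 1` is used where the likelihood ratio exceeds `exp c`, and
`dP ≤ exp c dQ` elsewhere. -/
lemma lintegral_le_measure_llr_add {Ω : Type*} [MeasurableSpace Ω] {P Q : Measure Ω}
    [IsProbabilityMeasure P] [IsProbabilityMeasure Q] (h : P ≪ Q) {d : Ω → ℝ≥0∞}
    (hd : Measurable d) (hd1 : ∀ y, d y ≤ 1) (c : ℝ) :
    ∫⁻ y, d y ∂P ≤ P {y | c < llr P Q y} + ENNReal.ofReal (Real.exp c) * ∫⁻ y, d y ∂Q := by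
  have hm : MeasurableSet {y | c < llr P Q y} := measurableSet_lt measurable_const (measurable_llr _ _)
  rw [← lintegral_rnDeriv_mul h hd.aemeasurable, ← Measure.setLIntegral_rnDeriv h,
    ← lintegral_indicator hm, ← lintegral_const_mul _ hd, ← lintegral_add_left
      ((Measure.measurable_rnDeriv _ _).indicator hm)]
  refine lintegral_mono_ae ?_
  filter_upwards [Measure.rnDeriv_lt_top P Q] with y hy
  by_cases hc : c < llr P Q y
  · have : y ∈ {y | c < llr P Q y} := hc
    rw [indicator_of_mem this]
    exact le_add_right (mul_le_of_le_one_right' (hd1 y))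
  · have : y ∉ {y | c < llr P Q y} := hc
    rw [indicator_of_notMem this, zero_add]
    gcongr
    rw [← ENNReal.ofReal_toReal hy.ne]
    refine ENNReal.ofReal_le_ofReal ?_
    -- Since `Real.log 0 = 0`, a vanishing density cannot be read off from `llr` and is treated
    -- apart.
    rcases (ENNReal.toReal_nonneg (a := P.rnDeriv Q y)).eq_or_lt with h0 | h0
    · rw [← h0]; positivity
    · rw [← Real.log_le_iff_le_exp h0]
      exact not_lt.1 hc

/-- Lower bound on the relative entropy by the mass of a small set. -/
lemma measure_mul_log_le_klDiv_add_one {Ω : Type*} [MeasurableSpace Ω] (P Q : Measure Ω)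
    [IsProbabilityMeasure P] [IsProbabilityMeasure Q] {N : Set Ω} {a : ℝ}
    (hQ : Q N ≤ ENNReal.ofReal (Real.exp (-a))) :
    ENNReal.ofReal a * P N ≤ klDiv P Q + 1 := by
  by_cases h : P ≪ Q
  swap
  · simp [klDiv_of_not_ac h]
  -- Young's inequality for the conjugate pair `u log u - u` and `exp a`.
  have hk : ∀ u : ℝ, 0 ≤ u → a * u ≤ klFun u + Real.exp a := by
    intro u hu
    rcases hu.eq_or_lt with rfl | hu
    · simp [klFun_zero]; positivity
    · have := Real.add_one_le_exp (a - Real.log u)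
      rw [Real.exp_sub, Real.exp_log hu, le_div_iff₀ hu] at this
      rw [klFun_apply]
      nlinarith
  rw [klDiv_eq_lintegral_klFun_of_ac h, ← Measure.setLIntegral_rnDeriv h,
    ← lintegral_const_mul _ (Measure.measurable_rnDeriv _ _)]
  have h1 : ∫⁻ y in N, ENNReal.ofReal (Real.exp a) ∂Q ≤ 1 := by
    rw [setLIntegral_const]
    calc _ ≤ ENNReal.ofReal (Real.exp a) * ENNReal.ofReal (Real.exp (-a)) := by gcongr
      _ = 1 := by
        rw [← ENNReal.ofReal_mul (Real.exp_pos _).le, ← Real.exp_add]; simp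
  calc ∫⁻ y in N, ENNReal.ofReal a * P.rnDeriv Q y ∂Q
      ≤ ∫⁻ y in N, (ENNReal.ofReal (klFun (P.rnDeriv Q y).toReal) + ENNReal.ofReal (Real.exp a)) ∂Q := by
        refine lintegral_mono_ae (ae_restrict_of_ae ?_)
        filter_upwards [Measure.rnDeriv_lt_top P Q] with y hy
        rw [← ENNReal.ofReal_add (klFun_nonneg ENNReal.toReal_nonneg) (Real.exp_pos _).le]
        conv_lhs => rw [← ENNReal.ofReal_toReal hy.ne]
        rw [← ENNReal.ofReal_mul' ENNReal.toReal_nonneg]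
        exact ENNReal.ofReal_le_ofReal (hk _ ENNReal.toReal_nonneg)
    _ = ∫⁻ y in N, ENNReal.ofReal (klFun (P.rnDeriv Q y).toReal) ∂Q +
        ∫⁻ y in N, ENNReal.ofReal (Real.exp a) ∂Q := lintegral_add_right _ measurable_const
    _ ≤ _ := add_le_add (setLIntegral_le_lintegral _ _) h1


/-! ### Output laws of capacity-achieving inputs dominate the channel -/

/-- Countable generation provides a jointly measurable density of the kernel with respect to `ν` and
the measurability of the set where absolute continuity holds. -/
lemma measurable_klDiv_kernel {A B : Type*} [MeasurableSpace A] [MeasurableSpace B]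
    [MeasurableSpace.CountablyGenerated B] (κ : Kernel A B) [IsMarkovKernel κ]
    (ν : Measure B) [IsProbabilityMeasure ν] : Measurable fun x => klDiv (κ x) ν := by
  classical
  set η : Kernel A B := Kernel.const A ν with hη
  have e : (fun x => klDiv (κ x) ν) = fun x => if κ x ≪ η x then
      ∫⁻ y, ENNReal.ofReal (klFun (κ.rnDeriv η x y).toReal) ∂ν else ∞ := by
    funext x
    split_ifs with h
    · have h' : κ x ≪ ν := h
      rw [klDiv_eq_lintegral_klFun_of_ac h']
      refine lintegral_congr_ae ?_
      have := Kernel.rnDeriv_eq_rnDeriv_measure (κ := κ) (η := η) (a := x)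
      filter_upwards [show κ.rnDeriv η x =ᵐ[ν] (κ x).rnDeriv ν from this] with y hy
      rw [hy]
    · exact klDiv_of_not_ac h
  rw [e]
  refine Measurable.ite (Kernel.measurableSet_absolutelyContinuous κ η) ?_ measurable_const
  refine Measurable.lintegral_prod_right' (f := fun p : A × B =>
    ENNReal.ofReal (klFun (κ.rnDeriv η p.1 p.2).toReal)) ?_
  exact (measurable_klFun.comp (Kernel.measurable_rnDeriv κ η).ennreal_toReal).ennreal_ofReal

/-- With `r = dQ'/dQ`, the chain rule `log dP/dQ = log dP/dQ' + log r` and `log r ≤ r - 1` are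
integrated against `P`. The `1` stands on the left so that no subtraction occurs in `ℝ≥0∞`. -/
lemma klDiv_add_one_le {Ω : Type*} [MeasurableSpace Ω] (P Q Q' : Measure Ω)
    [IsProbabilityMeasure P] [IsProbabilityMeasure Q] [IsProbabilityMeasure Q']
    (hP : klDiv P Q ≠ ∞) : klDiv P Q + 1 ≤ klDiv P Q' + ∫⁻ y, Q'.rnDeriv Q y ∂P := by
  obtain ⟨hPQ, hint⟩ := klDiv_ne_top_iff.1 hP
  by_cases hP' : klDiv P Q' = ∞
  · simp [hP']
  by_cases hr : ∫⁻ y, Q'.rnDeriv Q y ∂P = ∞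
  · simp [hr]
  obtain ⟨hPQ', hint'⟩ := klDiv_ne_top_iff.1 hP'
  have hpos : ∀ᵐ y ∂P, llr P Q y = llr P Q' y + Real.log (Q'.rnDeriv Q y).toReal ∧
      0 < (Q'.rnDeriv Q y).toReal := by
    filter_upwards [hPQ.ae_le (Measure.rnDeriv_mul_rnDeriv (κ := Q) hPQ'), Measure.rnDeriv_pos hPQ,
      hPQ.ae_le (Measure.rnDeriv_lt_top P Q), hPQ.ae_le (Measure.rnDeriv_lt_top Q' Q),
      hPQ'.ae_le (Measure.rnDeriv_lt_top P Q')] with y h1 h2 h3 h4 h5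
    rw [← h1, Pi.mul_apply] at h2
    have a := ENNReal.toReal_pos (pos_of_mul_pos_left h2 (by simp)).ne' h5.ne
    have b := ENNReal.toReal_pos (pos_of_mul_pos_right h2 (by simp)).ne' h4.ne
    refine ⟨?_, b⟩
    simp only [llr_def]
    rw [← h1, Pi.mul_apply, ENNReal.toReal_mul, Real.log_mul] <;> positivity
  have hri : Integrable (fun y => (Q'.rnDeriv Q y).toReal) P :=
    integrable_toReal_of_lintegral_ne_top (Measure.measurable_rnDeriv _ _).aemeasurable hr
  have hle : ∫ y, llr P Q y ∂P ≤ ∫ y, (llr P Q' y + ((Q'.rnDeriv Q y).toReal - 1)) ∂P := by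
    refine integral_mono_ae hint (hint'.add (hri.sub (integrable_const 1))) ?_
    filter_upwards [hpos] with y hy
    rw [hy.1]
    have := Real.log_le_sub_one_of_pos hy.2
    linarith
  have hri' : Integrable (fun y => (Q'.rnDeriv Q y).toReal - 1) P := hri.sub (integrable_const 1)
  rw [integral_add hint' hri', integral_sub hri (integrable_const 1),
    ← toReal_klDiv_of_measure_eq hPQ (by simp), ← toReal_klDiv_of_measure_eq hPQ' (by simp),
    integral_toReal (Measure.measurable_rnDeriv _ _).aemeasurable
      (hPQ.ae_le (Measure.rnDeriv_lt_top Q' Q))] at hle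
  rw [← ENNReal.toReal_le_toReal (by simp [hP]) (by simp [hP', hr]),
    ENNReal.toReal_add hP (by simp), ENNReal.toReal_add hP' hr]
  simp at hle ⊢
  linarith

lemma lintegral_rnDeriv_bind_le {A B : Type*} [MeasurableSpace A] [MeasurableSpace B]
    (κ : Kernel A B) [IsMarkovKernel κ] (PX : Measure A) [IsProbabilityMeasure PX]
    (Q' : Measure B) [IsProbabilityMeasure Q'] :
    ∫⁻ x, ∫⁻ y, Q'.rnDeriv (κ ∘ₘ PX) y ∂(κ x) ∂PX ≤ 1 := by
  rw [← Measure.lintegral_bind (Kernel.aemeasurable _) (Measure.measurable_rnDeriv _ _).aemeasurable]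
  exact (Measure.lintegral_rnDeriv_le).trans_eq measure_univ

/-- Replacing the optimal output law by another one cannot decrease the average divergence. -/
lemma channelMutualInfo_le_lintegral_klDiv {A B : Type*} [MeasurableSpace A] [MeasurableSpace B]
    [MeasurableSpace.CountablyGenerated B]
    (κ : Kernel A B) [IsMarkovKernel κ] (PX : Measure A) [IsProbabilityMeasure PX]
    (hfin : channelMutualInfo PX κ ≠ ∞)
    (Q' : Measure B) [IsProbabilityMeasure Q'] :
    channelMutualInfo PX κ ≤ ∫⁻ x, klDiv (κ x) Q' ∂PX := by
  have hmeas := measurable_klDiv_kernel κ (κ ∘ₘ PX)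
  have hae : ∀ᵐ x ∂PX, klDiv (κ x) (κ ∘ₘ PX) ≠ ∞ :=
    (ae_lt_top hmeas hfin).mono fun x hx => hx.ne
  -- After averaging over `PX`, the density term is integrated against the optimal output law,
  -- contributes at most `1`, and cancels the added `1`.
  have h1 : ∫⁻ x, (klDiv (κ x) (κ ∘ₘ PX) + 1) ∂PX ≤
      ∫⁻ x, (klDiv (κ x) Q' + ∫⁻ y, Q'.rnDeriv (κ ∘ₘ PX) y ∂(κ x)) ∂PX := by
    refine lintegral_mono_ae ?_
    filter_upwards [hae] with x hx using klDiv_add_one_le (κ x) (κ ∘ₘ PX) Q' hx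
  rw [lintegral_add_right _ measurable_const, lintegral_add_right _
    ((Measure.measurable_rnDeriv _ _).lintegral_kernel)] at h1
  have h2 := h1.trans (add_le_add_right (lintegral_rnDeriv_bind_le κ PX Q') _)
  simp only [lintegral_const, measure_univ, mul_one] at h2
  exact (ENNReal.add_le_add_iff_right (by simp)).1 h2

/-- If an input law is optimal under a cost constraint, then the output law of any other admissible
input law is absolutely continuous with respect to the optimal output law. -/
lemma bind_absolutelyContinuous_of_optimal {A B : Type*} [MeasurableSpace A] [MeasurableSpace B]
    [MeasurableSpace.CountablyGenerated B]
    (κ : Kernel A B) [IsMarkovKernel κ] (b : A → ℝ≥0∞) (β : ℝ≥0∞) (hC : capacityCost κ b β ≠ ∞)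
    (PX : Measure A) [IsProbabilityMeasure PX] (hPXcost : ∫⁻ x, b x ∂PX ≤ β)
    (hPXopt : channelMutualInfo PX κ = capacityCost κ b β)
    (PR : Measure A) [IsProbabilityMeasure PR] (hR : ∫⁻ x, b x ∂PR ≤ β) :
    κ ∘ₘ PR ≪ κ ∘ₘ PX := by
  refine Measure.AbsolutelyContinuous.mk fun N hN h0 => ?_
  set C := capacityCost κ b β with hCdef
  -- Mix in `PR` with weight `t = exp (-a)`. The `ν`-null set `N` has mass at most `t` under the
  -- mixed output law, so the `PR` part of the mutual information is at least `t (a m - 1)`, where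
  -- `m` is the mass of `N` under the output law of `PR`. The `PX` part is at least `(1 - t) C`, and
  -- the total is at most `C`. Hence `a m ≤ C + 1` for every `a`.
  have key : ∀ a : ℝ, 0 < a → a * ((κ ∘ₘ PR) N).toReal ≤ C.toReal + 1 := by
    intro a ha
    set t := Real.exp (-a) with ht
    have ht0 : 0 < t := Real.exp_pos _
    have ht1 : t < 1 := by rw [ht, Real.exp_lt_one_iff]; linarith
    set Pt : Measure A := ENNReal.ofReal (1 - t) • PX + ENNReal.ofReal t • PR with hPt
    have hsum : ENNReal.ofReal (1 - t) + ENNReal.ofReal t = 1 := by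
      rw [← ENNReal.ofReal_add (by linarith) ht0.le]; simp
    have : IsProbabilityMeasure Pt := ⟨by simp [hPt, hsum]⟩
    have hcost : ∫⁻ x, b x ∂Pt ≤ β := by
      rw [hPt, lintegral_add_measure, lintegral_smul_measure, lintegral_smul_measure, smul_eq_mul,
        smul_eq_mul]
      calc _ ≤ ENNReal.ofReal (1 - t) * β + ENNReal.ofReal t * β := by gcongr
        _ = β := by rw [← add_mul, hsum, one_mul]
    have hle : channelMutualInfo Pt κ ≤ C :=
      le_iSup_of_le Pt (le_iSup_of_le this (le_iSup_of_le hcost le_rfl))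
    have hνt : κ ∘ₘ Pt = ENNReal.ofReal (1 - t) • (κ ∘ₘ PX) + ENNReal.ofReal t • (κ ∘ₘ PR) := by
      rw [hPt, Measure.comp_add, Measure.comp_smul, Measure.comp_smul]
    have hNt : (κ ∘ₘ Pt) N ≤ ENNReal.ofReal t := by
      rw [hνt, Measure.add_apply, Measure.smul_apply, h0, Measure.smul_apply, smul_zero, zero_add,
        smul_eq_mul]
      exact mul_le_of_le_one_right' prob_le_one
    have hgold := channelMutualInfo_le_lintegral_klDiv κ PX (by rw [hPXopt]; exact hC) (κ ∘ₘ Pt)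
    rw [hPXopt] at hgold
    have hyoung : ENNReal.ofReal a * (κ ∘ₘ PR) N ≤ ∫⁻ x, klDiv (κ x) (κ ∘ₘ Pt) ∂PR + 1 := by
      rw [Measure.bind_apply hN (Kernel.aemeasurable _), ← lintegral_const_mul _ (κ.measurable_coe hN)]
      calc _ ≤ ∫⁻ x, (klDiv (κ x) (κ ∘ₘ Pt) + 1) ∂PR :=
            lintegral_mono fun x => measure_mul_log_le_klDiv_add_one _ _ hNt
        _ = _ := by rw [lintegral_add_right _ measurable_const]; simp
    have hI : channelMutualInfo Pt κ = ENNReal.ofReal (1 - t) * ∫⁻ x, klDiv (κ x) (κ ∘ₘ Pt) ∂PX +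
        ENNReal.ofReal t * ∫⁻ x, klDiv (κ x) (κ ∘ₘ Pt) ∂PR := by
      rw [channelMutualInfo]
      conv_lhs => rw [hPt, lintegral_add_measure, lintegral_smul_measure, lintegral_smul_measure]
      rfl
    rw [hI] at hle
    have htot : ENNReal.ofReal (1 - t) * C + ENNReal.ofReal t * (ENNReal.ofReal a * (κ ∘ₘ PR) N) ≤
        C + ENNReal.ofReal t := by
      calc _ ≤ ENNReal.ofReal (1 - t) * ∫⁻ x, klDiv (κ x) (κ ∘ₘ Pt) ∂PX +
            ENNReal.ofReal t * (∫⁻ x, klDiv (κ x) (κ ∘ₘ Pt) ∂PR + 1) := by gcongr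
        _ = ENNReal.ofReal (1 - t) * ∫⁻ x, klDiv (κ x) (κ ∘ₘ Pt) ∂PX +
            ENNReal.ofReal t * ∫⁻ x, klDiv (κ x) (κ ∘ₘ Pt) ∂PR + ENNReal.ofReal t := by ring
        _ ≤ _ := by gcongr
    have hne : (κ ∘ₘ PR) N ≠ ∞ := measure_ne_top _ _
    rw [← ENNReal.toReal_le_toReal (by finiteness) (by finiteness),
      ENNReal.toReal_add (by finiteness) (by finiteness),
      ENNReal.toReal_add (by finiteness) (by finiteness)] at htot
    simp only [ENNReal.toReal_mul, ENNReal.toReal_ofReal ht0.le, ENNReal.toReal_ofReal ha.le,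
      ENNReal.toReal_ofReal (by linarith : 0 ≤ 1 - t)] at htot
    have h5 : t * (a * ((κ ∘ₘ PR) N).toReal) ≤ t * (C.toReal + 1) := by linarith
    exact le_of_mul_le_mul_left h5 ht0
  have hz : ((κ ∘ₘ PR) N).toReal = 0 := by
    by_contra hne
    have hpos : 0 < ((κ ∘ₘ PR) N).toReal := lt_of_le_of_ne ENNReal.toReal_nonneg (Ne.symm hne)
    have hC0 : 0 ≤ C.toReal := ENNReal.toReal_nonneg
    have := key ((C.toReal + 2) / ((κ ∘ₘ PR) N).toReal) (by positivity)
    rw [div_mul_cancel₀ _ hne] at this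
    linarith
  exact ((ENNReal.toReal_eq_zero_iff _).1 hz).resolve_right (measure_ne_top _ _)

/-- A letter of any finite cost enters an admissible input law with positive weight once it is mixed
with a letter of cost below `β`. -/
lemma kernel_absolutelyContinuous_of_optimal {A B : Type*} [MeasurableSpace A] [MeasurableSpace B]
    [MeasurableSpace.CountablyGenerated B]
    (κ : Kernel A B) [IsMarkovKernel κ] {b : A → ℝ≥0∞} (hb : Measurable b) {β : ℝ≥0}
    (hβ : ⨅ x, b x < (β : ℝ≥0∞)) (hC : capacityCost κ b β ≠ ∞)
    (PX : Measure A) [IsProbabilityMeasure PX] (hPXcost : ∫⁻ x, b x ∂PX ≤ β)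
    (hPXopt : channelMutualInfo PX κ = capacityCost κ b β) {x : A} (hx : b x ≠ ∞) :
    κ x ≪ κ ∘ₘ PX := by
  obtain ⟨x₀, hx₀⟩ := iInf_lt_iff.1 hβ
  have hx₀t : b x₀ ≠ ∞ := (hx₀.trans_le le_top).ne
  set p := (b x).toReal
  set q := (b x₀).toReal
  have hqβ : q < β := by
    have := (ENNReal.toReal_lt_toReal hx₀t (by simp)).2 hx₀
    simpa using this
  have hp0 : 0 ≤ p := ENNReal.toReal_nonneg
  have hq0 : 0 ≤ q := ENNReal.toReal_nonneg
  obtain ⟨w, hw0, hw1, hwc⟩ : ∃ w : ℝ, 0 < w ∧ w < 1 ∧ w * p + (1 - w) * q ≤ β := by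
    refine ⟨(β - q) / (β - q + p + 1), div_pos (by linarith) (by linarith), ?_, ?_⟩
    · rw [div_lt_one (by linarith)]; linarith
    · have hden : 0 < β - q + p + 1 := by linarith
      have e : (β - q) / (β - q + p + 1) * p + (1 - (β - q) / (β - q + p + 1)) * q =
          q + (β - q) * ((p - q) / (β - q + p + 1)) := by field_simp; ring
      rw [e]
      have : (p - q) / (β - q + p + 1) ≤ 1 := by rw [div_le_one hden]; linarith
      nlinarith
  set PR : Measure A := ENNReal.ofReal w • Measure.dirac x + ENNReal.ofReal (1 - w) • Measure.dirac x₀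
    with hR
  have hsum : ENNReal.ofReal w + ENNReal.ofReal (1 - w) = 1 := by
    rw [← ENNReal.ofReal_add hw0.le (by linarith)]; simp
  have : IsProbabilityMeasure PR := ⟨by simp [hR, hsum]⟩
  have hcost : ∫⁻ x, b x ∂PR ≤ β := by
    rw [hR, lintegral_add_measure, lintegral_smul_measure, lintegral_smul_measure,
      lintegral_dirac' _ hb, lintegral_dirac' _ hb, smul_eq_mul, smul_eq_mul,
      ← ENNReal.ofReal_toReal hx, ← ENNReal.ofReal_toReal hx₀t, ← ENNReal.ofReal_mul hw0.le,
      ← ENNReal.ofReal_mul (by linarith), ← ENNReal.ofReal_add (by positivity)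
        (mul_nonneg (by linarith) hq0)]
    exact (ENNReal.ofReal_le_ofReal hwc).trans_eq (ENNReal.ofReal_coe_nnreal)
  have h1 := bind_absolutelyContinuous_of_optimal κ b β hC PX hPXcost hPXopt PR hcost
  refine Measure.AbsolutelyContinuous.mk fun s hs hs0 => ?_
  have h2 := h1 hs0
  rw [hR, Measure.comp_add, Measure.comp_smul, Measure.comp_smul,
    Measure.dirac_bind κ.measurable, Measure.add_apply, Measure.smul_apply, add_eq_zero, smul_eq_mul,
    mul_eq_zero] at h2
  exact h2.1.resolve_left (by simpa using hw0)


/-! ### The divergence to the optimal output law is an affine function of the cost -/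

/-- Cauchy's equation on the half line. A negative value would, by taking multiples, break the lower
bound; so `φ` is nonnegative, hence monotone. Comparing `n * r` with its integer part then gives `n
|φ r - r φ 1| ≤ φ 1` for all `n`. -/
lemma eq_mul_of_additive_of_nonneg {φ : ℝ → ℝ} (hadd : ∀ r s, 0 ≤ r → 0 ≤ s → φ (r + s) = φ r + φ s)
    {K : ℝ} (hK : ∀ r, 0 ≤ r → -K ≤ φ r) : ∀ r, 0 ≤ r → φ r = r * φ 1 := by
  have h0 : φ 0 = 0 := by have := hadd 0 0 le_rfl le_rfl; simp at this; exact this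
  have hmul : ∀ (n : ℕ) (r : ℝ), 0 ≤ r → φ (n * r) = n * φ r := by
    intro n r hr
    induction n with
    | zero => simp [h0]
    | succ n ih =>
      push_cast
      rw [add_mul, one_mul, hadd _ _ (by positivity) hr, ih]
      ring
  have hnn : ∀ r, 0 ≤ r → 0 ≤ φ r := by
    intro r hr
    by_contra! hneg
    obtain ⟨n, hn⟩ := exists_nat_gt (K / -φ r)
    have h1 := hK (n * r) (by positivity)
    rw [hmul n r hr] at h1
    rw [div_lt_iff₀ (by linarith)] at hn
    linarith
  have hmono : ∀ r s, 0 ≤ r → r ≤ s → φ r ≤ φ s := by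
    intro r s hr hrs
    have := hadd r (s - r) hr (by linarith)
    rw [add_sub_cancel] at this
    linarith [hnn (s - r) (by linarith)]
  intro r hr
  have hbd : ∀ n : ℕ, n * |φ r - r * φ 1| ≤ φ 1 := by
    intro n
    have hnr : 0 ≤ n * r := by positivity
    have h1 := hmono (⌊n * r⌋₊ * 1) (n * r) (by positivity) (by simpa using Nat.floor_le hnr)
    have h2 := hmono (n * r) ((⌊n * r⌋₊ + 1 : ℕ) * 1) hnr (by simpa using (Nat.lt_floor_add_one _).le)
    rw [hmul _ _ zero_le_one, hmul n r hr] at h1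
    rw [hmul _ _ zero_le_one, hmul n r hr] at h2
    push_cast at h2
    have h3 := Nat.floor_le hnr
    have h4 := (Nat.lt_floor_add_one (n * r)).le
    have h5 := hnn 1 zero_le_one
    have h6 := mul_le_mul_of_nonneg_right h3 h5
    have h7 := mul_le_mul_of_nonneg_right h4 h5
    have e : n * |φ r - r * φ 1| = |n * φ r - n * r * φ 1| := by
      rw [← abs_of_nonneg (Nat.cast_nonneg n : (0 : ℝ) ≤ n), ← abs_mul,
        abs_of_nonneg (Nat.cast_nonneg n : (0 : ℝ) ≤ n)]
      congr 1; ring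
    rw [e, abs_le]
    constructor <;> linarith
  by_contra hne
  have hpos : 0 < |φ r - r * φ 1| := abs_pos.2 (sub_ne_zero.2 hne)
  obtain ⟨n, hn⟩ := exists_nat_gt (φ 1 / |φ r - r * φ 1|)
  rw [div_lt_iff₀ hpos] at hn
  linarith [hbd n]

/-- A function bounded below whose sums vanish along the zero sums of `c` is proportional to `c`. -/
lemma exists_eq_mul_of_sum_eq_zero {A : Type*} (S : Set A) (c E : A → ℝ)
    (h : ∀ l : List A, l ≠ [] → (∀ x ∈ l, x ∈ S) → (l.map c).sum = 0 → (l.map E).sum = 0)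
    {K : ℝ} (hK : ∀ x ∈ S, -K ≤ E x) (honto : ∀ r : ℝ, 0 ≤ r → ∃ x ∈ S, c x = r)
    {x₀ : A} (hx₀ : x₀ ∈ S) (hc₀ : c x₀ < 0) : ∃ μ : ℝ, ∀ x ∈ S, E x = μ * c x := by
  have : Nonempty A := ⟨x₀⟩
  choose! y hyS hyc using honto
  set φ : ℝ → ℝ := fun r => E (y r) with hφ
  -- Enough copies of `x₀`, where `c` is negative, together with one letter of suitable value `u ≥
  -- 0`, balance any given total.
  have hm : ∀ r : ℝ, ∃ (m : ℕ) (u : ℝ), 0 ≤ u ∧ u + r + m * c x₀ = 0 := fun r => by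
    obtain ⟨m, hm⟩ := exists_nat_gt (r / -c x₀)
    rw [div_lt_iff₀ (by linarith)] at hm
    exact ⟨m, m * -c x₀ - r, by linarith, by ring⟩
  have hmem : ∀ (m : ℕ) (l : List A), (∀ x ∈ l, x ∈ S) → ∀ x ∈ l ++ List.replicate m x₀, x ∈ S := by
    intro m l hl x hx
    rcases List.mem_append.1 hx with hx | hx
    · exact hl x hx
    · rw [List.eq_of_mem_replicate hx]; exact hx₀
  have h0 : φ 0 = 0 := by
    have := h [y 0] (by simp) (by simpa using hyS 0 le_rfl) (by simpa using hyc 0 le_rfl)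
    simpa using this
  have hadd : ∀ r s, 0 ≤ r → 0 ≤ s → φ (r + s) = φ r + φ s := by
    intro r s hr hs
    -- Two zero-sum lists with a common balancing part; the letter `y 0` adds nothing, since `E (y
    -- 0) = 0`.
    obtain ⟨m, u, hu, hm⟩ := hm (r + s)
    have e1 := h ([y r, y s, y u] ++ List.replicate m x₀) (by simp)
      (hmem m _ (by simp [hyS _ hr, hyS _ hs, hyS _ hu]))
      (by simp [hyc _ hr, hyc _ hs, hyc _ hu]; linarith)
    have e2 := h ([y (r + s), y 0, y u] ++ List.replicate m x₀) (by simp)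
      (hmem m _ (by simp [hyS _ (add_nonneg hr hs), hyS 0 le_rfl, hyS _ hu]))
      (by simp [hyc _ (add_nonneg hr hs), hyc 0 le_rfl, hyc _ hu]; linarith)
    simp only [List.cons_append, List.nil_append, List.map_cons, List.map_replicate, List.sum_cons,
      List.sum_replicate] at e1 e2
    simp only [hφ] at h0 ⊢
    linarith
  have hlin := eq_mul_of_additive_of_nonneg hadd (K := K) fun r hr => hK _ (hyS r hr)
  refine ⟨φ 1, fun x hx => ?_⟩
  have hz : ∀ z ∈ S, ∀ (m : ℕ) (u : ℝ), 0 ≤ u → u + c z + m * c x₀ = 0 →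
      E z + u * φ 1 + m * E x₀ = 0 := by
    intro z hz m u hu hm
    have e1 := h ([z, y u] ++ List.replicate m x₀) (by simp)
      (hmem m _ (by simp [hz, hyS _ hu])) (by simp [hyc _ hu]; linarith)
    simp only [List.cons_append, List.nil_append, List.map_cons, List.map_replicate, List.sum_cons,
      List.sum_replicate, nsmul_eq_mul] at e1
    rw [← hlin u hu]
    linarith
  obtain ⟨m, u, hu, hm⟩ := hm (c x)
  have e1 := hz x hx m u hu hm
  -- With the same `m`, the letter `y 0` in the role of `x` determines `m * E x₀`.
  have e2 := hz (y 0) (hyS 0 le_rfl) m (m * -c x₀) (mul_nonneg (Nat.cast_nonneg m) (by linarith))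
    (by rw [hyc 0 le_rfl]; ring)
  have h0' : E (y 0) = 0 := h0
  rw [h0'] at e2
  have : u = -c x - m * c x₀ := by linarith
  rw [this] at e1
  linarith

/-! ### Cost shells -/

lemma mem_costShell_iff {A : Type*} {b : A → ℝ≥0∞} {β : ℝ≥0} {n : ℕ} (hn : 1 ≤ n) {x : Fin n → A} :
    x ∈ costShell b β n ↔ ∑ i, b (x i) = n * (β : ℝ≥0∞) := by
  have hn0 : (n : ℝ≥0∞) ≠ 0 := by exact_mod_cast (by omega : n ≠ 0)
  rw [costShell, mem_ofPred_eq, blockCost, eq_comm, ENNReal.eq_div_iff hn0 (by simp), eq_comm]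

lemma mem_costShell_of_sum_eq_zero {A : Type*} {b : A → ℝ≥0∞} {β : ℝ≥0} {n : ℕ} (hn : 1 ≤ n)
    {x : Fin n → A} (hx : ∀ i, b (x i) ≠ ∞) (h : ∑ i, ((b (x i)).toReal - β) = 0) :
    x ∈ costShell b β n := by
  rw [mem_costShell_iff hn, ← ENNReal.toReal_eq_toReal_iff' (by simpa [ENNReal.sum_eq_top] using hx)
    (by finiteness), ENNReal.toReal_sum fun i _ => hx i]
  rw [Finset.sum_sub_distrib] at h
  simp at h ⊢
  linarith

lemma ne_top_of_mem_costShell {A : Type*} {b : A → ℝ≥0∞} {β : ℝ≥0} {n : ℕ} (hn : 1 ≤ n)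
    {x : Fin n → A} (hx : x ∈ costShell b β n) (i : Fin n) : b (x i) ≠ ∞ := by
  rw [mem_costShell_iff hn] at hx
  have : ∑ i, b (x i) ≠ ∞ := by rw [hx]; finiteness
  exact ENNReal.sum_ne_top.1 this i (Finset.mem_univ i)

/-- This makes assumption (c) available at every letter of finite cost: the letter is balanced by
cheap letters `x₀` and by one letter of the exact cost `γ ≥ β` that remains. -/
lemma exists_mem_costShell {A : Type*} {b : A → ℝ≥0∞} {β : ℝ≥0}
    (hβ : ⨅ x, b x < (β : ℝ≥0∞)) (h_onto : ∀ γ : ℝ≥0, β ≤ γ → ∃ x, b x = γ) {a : A} (ha : b a ≠ ∞) :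
    ∃ n : ℕ, 1 ≤ n ∧ ∃ x ∈ costShell b β n, ∃ i, x i = a := by
  obtain ⟨x₀, hx₀⟩ := iInf_lt_iff.1 hβ
  have hx₀t : b x₀ ≠ ∞ := (hx₀.trans_le le_top).ne
  have hq : (b x₀).toReal < β := by
    have := (ENNReal.toReal_lt_toReal hx₀t (by simp)).2 hx₀
    simpa using this
  obtain ⟨m, hm⟩ := exists_nat_gt (((b a).toReal - β) / (β - (b x₀).toReal))
  rw [div_lt_iff₀ (by linarith)] at hm
  set γ : ℝ := β + (m * (β - (b x₀).toReal) - ((b a).toReal - β)) with hγ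
  have hγβ : β ≤ γ.toNNReal := NNReal.le_toNNReal_of_coe_le (by linarith)
  have hγ0 : 0 ≤ γ := by have := β.coe_nonneg; linarith
  obtain ⟨z, hz⟩ := h_onto _ hγβ
  refine ⟨m + 2, by omega, Fin.cons a (Fin.cons z fun _ => x₀),
    mem_costShell_of_sum_eq_zero (by omega) ?_ ?_, 0, rfl⟩
  · intro i
    refine Fin.cases ha (fun i => ?_) i
    refine Fin.cases ?_ (fun i => hx₀t) i
    simp [hz]
  · simp only [Fin.sum_univ_succ, Fin.cons_zero, Fin.cons_succ, hz, ENNReal.coe_toReal,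
      Real.coe_toNNReal _ hγ0, Finset.sum_const, Finset.card_univ, Fintype.card_fin, nsmul_eq_mul]
    rw [hγ]
    ring

/-- One more letter takes a block of cost at most `β` to the cost shell. -/
lemma exists_cons_mem_costShell {A : Type*} {b : A → ℝ≥0∞} {β : ℝ≥0}
    (h_onto : ∀ γ : ℝ≥0, β ≤ γ → ∃ x, b x = γ) {n : ℕ} (hn : 1 ≤ n) {x : Fin n → A}
    (hx : blockCost b n x ≤ β) : ∃ a, (Fin.cons a x : Fin (n + 1) → A) ∈ costShell b β (n + 1) := by
  have hn0 : (n : ℝ≥0∞) ≠ 0 := by exact_mod_cast (by omega : n ≠ 0)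
  rw [blockCost, ENNReal.div_le_iff hn0 (by simp)] at hx
  have hsum : ∑ i, b (x i) ≠ ∞ := (hx.trans_lt (by finiteness)).ne
  set s := (∑ i, b (x i)).toNNReal with hs
  have hsc : (s : ℝ≥0∞) = ∑ i, b (x i) := ENNReal.coe_toNNReal hsum
  rw [← hsc] at hx
  have hx' : s ≤ β * n := by exact_mod_cast hx
  obtain ⟨a, ha⟩ := h_onto (β + (β * n - s)) le_self_add
  refine ⟨a, (mem_costShell_iff (by omega)).2 ?_⟩
  rw [Fin.sum_univ_succ]
  simp only [Fin.cons_zero, Fin.cons_succ]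
  rw [ha, ← hsc]
  have : (β + (β * n - s)) + s = (n + 1 : ℕ) * β := by
    rw [add_assoc, tsub_add_cancel_of_le hx']; push_cast; ring
  exact_mod_cast this


/-! ### Single-letter characterization of the capacity-cost function -/

lemma memLp_three_of_integrable_abs_sub {Ω : Type*} [MeasurableSpace Ω] {P : Measure Ω}
    [IsProbabilityMeasure P] {g : Ω → ℝ} (hg : Measurable g) (c : ℝ)
    (h : Integrable (fun y => |g y - c| ^ 3) P) : MemLp g 3 P := by
  have h1 : MemLp (fun y => g y - c) 3 P := by
    rw [← integrable_norm_rpow_iff (hg.sub_const c).aestronglyMeasurable (by norm_num) (by norm_num)]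
    refine h.congr (ae_of_all _ fun y => ?_)
    simp only [Real.norm_eq_abs, ENNReal.toReal_ofNat]
    exact_mod_cast rfl
  have := h1.add (memLp_const c)
  refine this.congr_norm hg.aestronglyMeasurable (ae_of_all _ fun y => ?_)
  simp

lemma integral_llr_memorylessChannel {A B : Type*} [MeasurableSpace A] [MeasurableSpace B]
    (κ : Kernel A B) [IsMarkovKernel κ] (ν : Measure B) [IsProbabilityMeasure ν] {n : ℕ}
    (x : Fin n → A) (hac : ∀ i, κ (x i) ≪ ν) (hint : ∀ i, Integrable (llr (κ (x i)) ν) (κ (x i))) :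
    ∫ y, llr (memorylessChannel κ n x) (Measure.pi fun _ => ν) y ∂(memorylessChannel κ n x) =
      ∑ i, ∫ y, llr (κ (x i)) ν y ∂(κ (x i)) := by
  have h := llr_pi (fun i => κ (x i)) (fun _ => ν) hac
  have e : memorylessChannel κ n x = Measure.pi fun i => κ (x i) := rfl
  rw [e, integral_congr_ae h, integral_finsetSum]
  · refine Finset.sum_congr rfl fun i _ => ?_
    exact integral_comp_eval (μ := fun i => κ (x i)) (measurable_llr _ _).aestronglyMeasurable
  · intro i _
    exact integrable_comp_eval (μ := fun i => κ (x i)) (hint i)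

lemma sum_get_eq_sum_map {A : Type*} (l : List A) (g : A → ℝ) :
    ∑ i, g (l.get i) = (l.map g).sum := by
  simp

/-- The mean information density is additive over the coordinates and, by symmetry, constant on each
shell. So the sums of `D - D x₁` vanish whenever the sums of `b - β` do, and nonnegativity of
divergence supplies the lower bound for the functional equation. -/
lemma exists_integral_llr_affine {A B : Type*} [MeasurableSpace A] [MeasurableSpace B]
    (κ : Kernel A B) [IsMarkovKernel κ] (ν : Measure B) [IsProbabilityMeasure ν]
    {b : A → ℝ≥0∞} {β : ℝ≥0} (hβ : ⨅ x, b x < (β : ℝ≥0∞))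
    (h_onto : ∀ γ : ℝ≥0, β ≤ γ → ∃ x, b x = γ)
    (h_symm : ∀ n : ℕ, 1 ≤ n → ∀ x ∈ costShell b β n, ∀ x' ∈ costShell b β n,
      (memorylessChannel κ n x).map
          (llr (memorylessChannel κ n x) (Measure.pi fun _ : Fin n => ν)) =
        (memorylessChannel κ n x').map
          (llr (memorylessChannel κ n x') (Measure.pi fun _ : Fin n => ν)))
    (hac : ∀ x, b x ≠ ∞ → κ x ≪ ν) (hint : ∀ x, b x ≠ ∞ → Integrable (llr (κ x) ν) (κ x))
    {x₁ : A} (hx₁ : b x₁ = β) :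
    ∃ μ : ℝ, ∀ x, b x ≠ ∞ → ∫ y, llr (κ x) ν y ∂(κ x) =
      ∫ y, llr (κ x₁) ν y ∂(κ x₁) + μ * ((b x).toReal - β) := by
  set D : A → ℝ := fun x => ∫ y, llr (κ x) ν y ∂(κ x) with hD
  have hDnn : ∀ x, b x ≠ ∞ → 0 ≤ D x := fun x hx => by
    rw [hD]
    simp only
    rw [← toReal_klDiv_of_measure_eq (hac x hx) (by simp)]
    exact ENNReal.toReal_nonneg
  have hshell : ∀ n : ℕ, 1 ≤ n → ∀ x ∈ costShell b β n, ∑ i, D (x i) = n * D x₁ := by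
    intro n hn x hx
    have hmean : ∀ x ∈ costShell b β n,
        ∫ z, z ∂((memorylessChannel κ n x).map
          (llr (memorylessChannel κ n x) (Measure.pi fun _ : Fin n => ν))) = ∑ i, D (x i) := by
      intro x hx
      rw [integral_map (measurable_llr _ _).aemeasurable (by fun_prop)]
      exact integral_llr_memorylessChannel κ ν x
        (fun i => hac _ (ne_top_of_mem_costShell hn hx i))
        (fun i => hint _ (ne_top_of_mem_costShell hn hx i))
    have hconst : (fun _ => x₁ : Fin n → A) ∈ costShell b β n := by
      rw [mem_costShell_iff hn]
      simp [hx₁]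
    rw [← hmean x hx, h_symm n hn x hx _ hconst, hmean _ hconst]
    simp
  obtain ⟨x₀, hx₀⟩ := iInf_lt_iff.1 hβ
  have hx₀t : b x₀ ≠ ∞ := (hx₀.trans_le le_top).ne
  obtain ⟨μ, hμ⟩ := exists_eq_mul_of_sum_eq_zero {x | b x ≠ ∞} (fun x => (b x).toReal - β)
    (fun x => D x - D x₁)
    (by
      intro l hl hlS hsum
      have hlen : 1 ≤ l.length := List.length_pos_iff.2 hl
      have hmem : l.get ∈ costShell b β l.length :=
        mem_costShell_of_sum_eq_zero hlen (fun i => hlS _ (List.get_mem _ _))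
          (by rw [← hsum]; exact sum_get_eq_sum_map l fun x => (b x).toReal - β)
      have := hshell l.length hlen l.get hmem
      have e : (l.map fun x => D x - D x₁).sum = ∑ i, (D (l.get i) - D x₁) :=
        (sum_get_eq_sum_map l fun x => D x - D x₁).symm
      rw [e, Finset.sum_sub_distrib, this]
      simp)
    (K := D x₁) (fun x hx => by have := hDnn x hx; linarith)
    (fun r hr => by
      obtain ⟨x, hx⟩ := h_onto (β + r.toNNReal) le_self_add
      refine ⟨x, by simp [hx], ?_⟩
      rw [hx, ENNReal.coe_toReal, NNReal.coe_add, Real.coe_toNNReal _ hr]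
      ring)
    (x₀ := x₀) hx₀t
    (by
      have := (ENNReal.toReal_lt_toReal hx₀t (by simp)).2 hx₀
      simp only [ENNReal.coe_toReal] at this
      linarith)
  refine ⟨μ, fun x hx => ?_⟩
  have := hμ x hx
  simp only [hD] at this
  linarith

/-- The affine formula is averaged over `PX`. The mean cost is exactly `β`, so the linear term
vanishes whatever its slope, and the constant term is the mutual information. -/
lemma klDiv_eq_capacityCost {A B : Type*} [MeasurableSpace A] [MeasurableSpace B]
    (κ : Kernel A B) [IsMarkovKernel κ]
    {b : A → ℝ≥0∞} (hb : Measurable b) {β : ℝ≥0} (hβ : ⨅ x, b x < (β : ℝ≥0∞))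
    (PX : Measure A) [IsProbabilityMeasure PX] (hPXcost : ∫⁻ x, b x ∂PX = β)
    (hPXopt : channelMutualInfo PX κ = capacityCost κ b β)
    (h_onto : ∀ γ : ℝ≥0, β ≤ γ → ∃ x, b x = γ)
    (h_symm : ∀ n : ℕ, 1 ≤ n → ∀ x ∈ costShell b β n, ∀ x' ∈ costShell b β n,
      (memorylessChannel κ n x).map
          (llr (memorylessChannel κ n x) (Measure.pi fun _ : Fin n => κ ∘ₘ PX)) =
        (memorylessChannel κ n x').map
          (llr (memorylessChannel κ n x') (Measure.pi fun _ : Fin n => κ ∘ₘ PX)))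
    (hac : ∀ x, b x ≠ ∞ → κ x ≪ κ ∘ₘ PX)
    (hint : ∀ x, b x ≠ ∞ → Integrable (llr (κ x) (κ ∘ₘ PX)) (κ x))
    {x₁ : A} (hx₁ : b x₁ = β) :
    capacityCost κ b β = klDiv (κ x₁) (κ ∘ₘ PX) := by
  set ν := κ ∘ₘ PX with hν
  obtain ⟨μ, hμ⟩ := exists_integral_llr_affine κ ν hβ h_onto h_symm hac hint hx₁
  have hkl : ∀ x, b x ≠ ∞ → klDiv (κ x) ν = ENNReal.ofReal (∫ y, llr (κ x) ν y ∂(κ x)) := by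
    intro x hx
    rw [← toReal_klDiv_of_measure_eq (hac x hx) (by simp),
      ENNReal.ofReal_toReal (klDiv_ne_top (hac x hx) (hint x hx))]
  have hfin : ∀ᵐ x ∂PX, b x ≠ ∞ :=
    (ae_lt_top hb (by rw [hPXcost]; simp)).mono fun x hx => hx.ne
  have hbi : Integrable (fun x => (b x).toReal) PX :=
    integrable_toReal_of_lintegral_ne_top hb.aemeasurable (by rw [hPXcost]; simp)
  have hbint : ∫ x, (b x).toReal ∂PX = β := by
    rw [integral_toReal hb.aemeasurable (hfin.mono fun x hx => hx.lt_top), hPXcost]; simp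
  set D₁ := ∫ y, llr (κ x₁) ν y ∂(κ x₁) with hD₁
  have hi' : Integrable (fun x => (b x).toReal - β) PX := hbi.sub (integrable_const _)
  have hi : Integrable (fun x => D₁ + μ * ((b x).toReal - β)) PX :=
    (integrable_const _).add (hi'.const_mul _)
  rw [hkl x₁ (by simp [hx₁]), ← hPXopt, channelMutualInfo]
  have e1 : ∫⁻ x, klDiv (κ x) ν ∂PX = ∫⁻ x, ENNReal.ofReal (D₁ + μ * ((b x).toReal - β)) ∂PX := by
    refine lintegral_congr_ae ?_
    filter_upwards [hfin] with x hx
    rw [hkl x hx, hμ x hx]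
  rw [e1, ← ofReal_integral_eq_lintegral_ofReal hi]
  · congr 1
    rw [integral_add (integrable_const _) (hi'.const_mul _),
      integral_const_mul, integral_sub hbi (integrable_const _), hbint]
    simp [hD₁]
  · filter_upwards [hfin] with x hx
    rw [← hμ x hx, ← toReal_klDiv_of_measure_eq (hac x hx) (by simp)]
    exact ENNReal.toReal_nonneg


/-! ### Codes from disjoint decoding sets -/

lemma hasCode_of_disjoint {X Y : Type*} [MeasurableSpace X] [MeasurableSpace Y]
    (W : Kernel X Y) [IsMarkovKernel W] {c : X → ℝ≥0∞} (hc : Measurable c) {M : ℕ} (hM : 0 < M)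
    {ε : ℝ} (hε1 : ε < 1) {β : ℝ≥0∞} (x : Fin M → X) (hx : ∀ i, c (x i) ≤ β)
    (D : Fin M → Set Y) (hD : ∀ i, MeasurableSet (D i)) (hdisj : Pairwise (Function.onFun Disjoint D))
    (hW : ∀ i, ENNReal.ofReal (1 - ε) ≤ W (x i) (D i)) : HasCode W c M ε β := by
  classical
  refine ⟨hM, ?_⟩
  obtain ⟨k, rfl⟩ : ∃ k, M = k + 1 := ⟨M - 1, by omega⟩
  -- Message `0` also receives the outputs outside all decoding sets. The decoder is then total, and
  -- enlarging a decoding set only helps its message.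
  set g : Y → Fin (k + 1) := fun y => if h : ∃ j, j ≠ 0 ∧ y ∈ D j then h.choose else 0 with hg
  have hg1 : ∀ j, j ≠ 0 → g ⁻¹' {j} = D j := by
    intro j hj
    ext y
    simp only [mem_preimage, mem_singleton_iff, hg]
    constructor
    · intro h
      split_ifs at h with h'
      · rw [← h]; exact h'.choose_spec.2
      · exact absurd h.symm hj
    · intro hy
      have h' : ∃ j, j ≠ 0 ∧ y ∈ D j := ⟨j, hj, hy⟩
      rw [dif_pos h']
      by_contra hne
      exact (Set.disjoint_left.1 (hdisj hne)) h'.choose_spec.2 hy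
  have hg0 : g ⁻¹' {0} = (⋃ j ∈ {j : Fin (k + 1) | j ≠ 0}, D j)ᶜ := by
    rw [← iff_of_eq (compl_inj_iff).eq, compl_compl]
    ext y
    simp only [mem_compl_iff, mem_preimage, mem_singleton_iff, mem_iUnion, mem_ofPred_eq]
    constructor
    · intro h
      exact ⟨g y, h, by rw [← hg1 (g y) h]; rfl⟩
    · rintro ⟨j, hj, hy⟩ h
      rw [← hg1 j hj] at hy
      exact hj (hy.symm.trans h)
  have hgm : Measurable g := by
    refine measurable_to_countable' fun j => ?_
    by_cases hj : j = 0
    · rw [hj, hg0]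
      exact (MeasurableSet.biUnion (to_countable _) fun i _ => hD i).compl
    · rw [hg1 j hj]; exact hD j
  have hsub : ∀ j, D j ⊆ g ⁻¹' {j} := by
    intro j
    by_cases hj : j = 0
    · rw [hj, hg0]
      intro y hy
      simp only [mem_compl_iff, mem_iUnion, not_exists]
      intro i hi hy'
      exact (Set.disjoint_left.1 (hdisj (show i ≠ 0 from hi))) hy' hy
    · rw [hg1 j hj]
  have hxm : Measurable x := Measurable.of_discrete
  refine ⟨Kernel.deterministic x hxm, Kernel.deterministic g hgm, inferInstance, inferInstance, ?_, ?_⟩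
  · intro m
    rw [Kernel.deterministic_apply, ae_dirac_iff (measurableSet_le hc measurable_const)]
    exact hx m
  · have herr : ∀ m, (Kernel.deterministic g hgm ∘ₖ (W ∘ₖ Kernel.deterministic x hxm)) m {m}ᶜ ≤
        ENNReal.ofReal ε := by
      intro m
      rw [Kernel.deterministic_comp_eq_map, Kernel.comp_deterministic_eq_comap,
        Kernel.map_apply' _ hgm _ (measurableSet_singleton m).compl, Kernel.comap_apply,
        preimage_compl, prob_compl_eq_one_sub (hgm (measurableSet_singleton m))]
      calc 1 - W (x m) (g ⁻¹' {m}) ≤ 1 - ENNReal.ofReal (1 - ε) :=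
            tsub_le_tsub_left ((hW m).trans (measure_mono (hsub m))) _
        _ = ENNReal.ofReal ε := by
          rw [← ENNReal.ofReal_one, ← ENNReal.ofReal_sub _ (by linarith)]
          congr 1; ring
    calc _ ≤ ((k + 1 : ℕ) : ℝ≥0∞)⁻¹ * ∑ _m : Fin (k + 1), ENNReal.ofReal ε := by
          gcongr with m; exact herr m
      _ = ENNReal.ofReal ε := by
        rw [Finset.sum_const, Finset.card_univ, Fintype.card_fin, nsmul_eq_mul, ← mul_assoc,
          ENNReal.inv_mul_cancel (by simp) (by finiteness), one_mul]

/-- Feinstein's maximal code construction: if every code has bounded size, there is a code which is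
maximal in the sense that no further codeword can be added. -/
lemma exists_maximal_code {X Y : Type*} [MeasurableSpace X] [MeasurableSpace Y]
    (W : Kernel X Y) [IsMarkovKernel W] {c : X → ℝ≥0∞} (hc : Measurable c)
    {ε : ℝ} (hε1 : ε < 1) {β : ℝ≥0∞} (F : Set X) (hF : ∀ x ∈ F, c x ≤ β)
    (E : X → Set Y) (hE : ∀ x, MeasurableSet (E x)) {N : ℕ}
    (hN : ∀ M, HasCode W c M ε β → M ≤ N) :
    ∃ (M : ℕ) (x : Fin M → X) (D : Fin M → Set Y), (0 < M → HasCode W c M ε β) ∧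
      (∀ i, x i ∈ F) ∧ (∀ i, MeasurableSet (D i)) ∧ (∀ i, D i ⊆ E (x i)) ∧
      ∀ z ∈ F, W z (E z \ ⋃ i, D i) < ENNReal.ofReal (1 - ε) := by
  classical
  -- The empty code is admitted, and sizes are bounded by `N`, so a greatest size exists.
  set G : ℕ → Prop := fun M => ∃ (x : Fin M → X) (D : Fin M → Set Y), (∀ i, x i ∈ F) ∧
    (∀ i, MeasurableSet (D i)) ∧ (∀ i, D i ⊆ E (x i)) ∧ Pairwise (Function.onFun Disjoint D) ∧
    ∀ i, ENNReal.ofReal (1 - ε) ≤ W (x i) (D i) with hG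
  have hcode : ∀ M, G M → 0 < M → HasCode W c M ε β := by
    rintro M ⟨x, D, h1, h2, -, h4, h5⟩ hM
    exact hasCode_of_disjoint W hc hM hε1 x (fun i => hF _ (h1 i)) D h2 h4 h5
  have hG0 : G 0 := ⟨Fin.elim0, Fin.elim0, fun i => i.elim0, fun i => i.elim0, fun i => i.elim0,
    fun i => i.elim0, fun i => i.elim0⟩
  have hfind := Nat.findGreatest_spec (P := G) (Nat.zero_le N) hG0
  set M := Nat.findGreatest G N
  have hmax : ¬ G (M + 1) := by
    intro h
    have h1 : M + 1 ≤ N := hN _ (hcode _ h (by omega))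
    have h2 := Nat.le_findGreatest h1 h
    omega
  obtain ⟨x, D, h1, h2, h3, h4, h5⟩ := hfind
  refine ⟨M, x, D, hcode M ⟨x, D, h1, h2, h3, h4, h5⟩, h1, h2, h3, fun z hz => ?_⟩
  by_contra! hcon
  -- A violating `z` would be one more codeword, decoded on the still unused part of `E z`.
  refine hmax ⟨Fin.cons z x, Fin.cons (E z \ ⋃ i, D i) D, ?_, ?_, ?_, ?_, ?_⟩
  · exact Fin.cases hz h1
  · exact Fin.cases ((hE z).diff (MeasurableSet.iUnion h2)) h2
  · exact Fin.cases (by simp) h3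
  · intro i j hij
    have hd : ∀ j, Disjoint (E z \ ⋃ i, D i) (D j) := fun j =>
      disjoint_sdiff_left.mono_right (subset_iUnion D j)
    revert hij
    refine Fin.cases ?_ (fun i => ?_) i <;> refine Fin.cases ?_ (fun j => ?_) j
    · intro h; exact absurd rfl h
    · intro _; exact hd j
    · intro _; exact (hd i).symm
    · intro h; exact h4 fun e => h (congrArg Fin.succ e)
  · exact Fin.cases hcon h5

/-! ### Converse -/

lemma map_tail_pi {Y : Type*} [MeasurableSpace Y] {n : ℕ} (μ : Fin (n + 1) → Measure Y)
    [∀ i, IsProbabilityMeasure (μ i)] :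
    (Measure.pi μ).map Fin.tail = Measure.pi fun i : Fin n => μ i.succ := by
  have h := measurePreserving_piFinSuccAbove μ 0
  have e : (Fin.tail : (Fin (n + 1) → Y) → Fin n → Y) =
      Prod.snd ∘ MeasurableEquiv.piFinSuccAbove (fun _ => Y) 0 := by
    funext y
    simp [MeasurableEquiv.piFinSuccAbove, Fin.insertNthEquiv]
  rw [e, ← Measure.map_map measurable_snd h.measurable, h.map_eq, Measure.map_snd_prod]
  simp

/-- One prepended letter moves the block to the shell of length `n + 1`. The test ignores the
additional output, so it has the same value under both extended laws; hence the index `n + 1`. -/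
lemma lintegral_memorylessChannel_le {A B : Type*} [MeasurableSpace A] [MeasurableSpace B]
    (κ : Kernel A B) [IsMarkovKernel κ] (ν : Measure B) [IsProbabilityMeasure ν]
    {b : A → ℝ≥0∞} {β : ℝ≥0} (h_onto : ∀ γ : ℝ≥0, β ≤ γ → ∃ x, b x = γ) (Λ : ℕ → Measure ℝ)
    (hac : ∀ x, b x ≠ ∞ → κ x ≪ ν)
    (hlaw : ∀ n : ℕ, 1 ≤ n → ∀ x ∈ costShell b β n, (memorylessChannel κ n x).map
      (llr (memorylessChannel κ n x) (Measure.pi fun _ : Fin n => ν)) = Λ n)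
    {n : ℕ} (hn : 1 ≤ n) {x : Fin n → A} (hx : blockCost b n x ≤ β) {d : (Fin n → B) → ℝ≥0∞}
    (hd : Measurable d) (hd1 : ∀ y, d y ≤ 1) (c : ℝ) :
    ∫⁻ y, d y ∂(memorylessChannel κ n x) ≤
      Λ (n + 1) (Ioi c) + ENNReal.ofReal (Real.exp c) * ∫⁻ y, d y ∂(Measure.pi fun _ => ν) := by
  obtain ⟨a, ha⟩ := exists_cons_mem_costShell h_onto hn hx
  set x' : Fin (n + 1) → A := Fin.cons a x with hx'
  have htm : Measurable (Fin.tail : (Fin (n + 1) → B) → Fin n → B) :=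
    measurable_pi_lambda _ fun i => measurable_pi_apply _
  have e1 : ∫⁻ y, d y ∂(memorylessChannel κ n x) =
      ∫⁻ y, d (Fin.tail y) ∂(memorylessChannel κ (n + 1) x') := by
    have : memorylessChannel κ n x = (memorylessChannel κ (n + 1) x').map Fin.tail :=
      (map_tail_pi fun i => κ (x' i)).symm
    rw [this, lintegral_map hd htm]
  have e2 : ∫⁻ y, d y ∂(Measure.pi fun _ : Fin n => ν) =
      ∫⁻ y, d (Fin.tail y) ∂(Measure.pi fun _ : Fin (n + 1) => ν) := by
    rw [← lintegral_map hd htm, map_tail_pi fun _ => ν]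
  have hP : memorylessChannel κ (n + 1) x' = Measure.pi fun i => κ (x' i) := rfl
  have hacn : memorylessChannel κ (n + 1) x' ≪ Measure.pi fun _ : Fin (n + 1) => ν :=
    pi_absolutelyContinuous (fun i => κ (x' i)) (fun _ => ν) fun i =>
      hac _ (ne_top_of_mem_costShell (by omega) ha i)
  have : IsProbabilityMeasure (memorylessChannel κ (n + 1) x') := by rw [hP]; infer_instance
  rw [e1, e2, ← hlaw (n + 1) (by omega) x' ha, Measure.map_apply (measurable_llr _ _) measurableSet_Ioi]
  exact lintegral_le_measure_llr_add hacn (hd.comp htm) (fun y => hd1 _) c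

/-- Meta-converse: every code of blocklength `n` is tested against the product output law. -/
lemma hasCode_converse {A B : Type*} [MeasurableSpace A] [MeasurableSpace B]
    (κ : Kernel A B) [IsMarkovKernel κ] (ν : Measure B) [IsProbabilityMeasure ν]
    {b : A → ℝ≥0∞} {β : ℝ≥0} (h_onto : ∀ γ : ℝ≥0, β ≤ γ → ∃ x, b x = γ) (Λ : ℕ → Measure ℝ)
    [∀ n, IsProbabilityMeasure (Λ n)] (hac : ∀ x, b x ≠ ∞ → κ x ≪ ν)
    (hlaw : ∀ n : ℕ, 1 ≤ n → ∀ x ∈ costShell b β n, (memorylessChannel κ n x).map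
      (llr (memorylessChannel κ n x) (Measure.pi fun _ : Fin n => ν)) = Λ n)
    {n : ℕ} (hn : 1 ≤ n) {M : ℕ} {ε : ℝ} (hε : 0 ≤ ε)
    (hcode : HasCode (memorylessChannel κ n) (blockCost b n) M ε β) (c : ℝ) :
    (M : ℝ) * (1 - ε) ≤ M * (Λ (n + 1)).real (Ioi c) + Real.exp c := by
  obtain ⟨hM, enc, dec, _, _, hcost, herr⟩ := hcode
  set W := memorylessChannel κ n with hW
  have hWm : IsMarkovKernel W := ⟨fun x => by
    change IsProbabilityMeasure (Measure.pi fun i => κ (x i)); infer_instance⟩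
  have hdm : ∀ m, Measurable fun y => dec y {m} := fun m => dec.measurable_coe (measurableSet_singleton m)
  have hm : ∀ m, (dec ∘ₖ (W ∘ₖ enc)) m {m} ≤ Λ (n + 1) (Ioi c) +
      ENNReal.ofReal (Real.exp c) * ∫⁻ y, dec y {m} ∂(Measure.pi fun _ => ν) := by
    intro m
    rw [Kernel.comp_apply' _ _ _ (measurableSet_singleton m), Kernel.lintegral_comp _ _ _ (hdm m)]
    calc _ ≤ ∫⁻ _, (Λ (n + 1) (Ioi c) + ENNReal.ofReal (Real.exp c) *
            ∫⁻ y, dec y {m} ∂(Measure.pi fun _ => ν)) ∂(enc m) := by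
          refine lintegral_mono_ae ?_
          filter_upwards [hcost m] with x hx
          exact lintegral_memorylessChannel_le κ ν h_onto Λ hac hlaw hn hx (hdm m)
            (fun y => prob_le_one) c
      _ = _ := by rw [lintegral_const, measure_univ, mul_one]
  -- The decoder's probabilities add up to one, so the contributions of the reference law sum to
  -- `exp c` for any number of messages.
  have hsum : ∑ m, (dec ∘ₖ (W ∘ₖ enc)) m {m} ≤
      M * Λ (n + 1) (Ioi c) + ENNReal.ofReal (Real.exp c) := by
    refine (Finset.sum_le_sum fun m _ => hm m).trans_eq ?_
    rw [Finset.sum_add_distrib, ← Finset.mul_sum, ← lintegral_finsetSum _ fun m _ => hdm m]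
    have : ∀ y, ∑ m, dec y {m} = 1 := fun y => by
      rw [sum_measure_singleton]
      simp
    simp [this]
  have herr' : ∑ m, (dec ∘ₖ (W ∘ₖ enc)) m {m}ᶜ ≤ M * ENNReal.ofReal ε := by
    have hM0 : (M : ℝ≥0∞) ≠ 0 := by exact_mod_cast hM.ne'
    calc _ = (M : ℝ≥0∞) * ((M : ℝ≥0∞)⁻¹ * ∑ m, (dec ∘ₖ (W ∘ₖ enc)) m {m}ᶜ) := by
          rw [← mul_assoc, ENNReal.mul_inv_cancel hM0 (by simp), one_mul]
      _ ≤ _ := by gcongr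
  have htot : (M : ℝ≥0∞) ≤ M * Λ (n + 1) (Ioi c) + ENNReal.ofReal (Real.exp c) +
      M * ENNReal.ofReal ε := by
    refine le_trans (le_of_eq ?_) (add_le_add hsum herr')
    rw [← Finset.sum_add_distrib]
    have : ∀ m, (dec ∘ₖ (W ∘ₖ enc)) m {m} + (dec ∘ₖ (W ∘ₖ enc)) m {m}ᶜ = 1 := fun m => by
      rw [measure_add_measure_compl (measurableSet_singleton m), measure_univ]
    simp [this]
  rw [← ENNReal.toReal_le_toReal (by simp) (by finiteness),
    ENNReal.toReal_add (by finiteness) (by finiteness),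
    ENNReal.toReal_add (by finiteness) (by finiteness), ENNReal.toReal_mul, ENNReal.toReal_mul,
    ENNReal.toReal_ofReal (Real.exp_pos c).le, ENNReal.toReal_ofReal hε, ENNReal.toReal_natCast] at htot
  rw [Measure.real]
  linarith


/-! ### Achievability -/

/-- The region where the likelihood ratio exceeds `exp c`. -/
def likelySet {Ω : Type*} [MeasurableSpace Ω] (P Q : Measure Ω) (c : ℝ) : Set Ω :=
  {y | ENNReal.ofReal (Real.exp c) < P.rnDeriv Q y ∧ P.rnDeriv Q y < ∞}

lemma measurableSet_likelySet {Ω : Type*} [MeasurableSpace Ω] (P Q : Measure Ω) (c : ℝ) :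
    MeasurableSet (likelySet P Q c) :=
  (measurableSet_lt measurable_const (Measure.measurable_rnDeriv _ _)).inter
    (measurableSet_lt (Measure.measurable_rnDeriv _ _) measurable_const)

lemma exp_lt_rnDeriv_iff {Ω : Type*} [MeasurableSpace Ω] {P Q : Measure Ω} {y : Ω} {s : ℝ}
    (h0 : 0 < P.rnDeriv Q y) (h1 : P.rnDeriv Q y < ∞) :
    ENNReal.ofReal (Real.exp s) < P.rnDeriv Q y ↔ s < llr P Q y := by
  have hpos := ENNReal.toReal_pos h0.ne' h1.ne
  rw [llr_def]
  simp only
  rw [Real.lt_log_iff_exp_lt hpos, ENNReal.ofReal_lt_iff_lt_toReal (Real.exp_pos _).le h1.ne]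

/-- The set is defined through the density because `llr` equals `0` where the density vanishes: for
`c < 0` such points lie in `{llr > c}` and may have large `Q`-mass. Under `P` the two sets agree. -/
lemma likelySet_ae_eq {Ω : Type*} [MeasurableSpace Ω] {P Q : Measure Ω}
    [IsProbabilityMeasure P] [IsProbabilityMeasure Q] (h : P ≪ Q) (c : ℝ) :
    likelySet P Q c =ᵐ[P] (llr P Q ⁻¹' Ioi c : Set Ω) := by
  filter_upwards [Measure.rnDeriv_pos h, h.ae_le (Measure.rnDeriv_lt_top P Q)] with y h1 h2
  have := exp_lt_rnDeriv_iff (s := c) h1 h2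
  apply propext
  constructor
  · exact fun hy => this.1 hy.1
  · exact fun hy => ⟨this.2 hy, h2⟩

lemma exp_neg_one_le_half : Real.exp (-1) ≤ 1 / 2 := by
  have := Real.add_one_le_exp (1 : ℝ)
  rw [Real.exp_neg, inv_eq_one_div]
  exact one_div_le_one_div_of_le (by norm_num) (by linarith)

/-- If the log-likelihood ratio falls in unit intervals with probability at most `b`, then the set
where it exceeds `c` has small probability under the reference law. -/
lemma measure_likelySet_le {Ω : Type*} [MeasurableSpace Ω] {P Q : Measure Ω}
    [IsProbabilityMeasure P] [IsProbabilityMeasure Q] (h : P ≪ Q) (c : ℝ) {b : ℝ} (hb : 0 ≤ b)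
    (hI : ∀ s, P (llr P Q ⁻¹' Ioc s (s + 1)) ≤ ENNReal.ofReal b) :
    Q (likelySet P Q c) ≤ ENNReal.ofReal (2 * b * Real.exp (-c)) := by
  -- Unit slices of the log-likelihood ratio: slice `j` has `P`-mass at most `b`, hence `Q`-mass at
  -- most `b exp (-c - j)`. The geometric series accounts for the factor `2`.
  set E : ℕ → Set Ω := fun j => likelySet P Q c ∩ llr P Q ⁻¹' Ioc (c + j) (c + j + 1) with hE
  have hpos : ∀ y ∈ likelySet P Q c, 0 < P.rnDeriv Q y := fun y hy => lt_of_le_of_lt zero_le hy.1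
  have hcov : likelySet P Q c ⊆ ⋃ j, E j := by
    intro y hy
    have h1 := (exp_lt_rnDeriv_iff (hpos y hy) hy.2).1 hy.1
    obtain ⟨j, hj⟩ : ∃ j : ℕ, llr P Q y ∈ Ioc (c + j) (c + j + 1) := by
      have hc0 : 0 < ⌈llr P Q y - c⌉₊ := Nat.ceil_pos.2 (by linarith)
      refine ⟨⌈llr P Q y - c⌉₊ - 1, ?_, ?_⟩
      · have := Nat.ceil_lt_add_one (by linarith : 0 ≤ llr P Q y - c)
        rw [Nat.cast_sub (by omega)]; push_cast; linarith
      · have := Nat.le_ceil (llr P Q y - c)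
        rw [Nat.cast_sub (by omega)]; push_cast; linarith
    exact mem_iUnion.2 ⟨j, hy, hj⟩
  have hbound : ∀ j, Q (E j) ≤ ENNReal.ofReal (b * Real.exp (-c) * Real.exp (-1) ^ j) := by
    intro j
    have h1 := measure_mul_le_of_le_rnDeriv h (S := E j) (c := ENNReal.ofReal (Real.exp (c + j)))
      (fun y hy => ((exp_lt_rnDeriv_iff (hpos y hy.1) hy.1.2).2 hy.2.1).le)
    have h2 : ENNReal.ofReal (Real.exp (c + j)) * Q (E j) ≤ ENNReal.ofReal b :=
      h1.trans ((measure_mono inter_subset_right).trans (hI _))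
    have e : ENNReal.ofReal (Real.exp (-(c + j))) * ENNReal.ofReal (Real.exp (c + j)) = 1 := by
      rw [← ENNReal.ofReal_mul (Real.exp_pos _).le, ← Real.exp_add]; simp
    calc Q (E j) = ENNReal.ofReal (Real.exp (-(c + j))) *
          (ENNReal.ofReal (Real.exp (c + j)) * Q (E j)) := by rw [← mul_assoc, e, one_mul]
      _ ≤ ENNReal.ofReal (Real.exp (-(c + j))) * ENNReal.ofReal b := by gcongr
      _ = _ := by
        rw [← ENNReal.ofReal_mul (Real.exp_pos _).le]
        congr 1
        rw [← Real.exp_nat_mul, neg_add, Real.exp_add]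
        ring_nf
  have hr0 : 0 ≤ Real.exp (-1) := (Real.exp_pos _).le
  have hr1 : Real.exp (-1) < 1 := by linarith [exp_neg_one_le_half]
  calc Q (likelySet P Q c) ≤ ∑' j, Q (E j) := (measure_mono hcov).trans (measure_iUnion_le _)
    _ ≤ ∑' j, ENNReal.ofReal (b * Real.exp (-c) * Real.exp (-1) ^ j) := ENNReal.tsum_le_tsum hbound
    _ = ENNReal.ofReal (∑' j : ℕ, b * Real.exp (-c) * Real.exp (-1) ^ j) :=
      (ENNReal.ofReal_tsum_of_nonneg (fun j => by positivity)
        ((summable_geometric_of_lt_one hr0 hr1).mul_left _)).symm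
    _ ≤ _ := by
      apply ENNReal.ofReal_le_ofReal
      rw [tsum_mul_left, tsum_geometric_of_lt_one hr0 hr1]
      have : (1 - Real.exp (-1))⁻¹ ≤ 2 := by
        rw [inv_le_comm₀ (by linarith) (by norm_num)]
        linarith [exp_neg_one_le_half]
      have h0 : 0 ≤ b * Real.exp (-c) := by positivity
      nlinarith

lemma measure_le_exp_mul_of_llr_le {Ω : Type*} [MeasurableSpace Ω] {P Q : Measure Ω}
    [IsProbabilityMeasure P] [IsProbabilityMeasure Q] (h : P ≪ Q) {f : ℝ}
    (hf : ∀ᵐ y ∂P, llr P Q y ≤ f) {s : Set Ω} (hs : MeasurableSet s) :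
    P s ≤ ENNReal.ofReal (Real.exp f) * Q s := by
  have hd := lintegral_le_measure_llr_add h (d := s.indicator 1) (measurable_one.indicator hs)
    (fun y => by by_cases hy : y ∈ s <;> simp [hy]) f
  rw [lintegral_indicator_one hs, lintegral_indicator_one hs] at hd
  have h0 : P {y | f < llr P Q y} = 0 := by
    rw [measure_eq_zero_iff_ae_notMem]
    filter_upwards [hf] with y hy
    simpa using hy
  rwa [h0, zero_add] at hd

/-- Feinstein's lemma for the cost shell. -/
lemma exists_hasCode_le {X Y : Type*} [MeasurableSpace X] [MeasurableSpace Y]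
    (W : Kernel X Y) [IsMarkovKernel W] {c : X → ℝ≥0∞} (hc : Measurable c)
    {ε : ℝ} (hε1 : ε < 1) {β : ℝ≥0∞} (F : Set X) (hF : ∀ x ∈ F, c x ≤ β)
    (Q : Measure Y) [IsProbabilityMeasure Q] (hac : ∀ x ∈ F, W x ≪ Q)
    (Λ : Measure ℝ) [IsProbabilityMeasure Λ] (hlaw : ∀ x ∈ F, (W x).map (llr (W x) Q) = Λ)
    {N : ℕ} (hN : ∀ M, HasCode W c M ε β → M ≤ N)
    (P : Measure X) [IsProbabilityMeasure P] (hPF : ∀ᵐ x ∂P, x ∈ F) (hPQ : W ∘ₘ P ≪ Q) {f : ℝ}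
    (hf : ∀ᵐ y ∂(W ∘ₘ P), llr (W ∘ₘ P) Q y ≤ f) (s : ℝ) (hs : Λ.real (Iic s) < ε)
    {b : ℝ} (hb : 0 ≤ b) (hbound : ∀ x ∈ F, Q (likelySet (W x) Q s) ≤ ENNReal.ofReal b) :
    ∃ M, HasCode W c M ε β ∧ ε - Λ.real (Iic s) ≤ M * Real.exp f * b := by
  obtain ⟨M, x, D, hcode, hxF, hDm, hDE, hmax⟩ := exists_maximal_code W hc hε1 F hF
    (fun x => likelySet (W x) Q s) (fun x => measurableSet_likelySet _ _ _) hN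
  have hUm : MeasurableSet (⋃ i, D i) := MeasurableSet.iUnion hDm
  have hQU : Q (⋃ i, D i) ≤ M * ENNReal.ofReal b := by
    refine (measure_iUnion_le _).trans ?_
    rw [tsum_fintype]
    calc _ ≤ ∑ _i : Fin M, ENNReal.ofReal b :=
          Finset.sum_le_sum fun i _ => (measure_mono (hDE i)).trans (hbound _ (hxF i))
      _ = _ := by simp
  have hPU : (W ∘ₘ P) (⋃ i, D i) ≤ ENNReal.ofReal (Real.exp f) * (M * ENNReal.ofReal b) :=
    (measure_le_exp_mul_of_llr_le hPQ hf hUm).trans (by gcongr)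
  -- By maximality, for each `z ∈ F` the union of decoding sets covers the likely set of `z` up to
  -- probability `1 - ε`. Averaging over `P` bounds its output mass from below.
  have hlow : Λ (Ioi s) ≤ (W ∘ₘ P) (⋃ i, D i) + ENNReal.ofReal (1 - ε) := by
    rw [Measure.bind_apply hUm (Kernel.aemeasurable _)]
    calc Λ (Ioi s) = ∫⁻ _, Λ (Ioi s) ∂P := by simp
      _ ≤ ∫⁻ z, (W z (⋃ i, D i) + ENNReal.ofReal (1 - ε)) ∂P := by
        refine lintegral_mono_ae ?_
        filter_upwards [hPF] with z hz
        have h1 : Λ (Ioi s) = W z (likelySet (W z) Q s) := by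
          rw [← hlaw z hz, Measure.map_apply (measurable_llr _ _) measurableSet_Ioi,
            measure_congr (likelySet_ae_eq (hac z hz) s)]
        rw [h1]
        calc W z (likelySet (W z) Q s) ≤ W z ((⋃ i, D i) ∪ (likelySet (W z) Q s \ ⋃ i, D i)) := by
              refine measure_mono fun y hy => ?_
              by_cases hy' : y ∈ ⋃ i, D i
              · exact Or.inl hy'
              · exact Or.inr ⟨hy, hy'⟩
          _ ≤ _ := (measure_union_le _ _).trans (by gcongr; exact (hmax z hz).le)
      _ = _ := by rw [lintegral_add_right _ measurable_const]; simp
  have hfin : Λ (Ioi s) ≤ ENNReal.ofReal (Real.exp f) * (M * ENNReal.ofReal b) +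
      ENNReal.ofReal (1 - ε) := hlow.trans (by gcongr)
  rw [← ENNReal.toReal_le_toReal (by finiteness) (by finiteness),
    ENNReal.toReal_add (by finiteness) (by finiteness)] at hfin
  simp only [ENNReal.toReal_mul, ENNReal.toReal_ofReal (Real.exp_pos f).le, ENNReal.toReal_ofReal hb,
    ENNReal.toReal_ofReal (by linarith : 0 ≤ 1 - ε), ENNReal.toReal_natCast] at hfin
  have hcompl : (Λ (Ioi s)).toReal = 1 - Λ.real (Iic s) := by
    rw [← compl_Iic, ← Measure.real, probReal_compl_eq_one_sub measurableSet_Iic]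
  rw [hcompl] at hfin
  have hmain : ε - Λ.real (Iic s) ≤ M * Real.exp f * b := by linarith
  refine ⟨M, hcode ?_, hmain⟩
  by_contra hM0
  have : M = 0 := by omega
  rw [this] at hmain
  simp at hmain
  linarith


/-! ### The inverse of the Gaussian tail function -/

lemma gaussianReal_real_Ioi (t : ℝ) : (gaussianReal 0 1).real (Ioi t) = stdCDF (-t) := by
  have hmap : (gaussianReal 0 1).map (fun x => -x) = gaussianReal 0 1 := by
    rw [gaussianReal_map_neg, neg_zero]
  have := nullSingletonClass_gaussianReal (μ := 0) (v := 1) one_ne_zero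
  rw [stdCDF, Measure.real, Measure.real]
  congr 1
  conv_lhs => rw [← hmap]
  rw [Measure.map_apply (by fun_prop) measurableSet_Ioi, ← measure_congr Iio_ae_eq_Iic]
  congr 1
  ext x
  simp

lemma stdCDF_eq_cdf : stdCDF = cdf (gaussianReal 0 1) := by
  funext x
  rw [stdCDF, cdf_eq_real]

lemma exists_stdCDF_eq {ε : ℝ} (h0 : 0 < ε) (h1 : ε < 1) : ∃ x, stdCDF x = ε := by
  have hbot : Tendsto stdCDF atBot (𝓝 0) := by rw [stdCDF_eq_cdf]; exact tendsto_cdf_atBot _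
  have htop : Tendsto stdCDF atTop (𝓝 1) := by rw [stdCDF_eq_cdf]; exact tendsto_cdf_atTop _
  obtain ⟨a, ha⟩ := (hbot.eventually (gt_mem_nhds h0)).exists
  obtain ⟨c, hc⟩ := (htop.eventually (lt_mem_nhds h1)).exists
  exact mem_range_of_exists_le_of_exists_ge continuous_stdCDF ⟨a, ha.le⟩ ⟨c, hc.le⟩

lemma stdCDF_neg_gaussianQInv {ε : ℝ} (h0 : 0 < ε) (h1 : ε < 1) :
    stdCDF (-gaussianQInv ε) = ε := by
  obtain ⟨x, hx⟩ := exists_stdCDF_eq h0 h1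
  have : gaussianQInv ε = -x := by
    rw [gaussianQInv]
    have e : {t : ℝ | (gaussianReal 0 1).real (Ioi t) ≤ ε} = Ici (-x) := by
      ext t
      simp only [mem_ofPred_eq, mem_Ici]
      rw [gaussianReal_real_Ioi, ← hx, strictMono_stdCDF.le_iff_le, neg_le]
    rw [e, csInf_Ici]
  rw [this, neg_neg, hx]

lemma stdCDF_neg_le_exp {t : ℝ} (ht : 0 ≤ t) : stdCDF (-t) ≤ Real.exp (-t ^ 2 / 2) := by
  rw [← gaussianReal_real_Ioi]
  have h := measure_ge_le_exp_mul_mgf (μ := gaussianReal 0 1) (X := id) t ht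
    (by simpa using integrable_exp_mul_gaussianReal t)
  rw [mgf_id_gaussianReal] at h
  refine (measureReal_mono fun x hx => ?_).trans (h.trans_eq ?_)
  · exact (mem_Ioi.1 hx).le
  · rw [← Real.exp_add]
    congr 1
    simp
    ring

lemma mul_sub_le_stdCDF_sub {m x y : ℝ} (hxy : x ≤ y) (hm : ∀ z ∈ Icc x y, m ≤ stdPDF z) :
    m * (y - x) ≤ stdCDF y - stdCDF x := by
  refine Convex.mul_sub_le_image_sub_of_le_deriv (convex_Icc x y) continuous_stdCDF.continuousOn
    (fun z _ => (hasDerivAt_stdCDF z).differentiableAt.differentiableWithinAt) (fun z hz => ?_)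
    x (left_mem_Icc.2 hxy) y (right_mem_Icc.2 hxy) hxy
  rw [(hasDerivAt_stdCDF z).deriv]
  exact hm z (interior_subset hz)

/-- The tail contains the interval `[-(t + 1), -t]` of length one, where the density is at least its
value at `t + 1`. -/
lemma stdPDF_le_stdCDF_neg {t : ℝ} (ht : 0 ≤ t) : stdPDF (t + 1) ≤ stdCDF (-t) := by
  have h := mul_sub_le_stdCDF_sub (m := stdPDF (t + 1)) (x := -(t + 1)) (y := -t) (by linarith)
    (fun z hz => by
      rw [stdPDF_eq, stdPDF_eq]
      have : z ^ 2 ≤ (t + 1) ^ 2 := by nlinarith [hz.1, hz.2]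
      gcongr)
  have := stdCDF_nonneg (-(t + 1))
  linarith

lemma exists_mul_sub_le_stdCDF_sub (p : ℝ) :
    ∃ m > 0, ∀ x y, p - 1 ≤ x → x ≤ y → y ≤ p + 1 → m * (y - x) ≤ stdCDF y - stdCDF x := by
  obtain ⟨z, -, hz⟩ := (isCompact_Icc (a := p - 1) (b := p + 1)).exists_isMinOn
    ⟨p, by simp⟩ continuous_stdPDF.continuousOn
  exact ⟨stdPDF z, stdPDF_pos z, fun x y h1 h2 h3 => mul_sub_le_stdCDF_sub h2 fun w hw =>
    hz ⟨h1.trans hw.1, hw.2.trans h3⟩⟩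

/-- Let `L = 2 log (1/ε)` and `q = Q⁻¹(ε)`. The Chernoff bound gives `q² ≤ L`, and the unit-interval
bound gives `L ≤ (q + 1)² + log (2π) ≤ q² + 2 q + 4`. -/
lemma tendsto_gaussianQInv_sq_div :
    Tendsto (fun ε : ℝ => gaussianQInv ε ^ 2 / (2 * Real.log (1 / ε))) (𝓝[>] 0) (𝓝 1) := by
  set L : ℝ → ℝ := fun ε => 2 * Real.log (1 / ε) with hL
  have hLtop : Tendsto L (𝓝[>] 0) atTop := by
    have : Tendsto (fun ε : ℝ => Real.log (1 / ε)) (𝓝[>] 0) atTop := by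
      refine Real.tendsto_log_atTop.comp ?_
      exact (tendsto_inv_nhdsGT_zero (𝕜 := ℝ)).congr fun x => (one_div x).symm
    exact this.const_mul_atTop (by norm_num)
  have hlow : Tendsto (fun ε => 1 - 2 / Real.sqrt (L ε) - 4 / L ε) (𝓝[>] 0) (𝓝 1) := by
    have h1 : Tendsto (fun ε => 2 / Real.sqrt (L ε)) (𝓝[>] 0) (𝓝 0) :=
      tendsto_const_nhds.div_atTop (Real.tendsto_sqrt_atTop.comp hLtop)
    have h2 : Tendsto (fun ε => 4 / L ε) (𝓝[>] 0) (𝓝 0) := tendsto_const_nhds.div_atTop hLtop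
    simpa using (tendsto_const_nhds (x := (1 : ℝ))).sub h1 |>.sub h2
  -- Below the median level the quantile `q` is nonnegative, as both tail bounds require.
  have hev : ∀ᶠ ε in 𝓝[>] (0 : ℝ), ε ∈ Ioo (0 : ℝ) (stdCDF 0) :=
    Ioo_mem_nhdsGT ((stdPDF_pos (0 + 1)).trans_le (by simpa using stdPDF_le_stdCDF_neg le_rfl))
  have key : ∀ᶠ ε in 𝓝[>] (0 : ℝ), gaussianQInv ε ^ 2 ≤ L ε ∧
      L ε ≤ gaussianQInv ε ^ 2 + 2 * Real.sqrt (L ε) + 4 ∧ 0 < L ε := by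
    filter_upwards [hev] with ε hε
    have hε0 := hε.1
    have hε1 : ε < 1 := hε.2.trans_le (stdCDF_le_one 0)
    have hq := stdCDF_neg_gaussianQInv hε0 hε1
    set q := gaussianQInv ε
    have hq0 : 0 ≤ q := by
      have : stdCDF (-q) < stdCDF 0 := by rw [hq]; exact hε.2
      have := strictMono_stdCDF.lt_iff_lt.1 this
      linarith
    have hLe : L ε = -(2 * Real.log ε) := by simp [hL]
    have h1 := stdCDF_neg_le_exp hq0
    rw [hq, ← Real.log_le_iff_le_exp hε0] at h1
    have hup : q ^ 2 ≤ L ε := by rw [hLe]; linarith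
    have h2 := stdPDF_le_stdCDF_neg hq0
    rw [hq, stdPDF_eq, ← Real.log_le_log_iff (by positivity) hε0, Real.log_mul (by positivity)
      (by positivity), Real.log_exp, Real.log_inv, Real.log_sqrt (by positivity)] at h2
    have h3 : Real.log (2 * Real.pi) ≤ 3 := by
      rw [Real.log_le_iff_le_exp (by positivity)]
      have ha := Real.add_one_le_exp (1 : ℝ)
      have : Real.exp 3 = Real.exp 1 ^ 3 := by rw [← Real.exp_nat_mul]; norm_num
      rw [this]
      have hb : (2 : ℝ) ^ 3 ≤ Real.exp 1 ^ 3 := by gcongr; linarith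
      have := Real.pi_lt_d2
      linarith
    have hsq : q ≤ Real.sqrt (L ε) := Real.le_sqrt_of_sq_le hup
    have hLpos : 0 < L ε := by
      rw [hLe]; have := Real.log_neg hε0 hε1; linarith
    refine ⟨hup, ?_, hLpos⟩
    have : L ε ≤ q ^ 2 + 2 * q + 4 := by rw [hLe]; nlinarith
    linarith
  refine tendsto_of_tendsto_of_tendsto_of_le_of_le' hlow tendsto_const_nhds ?_ ?_
  · filter_upwards [key] with ε hε
    obtain ⟨-, h2, h3⟩ := hε
    have hs : 0 < Real.sqrt (L ε) := Real.sqrt_pos.2 h3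
    have e : 1 - 2 / Real.sqrt (L ε) - 4 / L ε = (L ε - 2 * Real.sqrt (L ε) - 4) / L ε := by
      have : L ε / L ε = 1 := div_self h3.ne'
      have h4 : 2 * Real.sqrt (L ε) / L ε = 2 / Real.sqrt (L ε) := by
        rw [div_eq_div_iff h3.ne' hs.ne', mul_assoc, Real.mul_self_sqrt h3.le]
      rw [sub_div, sub_div, this, h4]
    rw [e]
    exact div_le_div_of_nonneg_right (by linarith) h3.le
  · filter_upwards [key] with ε hε
    exact (div_le_one hε.2.2).2 hε.1

/-! ### Quantiles of sums -/

/-- Here `m` is a lower bound for the slope of the distribution function near `p`, so an error `(K +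
1) / N` in probability costs at most `k / N` in the argument. The condition `k ≤ N` keeps the
argument in the window. In use, `K` is the Berry–Esseen constant and the extra `1` is the slack in
the choice of threshold. -/
lemma le_of_stdCDF_le {p k K m N τ : ℝ} (hm : 0 < m)
    (hmon : ∀ x y, p - 1 ≤ x → x ≤ y → y ≤ p + 1 → m * (y - x) ≤ stdCDF y - stdCDF x)
    (hk : k = (K + 1) / m) (hk0 : 0 ≤ k) (hN : 0 < N) (hkN : k ≤ N)
    (h : stdCDF τ ≤ stdCDF p + (K + 1) / N) : τ ≤ p + k / N := by
  by_contra! hlt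
  have h1 : 0 ≤ k / N := by positivity
  have h2 : k / N ≤ 1 := (div_le_one hN).2 hkN
  have h3 := hmon p (p + k / N) (by linarith) (by linarith) (by linarith)
  have h4 := strictMono_stdCDF hlt
  have h5 : m * (p + k / N - p) = (K + 1) / N := by rw [hk]; field_simp; ring
  linarith

lemma stdCDF_sub_le {p k K m N : ℝ} (hm : 0 < m)
    (hmon : ∀ x y, p - 1 ≤ x → x ≤ y → y ≤ p + 1 → m * (y - x) ≤ stdCDF y - stdCDF x)
    (hk : k = (K + 1) / m) (hk0 : 0 ≤ k) (hN : 0 < N) (hkN : k ≤ N) :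
    stdCDF (p - k / N) ≤ stdCDF p - (K + 1) / N := by
  have h1 : 0 ≤ k / N := by positivity
  have h2 : k / N ≤ 1 := (div_le_one hN).2 hkN
  have h3 := hmon (p - k / N) p (by linarith) (by linarith) (by linarith)
  have h5 : m * (p - (p - k / N)) = (K + 1) / N := by rw [hk]; field_simp; ring
  linarith


/-! ### Second-order expansion of a sequence of code sizes -/

lemma exists_forall_le_of_eventually_le {u : ℕ → ℝ} {K : ℝ} (h : ∀ᶠ n in atTop, u n ≤ K) :
    ∃ K', ∀ n, u n ≤ K' := by
  obtain ⟨K', hK'⟩ := (IsBoundedUnder.bddAbove_range (f := u) ⟨K, by simpa using h⟩)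
  exact ⟨K', fun n => hK' (mem_range_self n)⟩

lemma eq_dirac_of_variance_eq_zero {μ : Measure ℝ} [IsProbabilityMeasure μ]
    (h2 : MemLp (fun x : ℝ => x) 2 μ) {C : ℝ} (hC : ∫ x, x ∂μ = C)
    (hV : Var[fun x => x; μ] = 0) : μ = Measure.dirac C := by
  have he : (fun x : ℝ => x) =ᵐ[μ] fun _ => C := by
    rw [← hC]
    refine (evariance_eq_zero_iff (by fun_prop)).1 ?_
    rw [← h2.ofReal_variance_eq, hV, ENNReal.ofReal_zero]
  calc μ = μ.map fun x => x := Measure.map_id'.symm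
    _ = μ.map fun _ => C := Measure.map_congr he
    _ = Measure.dirac C := by rw [Measure.map_const]; simp

lemma convPow_dirac (C : ℝ) (n : ℕ) : convPow (Measure.dirac C) n = Measure.dirac (n * C) := by
  induction n with
  | zero => simp [convPow]
  | succ n ih =>
    rw [convPow, ih, Measure.dirac_conv, Measure.map_dirac' (by fun_prop)]
    push_cast
    congr 1
    ring

lemma real_Ioi_eq_one_sub (μ : Measure ℝ) [IsProbabilityMeasure μ] (c : ℝ) :
    μ.real (Ioi c) = 1 - μ.real (Iic c) := by
  rw [← compl_Iic, probReal_compl_eq_one_sub measurableSet_Iic]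

/-- Second-order converse: a sequence of sizes satisfying the metaconverse inequality. -/
lemma exists_log_le (μ : Measure ℝ) [IsProbabilityMeasure μ]
    (h3 : MemLp (fun x : ℝ => x) 3 μ) {C V : ℝ} (hC : ∫ x, x ∂μ = C) (hV : Var[fun x => x; μ] = V)
    {ε : ℝ} (hε0 : 0 < ε) (hε1 : ε < 1) {M : ℕ → ℕ} (hM : ∀ n, 1 ≤ n → 1 ≤ M n)
    (hconv : ∀ n, 1 ≤ n → ∀ c, (M n : ℝ) * (1 - ε) ≤
      M n * (convPow μ (n + 1)).real (Ioi c) + Real.exp c) :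
    ∃ K, ∀ n, 1 ≤ n → Real.log (M n) ≤
      n * C - Real.sqrt (n * V) * gaussianQInv ε + 1 / 2 * Real.log n + K := by
  suffices h : ∃ K, ∀ᶠ n : ℕ in atTop, Real.log (M n) -
      (n * C - Real.sqrt (n * V) * gaussianQInv ε + 1 / 2 * Real.log n) ≤ K by
    obtain ⟨K, hK⟩ := h
    obtain ⟨K', hK'⟩ := exists_forall_le_of_eventually_le hK
    exact ⟨K', fun n _ => by linarith [hK' n]⟩
  have hVnn : 0 ≤ V := hV ▸ variance_nonneg _ _
  rcases hVnn.eq_or_lt with hV0 | hV0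
  -- For `V = 0` there is no Gaussian approximation, but the sum is deterministic: the threshold at
  -- its atom leaves no mass strictly above.
  · have hd := eq_dirac_of_variance_eq_zero (h3.mono_exponent (by norm_num)) hC (by rw [hV, hV0])
    refine ⟨C - Real.log (1 - ε), ?_⟩
    filter_upwards [eventually_ge_atTop 1] with n hn
    have hMn : (0 : ℝ) < M n := by exact_mod_cast hM n hn
    have h := hconv n hn ((n + 1 : ℕ) * C)
    rw [hd, convPow_dirac, Measure.real, Measure.dirac_apply' _ measurableSet_Ioi] at h
    simp only [mem_Ioi, lt_self_iff_false, not_false_eq_true, indicator_of_notMem,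
      ENNReal.toReal_zero, mul_zero, zero_add] at h
    rw [← Real.log_le_iff_le_exp (mul_pos hMn (by linarith)),
      Real.log_mul hMn.ne' (by linarith)] at h
    have hlog : 0 ≤ Real.log n := Real.log_natCast_nonneg n
    rw [← hV0, mul_zero, Real.sqrt_zero]
    push_cast at h
    linarith
  · obtain ⟨K, hK0, hBE⟩ := exists_berry_esseen μ h3 hC hV hV0
    set p := -gaussianQInv ε with hp
    have hpε : stdCDF p = ε := stdCDF_neg_gaussianQInv hε0 hε1
    obtain ⟨m, hm, hmon⟩ := exists_mul_sub_le_stdCDF_sub p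
    set k := (K + 1) / m with hk
    have hk0 : 0 ≤ k := by positivity
    have hsV : 0 < Real.sqrt V := Real.sqrt_pos.2 hV0
    refine ⟨C + Real.sqrt V * |p| + Real.sqrt V * k + 1, ?_⟩
    have hev : ∀ᶠ n : ℕ in atTop, k ≤ Real.sqrt n :=
      (Real.tendsto_sqrt_atTop.comp tendsto_natCast_atTop_atTop).eventually_ge_atTop k
    filter_upwards [eventually_ge_atTop 1, hev] with n hn hkn
    have hMn : (0 : ℝ) < M n := by exact_mod_cast hM n hn
    have hn1 : (1 : ℝ) ≤ n := by exact_mod_cast hn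
    set N : ℝ := n + 1 with hN
    have hN0 : 0 < N := by positivity
    have hsN : 0 < Real.sqrt N := Real.sqrt_pos.2 hN0
    have hsn : Real.sqrt n ≤ Real.sqrt N := Real.sqrt_le_sqrt (by linarith)
    have hsn' : Real.sqrt N ≤ Real.sqrt n + 1 := by
      rw [Real.sqrt_le_left (by positivity), add_sq, Real.sq_sqrt (by positivity)]
      nlinarith [Real.sqrt_nonneg (n : ℝ)]
    -- This gives `exp c = M / √N`, so the last term of the metaconverse costs `1/√N` in
    -- probability, the order of the Berry–Esseen error. It is the source of `(1/2) log n`.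
    set c := Real.log (M n) - 1 / 2 * Real.log N with hc
    have hexp : Real.exp c = M n / Real.sqrt N := by
      rw [hc, Real.exp_sub, Real.exp_log hMn, one_div_mul_eq_div, ← Real.log_sqrt hN0.le,
        Real.exp_log hsN]
    have h := hconv n hn c
    rw [hexp, real_Ioi_eq_one_sub] at h
    have h1 : (convPow μ (n + 1)).real (Iic c) ≤ ε + 1 / Real.sqrt N := by
      have : (M n : ℝ) * (convPow μ (n + 1)).real (Iic c) ≤ M n * (ε + 1 / Real.sqrt N) := by
        have e : (M n : ℝ) / Real.sqrt N = M n * (1 / Real.sqrt N) := by ring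
        rw [e] at h
        linarith
      exact le_of_mul_le_mul_left this hMn
    have h2 := hBE (n + 1) (by omega) c
    push_cast at h2
    rw [← hN] at h2
    have h3 := (abs_le.1 h2).1
    have h4 := le_of_stdCDF_le hm hmon hk hk0 hsN (hkn.trans hsn) (τ := (c - N * C) / Real.sqrt (N * V))
      (by rw [hpε, add_div]; linarith)
    rw [Real.sqrt_mul hN0.le, div_le_iff₀ (mul_pos hsN hsV)] at h4
    have e : (p + k / Real.sqrt N) * (Real.sqrt N * Real.sqrt V) =
        Real.sqrt V * p * Real.sqrt N + Real.sqrt V * k := by field_simp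
    rw [e] at h4
    -- The quantile is taken at length `N = n + 1`; passing back to `n` changes it by a bounded
    -- amount because `√N - √n ≤ 1`.
    have h5 : p * (Real.sqrt N - Real.sqrt n) ≤ |p| := by
      have := mul_le_mul (le_abs_self p) (by linarith : Real.sqrt N - Real.sqrt n ≤ 1)
        (by linarith) (abs_nonneg p)
      linarith
    have h6 : Real.sqrt V * (p * (Real.sqrt N - Real.sqrt n)) ≤ Real.sqrt V * |p| :=
      mul_le_mul_of_nonneg_left h5 hsV.le
    have h7 : Real.log N ≤ Real.log n + 1 := by
      have : N ≤ Real.exp 1 * n := by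
        have := Real.add_one_le_exp (1 : ℝ)
        nlinarith
      calc Real.log N ≤ Real.log (Real.exp 1 * n) := Real.log_le_log hN0 this
        _ = Real.log n + 1 := by
          rw [Real.log_mul (Real.exp_pos _).ne' (by positivity), Real.log_exp, add_comm]
    have e2 : Real.sqrt (n * V) * gaussianQInv ε = -(Real.sqrt V * p * Real.sqrt n) := by
      rw [Real.sqrt_mul (by positivity), hp]; ring
    rw [e2]
    have e3 : N * C = n * C + C := by rw [hN]; ring
    rw [e3] at h4
    nlinarith

/-- Second-order achievability: a sequence of sizes satisfying the Feinstein-type inequality. -/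
lemma exists_le_log (μ : Measure ℝ) [IsProbabilityMeasure μ]
    (h3 : MemLp (fun x : ℝ => x) 3 μ) {C V : ℝ} (hC : ∫ x, x ∂μ = C) (hV : Var[fun x => x; μ] = V)
    {ε : ℝ} (hε0 : 0 < ε) (hε1 : ε < 1) {M : ℕ → ℕ} (hM : ∀ n, 1 ≤ n → 1 ≤ M n) (f : ℕ → ℝ)
    (hach : ∀ n, 1 ≤ n → ∀ s b, 0 ≤ b → (∀ t, (convPow μ n).real (Ioc t (t + 1)) ≤ b) →
      (convPow μ n).real (Iic s) < ε →
      ε - (convPow μ n).real (Iic s) ≤ M n * Real.exp (f n) * (2 * b * Real.exp (-s))) :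
    ∃ K, ∀ n : ℕ, 1 ≤ n →
      n * C - Real.sqrt (n * V) * gaussianQInv ε - f n - K ≤ Real.log (M n) := by
  suffices h : ∃ K, ∀ᶠ n : ℕ in atTop,
      (n : ℝ) * C - Real.sqrt (n * V) * gaussianQInv ε - f n - Real.log (M n) ≤ K by
    obtain ⟨K, hK⟩ := h
    obtain ⟨K', hK'⟩ := exists_forall_le_of_eventually_le hK
    exact ⟨K', fun n _ => by linarith [hK' n]⟩
  have key : ∀ n, 1 ≤ n → ∀ s a b : ℝ, 0 < a → 0 < b → a ≤ M n * Real.exp (f n) * (b * Real.exp (-s)) →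
      s - f n + Real.log a - Real.log b ≤ Real.log (M n) := by
    intro n hn s a b ha hb h
    have hMn : (0 : ℝ) < M n := by exact_mod_cast hM n hn
    have := Real.log_le_log ha h
    rw [Real.log_mul (by positivity) (by positivity), Real.log_mul hMn.ne' (by positivity),
      Real.log_mul hb.ne' (by positivity), Real.log_exp, Real.log_exp] at this
    linarith
  have hVnn : 0 ≤ V := hV ▸ variance_nonneg _ _
  rcases hVnn.eq_or_lt with hV0 | hV0
  · have hd := eq_dirac_of_variance_eq_zero (h3.mono_exponent (by norm_num)) hC (by rw [hV, hV0])
    refine ⟨1 - Real.log ε + Real.log 2, ?_⟩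
    filter_upwards [eventually_ge_atTop 1] with n hn
    -- In the deterministic case a threshold one below the atom leaves the full slack `ε`, and the
    -- trivial bound `1` on the mass of unit intervals suffices.
    have h0 : (convPow μ n).real (Iic (n * C - 1)) = 0 := by
      rw [hd, convPow_dirac, Measure.real, Measure.dirac_apply' _ measurableSet_Iic]
      simp
    have h := hach n hn (n * C - 1) 1 zero_le_one (fun t => measureReal_le_one) (by rwa [h0])
    rw [h0, sub_zero, mul_one] at h
    have := key n hn _ _ _ hε0 two_pos h
    rw [← hV0, mul_zero, Real.sqrt_zero]
    linarith
  · obtain ⟨K, hK0, hBE⟩ := exists_berry_esseen μ h3 hC hV hV0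
    set p := -gaussianQInv ε with hp
    have hpε : stdCDF p = ε := stdCDF_neg_gaussianQInv hε0 hε1
    obtain ⟨m, hm, hmon⟩ := exists_mul_sub_le_stdCDF_sub p
    set k := (K + 1) / m with hk
    have hk0 : 0 ≤ k := by positivity
    have hsV : 0 < Real.sqrt V := Real.sqrt_pos.2 hV0
    set b₀ := 1 / Real.sqrt V + 2 * K with hb₀
    have hb₀0 : 0 < b₀ := by positivity
    refine ⟨Real.sqrt V * k + Real.log (2 * b₀), ?_⟩
    have hev : ∀ᶠ n : ℕ in atTop, k ≤ Real.sqrt n :=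
      (Real.tendsto_sqrt_atTop.comp tendsto_natCast_atTop_atTop).eventually_ge_atTop k
    filter_upwards [eventually_ge_atTop 1, hev] with n hn hkn
    have hn0 : (0 : ℝ) < n := by exact_mod_cast hn
    have hsn : 0 < Real.sqrt n := Real.sqrt_pos.2 hn0
    have hsnV : 0 < Real.sqrt (n * V) := Real.sqrt_pos.2 (by positivity)
    have eV : Real.sqrt (n * V) = Real.sqrt n * Real.sqrt V := Real.sqrt_mul hn0.le V
    -- The threshold lies below the Gaussian `ε`-quantile by a shift, in standardized units, that
    -- covers the Berry–Esseen error and still leaves slack `1/√n`.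
    set c := n * C + Real.sqrt (n * V) * (p - k / Real.sqrt n) with hc
    have h1 : (convPow μ n).real (Iic c) ≤ ε - 1 / Real.sqrt n := by
      have h := (abs_le.1 (hBE n hn c)).2
      have e : (c - n * C) / Real.sqrt (n * V) = p - k / Real.sqrt n := by
        rw [hc, add_sub_cancel_left, mul_div_cancel_left₀ _ hsnV.ne']
      rw [e] at h
      have := stdCDF_sub_le hm hmon hk hk0 hsn hkn
      rw [hpε, add_div] at this
      linarith
    have hpos : 0 < 1 / Real.sqrt n := by positivity
    -- The law of the sum gives a unit interval the Gaussian mass plus two Berry–Esseen errors, all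
    -- `O(1/√n)`. This cancels against the slack, so the lower bound carries no logarithm.
    have hb : ∀ t, (convPow μ n).real (Ioc t (t + 1)) ≤ b₀ / Real.sqrt n := by
      intro t
      have e : (convPow μ n).real (Ioc t (t + 1)) =
          (convPow μ n).real (Iic (t + 1)) - (convPow μ n).real (Iic t) := by
        rw [← Iic_sdiff_Iic, measureReal_sdiff (Iic_subset_Iic.2 (by linarith)) measurableSet_Iic]
      have ha := (abs_le.1 (hBE n hn t)).1
      have ha' := (abs_le.1 (hBE n hn (t + 1))).2
      have hL := (abs_le.1 (abs_stdCDF_sub_le ((t - n * C) / Real.sqrt (n * V))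
        ((t + 1 - n * C) / Real.sqrt (n * V)))).2
      have e2 : (t + 1 - n * C) / Real.sqrt (n * V) - (t - n * C) / Real.sqrt (n * V) =
          1 / Real.sqrt V / Real.sqrt n := by
        rw [← sub_div, eV]; field_simp; ring
      rw [e2, abs_of_pos (by positivity)] at hL
      have e3 : b₀ / Real.sqrt n = 1 / Real.sqrt V / Real.sqrt n + 2 * (K / Real.sqrt n) := by
        rw [hb₀]; ring
      rw [e, e3]
      linarith
    have h := hach n hn c (b₀ / Real.sqrt n) (by positivity) hb (by linarith)
    have h' : 1 ≤ M n * Real.exp (f n) * (2 * b₀ * Real.exp (-c)) := by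
      have h2 : 1 / Real.sqrt n ≤
          (M n * Real.exp (f n) * (2 * b₀ * Real.exp (-c))) / Real.sqrt n := by
        refine (by linarith : 1 / Real.sqrt n ≤ ε - (convPow μ n).real (Iic c)).trans
          (h.trans_eq ?_)
        ring
      exact (div_le_div_iff_of_pos_right hsn).1 h2
    have h4 := key n hn c 1 (2 * b₀) one_pos (by positivity) h'
    rw [Real.log_one] at h4
    have e4 : c = n * C - Real.sqrt (n * V) * gaussianQInv ε - Real.sqrt V * k := by
      rw [hc, hp, eV]; field_simp; ring
    linarith

lemma isLittleO_log_sqrt : (fun n : ℕ => Real.log n) =o[atTop] fun n : ℕ => Real.sqrt n := by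
  have := (isLittleO_log_rpow_atTop (r := 1 / 2) (by norm_num)).comp_tendsto
    tendsto_natCast_atTop_atTop
  simpa only [Function.comp_def, ← Real.sqrt_eq_rpow] using this

/-- Both bounds on `θ` are `o(√n)`, so `n C - L n` is `√n` times a sequence tending to `√V q`. -/
lemma tendsto_sq_div_of_expansion {L θ f : ℕ → ℝ} {C V q K d : ℝ} (hV : 0 ≤ V)
    (hf : f =o[atTop] fun n : ℕ => Real.sqrt n)
    (h : ∀ n : ℕ, 1 ≤ n → L n = n * C - Real.sqrt (n * V) * q + θ n ∧
      -f n - K ≤ θ n ∧ θ n ≤ 1 / 2 * Real.log n + K) :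
    Tendsto (fun n : ℕ => 1 / (n : ℝ) * ((n * C - L n) ^ 2 / d)) atTop (𝓝 (V * (q ^ 2 / d))) := by
  have hs : Tendsto (fun n : ℕ => Real.sqrt n) atTop atTop :=
    Real.tendsto_sqrt_atTop.comp tendsto_natCast_atTop_atTop
  have hKs : Tendsto (fun n : ℕ => K / Real.sqrt n) atTop (𝓝 0) := tendsto_const_nhds.div_atTop hs
  have hθ : Tendsto (fun n : ℕ => θ n / Real.sqrt n) atTop (𝓝 0) := by
    have hlo : Tendsto (fun n : ℕ => -(f n / Real.sqrt n) - K / Real.sqrt n) atTop (𝓝 0) := by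
      simpa using hf.tendsto_div_nhds_zero.neg.sub hKs
    have hup : Tendsto (fun n : ℕ => 1 / 2 * (Real.log n / Real.sqrt n) + K / Real.sqrt n)
        atTop (𝓝 0) := by
      simpa only [mul_zero, add_zero] using
        (isLittleO_log_sqrt.tendsto_div_nhds_zero.const_mul (1 / 2)).add hKs
    refine tendsto_of_tendsto_of_tendsto_of_le_of_le' hlo hup ?_ ?_
    · filter_upwards [eventually_ge_atTop 1] with n hn
      have := div_le_div_of_nonneg_right (h n hn).2.1 (Real.sqrt_nonneg n)
      refine le_trans (le_of_eq ?_) this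
      ring
    · filter_upwards [eventually_ge_atTop 1] with n hn
      have := div_le_div_of_nonneg_right (h n hn).2.2 (Real.sqrt_nonneg n)
      refine this.trans (le_of_eq ?_)
      ring
  have hmain : Tendsto (fun n : ℕ => (Real.sqrt V * q - θ n / Real.sqrt n) ^ 2 / d) atTop
      (𝓝 (V * (q ^ 2 / d))) := by
    have := ((hθ.const_sub (Real.sqrt V * q)).pow 2).div_const d
    have e : (Real.sqrt V * q - 0) ^ 2 / d = V * (q ^ 2 / d) := by
      rw [sub_zero, mul_pow, Real.sq_sqrt hV, mul_div_assoc]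
    rwa [e] at this
  refine hmain.congr' ?_
  filter_upwards [eventually_ge_atTop 1] with n hn
  have hn0 : (0 : ℝ) < n := by exact_mod_cast hn
  have hsn : 0 < Real.sqrt n := Real.sqrt_pos.2 hn0
  have e : n * C - L n = Real.sqrt n * (Real.sqrt V * q - θ n / Real.sqrt n) := by
    rw [(h n hn).1, Real.sqrt_mul hn0.le]; field_simp; ring
  rw [e, mul_pow, Real.sq_sqrt hn0.le]
  field_simp


/-! ### The maximal code size -/

lemma maxCodeSize_spec {A B : Type*} [MeasurableSpace A] [MeasurableSpace B]
    (κ : Kernel A B) [IsMarkovKernel κ] {b : A → ℝ≥0∞} {n : ℕ} {ε : ℝ} {β : ℝ≥0∞} {M₀ N : ℕ}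
    (h0 : HasCode (memorylessChannel κ n) (blockCost b n) M₀ ε β)
    (hN : ∀ M, HasCode (memorylessChannel κ n) (blockCost b n) M ε β → M ≤ N) :
    maxCodeSize κ b n ε β ≠ ⊤ ∧
      HasCode (memorylessChannel κ n) (blockCost b n) (maxCodeSize κ b n ε β).toNat ε β ∧
      ∀ M, HasCode (memorylessChannel κ n) (blockCost b n) M ε β →
        M ≤ (maxCodeSize κ b n ε β).toNat := by
  set S : Set ℕ := {M | HasCode (memorylessChannel κ n) (blockCost b n) M ε β} with hS
  have hbdd : BddAbove S := ⟨N, fun M hM => hN M hM⟩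
  have hmem : sSup S ∈ S := Nat.sSup_mem ⟨M₀, h0⟩ hbdd
  have e : maxCodeSize κ b n ε β = (sSup S : ℕ) := by
    refine le_antisymm (iSup₂_le fun M hM => ?_) (le_iSup₂_of_le (sSup S) hmem le_rfl)
    exact_mod_cast le_csSup hbdd hM
  rw [e, ENat.toNat_natCast]
  exact ⟨ENat.natCast_ne_top _, hmem, fun M hM => le_csSup hbdd hM⟩

/-- A threshold `c` with upper tail below `(1 - ε) / 2` turns the metaconverse into `M (1 - ε) / 2 ≤
exp c`. -/
lemma exists_forall_code_le {M₀ : ℕ → Prop} (μ : Measure ℝ) [IsProbabilityMeasure μ] {ε : ℝ}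
    (hε1 : ε < 1)
    (h : ∀ M : ℕ, M₀ M → ∀ c, (M : ℝ) * (1 - ε) ≤ M * μ.real (Ioi c) + Real.exp c) :
    ∃ N, ∀ M, M₀ M → M ≤ N := by
  obtain ⟨c, hc⟩ := ((tendsto_cdf_atTop μ).eventually
    (lt_mem_nhds (by linarith : 1 - (1 - ε) / 2 < 1))).exists
  rw [cdf_eq_real] at hc
  obtain ⟨N, hN⟩ := exists_nat_ge (Real.exp c / ((1 - ε) / 2))
  refine ⟨N, fun M hM => ?_⟩
  have h1 := h M hM c
  rw [real_Ioi_eq_one_sub] at h1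
  have h2 : (M : ℝ) * (1 - μ.real (Iic c)) ≤ M * ((1 - ε) / 2) :=
    mul_le_mul_of_nonneg_left (by linarith) (Nat.cast_nonneg M)
  have h3 : (M : ℝ) ≤ Real.exp c / ((1 - ε) / 2) := by
    rw [le_div_iff₀ (by linarith)]
    linarith
  exact_mod_cast h3.trans hN

lemma measurable_blockCost {A : Type*} [MeasurableSpace A] {b : A → ℝ≥0∞} (hb : Measurable b)
    (n : ℕ) : Measurable (blockCost b n) :=
  (Finset.measurable_sum _ fun i _ => hb.comp (measurable_pi_apply i)).div_const _

lemma isMarkovKernel_memorylessChannel {A B : Type*} [MeasurableSpace A] [MeasurableSpace B]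
    (κ : Kernel A B) [IsMarkovKernel κ] (n : ℕ) : IsMarkovKernel (memorylessChannel κ n) :=
  ⟨fun x => by change IsProbabilityMeasure (Measure.pi fun i => κ (x i)); infer_instance⟩

lemma const_mem_costShell {A : Type*} {b : A → ℝ≥0∞} {β : ℝ≥0} {x : A} (hx : b x = β) {n : ℕ}
    (hn : 1 ≤ n) : (fun _ => x) ∈ costShell b β n := by
  rw [mem_costShell_iff hn]
  simp [hx]

lemma map_llr_memorylessChannel_const {A B : Type*} [MeasurableSpace A] [MeasurableSpace B]
    (κ : Kernel A B) [IsMarkovKernel κ] (ν : Measure B) [IsProbabilityMeasure ν] {x : A}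
    (hac : κ x ≪ ν) (n : ℕ) :
    (memorylessChannel κ n fun _ => x).map
      (llr (memorylessChannel κ n fun _ => x) (Measure.pi fun _ : Fin n => ν)) =
        convPow ((κ x).map (llr (κ x) ν)) n := by
  have e : (memorylessChannel κ n fun _ => x) = Measure.pi fun _ : Fin n => κ x := rfl
  rw [e, Measure.map_congr (llr_pi (fun _ => κ x) (fun _ => ν) fun _ => hac),
    map_sum_pi_eq_convPow (κ x) (measurable_llr _ _)]

lemma convPow_one (μ : Measure ℝ) [IsProbabilityMeasure μ] : convPow μ 1 = μ := by
  simp [convPow, Measure.conv_dirac_zero]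

/-- Gaussian approximation of the maximal code size, for a channel whose information density
with respect to `ν` has the law of a sum of independent copies of `μ` on the cost shells. -/
lemma exists_expansion {A B : Type*} [MeasurableSpace A] [MeasurableSpace B]
    (κ : Kernel A B) [IsMarkovKernel κ] {b : A → ℝ≥0∞} (hb : Measurable b) {β : ℝ≥0}
    (ν : Measure B) [IsProbabilityMeasure ν]
    (h_onto : ∀ γ : ℝ≥0, β ≤ γ → ∃ x, b x = γ)
    (hac : ∀ x, b x ≠ ∞ → κ x ≪ ν)
    (μ : Measure ℝ) [IsProbabilityMeasure μ] (h3 : MemLp (fun x : ℝ => x) 3 μ)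
    (hlaw : ∀ n : ℕ, 1 ≤ n → ∀ x ∈ costShell b β n, (memorylessChannel κ n x).map
      (llr (memorylessChannel κ n x) (Measure.pi fun _ : Fin n => ν)) = convPow μ n)
    (f : ℕ → ℝ)
    (h_div : ∀ n : ℕ, 1 ≤ n → ∃ P : Measure (Fin n → A), IsProbabilityMeasure P ∧
      (∀ᵐ x ∂P, x ∈ costShell b β n) ∧
      (memorylessChannel κ n ∘ₘ P) ≪ (Measure.pi fun _ : Fin n => ν) ∧
      ∀ᵐ y ∂(memorylessChannel κ n ∘ₘ P),
        llr (memorylessChannel κ n ∘ₘ P) (Measure.pi fun _ : Fin n => ν) y ≤ f n)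
    {C V : ℝ} (hC : ∫ x, x ∂μ = C) (hV : Var[fun x => x; μ] = V)
    {ε : ℝ} (hε0 : 0 < ε) (hε1 : ε < 1) :
    (∀ n : ℕ, 1 ≤ n → maxCodeSize κ b n ε β ≠ ⊤) ∧
      ∃ (θ : ℕ → ℝ) (K : ℝ), ∀ n : ℕ, 1 ≤ n →
        logMaxCodeSize κ b n ε β = n * C - Real.sqrt (n * V) * gaussianQInv ε + θ n ∧
        -f n - K ≤ θ n ∧ θ n ≤ (1 / 2) * Real.log n + K := by
  obtain ⟨x₁, hx₁⟩ := h_onto β le_rfl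
  have hmk := isMarkovKernel_memorylessChannel κ
  have hshell : ∀ n, 1 ≤ n → ∀ x ∈ costShell b β n, blockCost b n x ≤ β := fun n _ x hx => le_of_eq hx
  have hfin : ∀ n, 1 ≤ n →
      ∃ N, ∀ M, HasCode (memorylessChannel κ n) (blockCost b n) M ε β → M ≤ N := fun n hn =>
    exists_forall_code_le (convPow μ (n + 1)) hε1 fun M hM c =>
      hasCode_converse κ ν h_onto (convPow μ) hac hlaw hn hε0.le hM c
  have htriv : ∀ n, 1 ≤ n → HasCode (memorylessChannel κ n) (blockCost b n) 1 ε β := fun n hn =>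
    hasCode_of_disjoint _ (measurable_blockCost hb n) one_pos hε1 (fun _ _ => x₁)
      (fun _ => hshell n hn _ (const_mem_costShell hx₁ hn)) (fun _ => univ)
      (fun _ => MeasurableSet.univ) (fun i j hij => absurd (Subsingleton.elim i j) hij)
      (fun _ => by
        rw [measure_univ, ← ENNReal.ofReal_one]
        exact ENNReal.ofReal_le_ofReal (by linarith))
  choose! N hN using hfin
  have hspec := fun n hn => maxCodeSize_spec κ (htriv n hn) (hN n hn)
  set M : ℕ → ℕ := fun n => (maxCodeSize κ b n ε β).toNat with hM
  have hM1 : ∀ n, 1 ≤ n → 1 ≤ M n := fun n hn => (hspec n hn).2.1.1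
  refine ⟨fun n hn => (hspec n hn).1, ?_⟩
  obtain ⟨K₁, hK₁⟩ := exists_log_le μ h3 hC hV hε0 hε1 hM1 fun n hn c =>
    hasCode_converse κ ν h_onto (convPow μ) hac hlaw hn hε0.le (hspec n hn).2.1 c
  -- Here `a` bounds the mass of unit intervals; slicing makes the reference mass of every likely
  -- set at most `2 a exp (-s)`, which enters Feinstein's bound. A code found there is no larger
  -- than the maximal one.
  obtain ⟨K₂, hK₂⟩ := exists_le_log μ h3 hC hV hε0 hε1 hM1 f fun n hn s a ha hI hs => by
    obtain ⟨P, hP, hPF, hPQ, hPf⟩ := h_div n hn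
    have hacn : ∀ x ∈ costShell b β n, memorylessChannel κ n x ≪ Measure.pi fun _ : Fin n => ν :=
      fun x hx => pi_absolutelyContinuous (fun i => κ (x i)) (fun _ => ν)
        fun i => hac _ (ne_top_of_mem_costShell hn hx i)
    obtain ⟨M', hM', hle⟩ := exists_hasCode_le (memorylessChannel κ n) (measurable_blockCost hb n)
      hε1 (costShell b β n) (hshell n hn) (Measure.pi fun _ : Fin n => ν) hacn (convPow μ n)
      (hlaw n hn) (hN n hn) P hPF hPQ hPf s hs (b := 2 * a * Real.exp (-s)) (by positivity)
      (fun x hx => measure_likelySet_le (hacn x hx) s ha fun t => by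
        rw [← Measure.map_apply (measurable_llr _ _) measurableSet_Ioc, hlaw n hn x hx,
          ← ofReal_measureReal]
        exact ENNReal.ofReal_le_ofReal (hI t))
    refine hle.trans ?_
    have : (M' : ℝ) ≤ M n := by exact_mod_cast (hspec n hn).2.2 M' hM'
    gcongr
  refine ⟨fun n => logMaxCodeSize κ b n ε β - (n * C - Real.sqrt (n * V) * gaussianQInv ε),
    max K₁ K₂, fun n hn => ⟨by ring, ?_, ?_⟩⟩
  · have h1 := hK₂ n hn
    have h2 := le_max_right K₁ K₂
    simp only [logMaxCodeSize]
    linarith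
  · have h1 := hK₁ n hn
    have h2 := le_max_left K₁ K₂
    simp only [logMaxCodeSize]
    linarith

/-- For fixed `ε < 1` the inner `limsup` is a true limit, `V Q⁻¹(ε)² / (2 log (1/ε))`, and the ratio
multiplying `V` tends to `1`. -/
lemma isDispersionCost_of_expansion {A B : Type*} [MeasurableSpace A] [MeasurableSpace B]
    (κ : Kernel A B) [IsMarkovKernel κ] {b : A → ℝ≥0∞} {β : ℝ≥0∞} {f : ℕ → ℝ}
    (hf : f =o[atTop] fun n : ℕ => Real.sqrt n) {V : ℝ} (hV : 0 ≤ V)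
    (h : ∀ ε : ℝ, 0 < ε → ε < 1 → ∃ (θ : ℕ → ℝ) (K : ℝ), ∀ n : ℕ, 1 ≤ n →
      logMaxCodeSize κ b n ε β
        = n * (capacityCost κ b β).toReal - Real.sqrt (n * V) * gaussianQInv ε + θ n ∧
      -f n - K ≤ θ n ∧ θ n ≤ (1 / 2) * Real.log n + K) :
    IsDispersionCost κ b β V := by
  have hlim : Tendsto (fun ε : ℝ => ((V * (gaussianQInv ε ^ 2 / (2 * Real.log (1 / ε))) : ℝ) : EReal))
      (𝓝[>] 0) (𝓝 (V : EReal)) := by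
    have := tendsto_gaussianQInv_sq_div.const_mul V
    rw [mul_one] at this
    exact (continuous_coe_real_ereal.tendsto V).comp this
  refine hlim.congr' ?_
  filter_upwards [Ioo_mem_nhdsGT (zero_lt_one' ℝ)] with ε hε
  obtain ⟨θ, K, hθ⟩ := h ε hε.1 hε.2
  have := tendsto_sq_div_of_expansion (d := 2 * Real.log (1 / ε)) hV hf hθ
  exact ((continuous_coe_real_ereal.tendsto _).comp this).limsup_eq.symm

end CostDispersion

/-! ### Assembly of the theorem -/

open CostDispersion

theorem mainTheorem9
    {A B : Type*} [MeasurableSpace A] [MeasurableSpace B] [MeasurableSpace.CountablyGenerated B]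
    (κ : Kernel A B) [IsMarkovKernel κ]
    (b : A → ℝ≥0∞) (hb : Measurable b) (β : ℝ≥0)
    -- standing assumptions: `β` exceeds the minimal cost, `C(β)` is finite, and `C(β)` is attained
    -- by an input law `PX` (the law of `X*`) that meets the cost constraint with equality
    (hβ : ⨅ x, b x < (β : ℝ≥0∞))
    (hC : capacityCost κ b β ≠ ⊤)
    (PX : Measure A) [IsProbabilityMeasure PX]
    (hPXcost : ∫⁻ x, b x ∂PX = β)
    (hPXopt : channelMutualInfo PX κ = capacityCost κ b β)
    -- (a) every finite cost level from `β` on is attained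
    (h_onto : ∀ γ : ℝ≥0, β ≤ γ → ∃ x, b x = γ)
    -- (b) the information density at `x^n` has the same law for all `x^n` in the cost shell
    (h_symm : ∀ n : ℕ, 1 ≤ n → ∀ x ∈ costShell b β n, ∀ x' ∈ costShell b β n,
      (memorylessChannel κ n x).map
          (llr (memorylessChannel κ n x) (Measure.pi fun _ : Fin n => κ ∘ₘ PX)) =
        (memorylessChannel κ n x').map
          (llr (memorylessChannel κ n x') (Measure.pi fun _ : Fin n => κ ∘ₘ PX)))
    -- (c) finite third moments on the projection of the cost shells onto `A`
    (h_third : ∀ a : A, (∃ n : ℕ, 1 ≤ n ∧ ∃ x ∈ costShell b β n, ∃ i, x i = a) →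
      Integrable (fun y =>
        |bTilted κ b (κ ∘ₘ PX) β a y - (capacityCost κ b β).toReal| ^ 3) (κ a))
    -- (d) an input law on each cost shell with output log-likelihood ratio at most `f n`, a.s.
    (f : ℕ → ℝ) (hf : f =o[atTop] fun n : ℕ => Real.sqrt n)
    (h_div : ∀ n : ℕ, 1 ≤ n → ∃ P : Measure (Fin n → A), IsProbabilityMeasure P ∧
      (∀ᵐ x ∂P, x ∈ costShell b β n) ∧
      (memorylessChannel κ n ∘ₘ P) ≪ (Measure.pi fun _ : Fin n => κ ∘ₘ PX) ∧
      ∀ᵐ y ∂(memorylessChannel κ n ∘ₘ P),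
        llr (memorylessChannel κ n ∘ₘ P) (Measure.pi fun _ : Fin n => κ ∘ₘ PX) y ≤ f n) :
    ∃ V : ℝ, IsDispersionCost κ b β V ∧
      (∀ x : A, b x = β →
        capacityCost κ b β = klDiv (κ x) (κ ∘ₘ PX) ∧
        MemLp (llr (κ x) (κ ∘ₘ PX)) 2 (κ x) ∧
        V = Var[llr (κ x) (κ ∘ₘ PX); κ x]) ∧
      ∀ ε : ℝ, 0 < ε → ε < 1 →
        (∀ n : ℕ, 1 ≤ n → maxCodeSize κ b n ε β ≠ ⊤) ∧
        ∃ (θ : ℕ → ℝ) (K : ℝ), ∀ n : ℕ, 1 ≤ n →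
          logMaxCodeSize κ b n ε β
            = n * (capacityCost κ b β).toReal - Real.sqrt (n * V) * gaussianQInv ε + θ n ∧
          -f n - K ≤ θ n ∧ θ n ≤ (1 / 2) * Real.log n + K := by
  have hac : ∀ x, b x ≠ ∞ → κ x ≪ κ ∘ₘ PX := fun x hx =>
    kernel_absolutelyContinuous_of_optimal κ hb hβ hC PX hPXcost.le hPXopt hx
  -- For a fixed letter the tilted density differs from `llr` by a constant, so the third moment
  -- passes over whatever the value of `C'(β)`.
  have hmem : ∀ x, b x ≠ ∞ → MemLp (llr (κ x) (κ ∘ₘ PX)) 3 (κ x) := fun x hx =>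
    memLp_three_of_integrable_abs_sub (measurable_llr _ _)
      (lambdaStar κ b β * ((b x).toReal - β) + (capacityCost κ b β).toReal) (by
        simpa only [bTilted, sub_sub] using h_third x (exists_mem_costShell hβ h_onto hx))
  have hfinite : ∀ x, b x = β → b x ≠ ∞ := fun x hx => hx ▸ ENNReal.coe_ne_top
  have hkl : ∀ x, b x = β → capacityCost κ b β = klDiv (κ x) (κ ∘ₘ PX) := fun x hx =>
    klDiv_eq_capacityCost κ hb hβ PX hPXcost hPXopt h_onto h_symm hac
      (fun x hx => (hmem x hx).integrable (by norm_num)) hx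
  have hvar : ∀ x, Var[fun t => t; (κ x).map (llr (κ x) (κ ∘ₘ PX))] =
      Var[llr (κ x) (κ ∘ₘ PX); κ x] := fun x =>
    variance_map (X := fun t : ℝ => t) (by fun_prop) (measurable_llr _ _).aemeasurable
  obtain ⟨x₁, hx₁⟩ := h_onto β le_rfl
  -- Every block of the shell is compared with the constant block of `x₁`, whose density is a sum of
  -- independent copies.
  have hlaw : ∀ n : ℕ, 1 ≤ n → ∀ x ∈ costShell b β n, (memorylessChannel κ n x).map
      (llr (memorylessChannel κ n x) (Measure.pi fun _ : Fin n => κ ∘ₘ PX)) =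
        convPow ((κ x₁).map (llr (κ x₁) (κ ∘ₘ PX))) n := fun n hn x hx => by
    rw [h_symm n hn x hx _ (const_mem_costShell hx₁ hn),
      map_llr_memorylessChannel_const κ _ (hac _ (hfinite _ hx₁))]
  have hprob : ∀ x, IsProbabilityMeasure ((κ x).map (llr (κ x) (κ ∘ₘ PX))) := fun x =>
    Measure.isProbabilityMeasure_map (measurable_llr _ _).aemeasurable
  have hmean : ∫ t, t ∂((κ x₁).map (llr (κ x₁) (κ ∘ₘ PX))) = (capacityCost κ b β).toReal := by
    rw [hkl x₁ hx₁, toReal_klDiv_of_measure_eq (hac _ (hfinite _ hx₁)) (by simp),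
      integral_map (measurable_llr _ _).aemeasurable (by fun_prop)]
  have hexp := fun (ε : ℝ) (hε0 : 0 < ε) (hε1 : ε < 1) =>
    exists_expansion κ hb (κ ∘ₘ PX) h_onto hac ((κ x₁).map (llr (κ x₁) (κ ∘ₘ PX)))
      ((memLp_map_measure_iff (by fun_prop) (measurable_llr _ _).aemeasurable).2
        (hmem x₁ (hfinite _ hx₁))) hlaw f h_div hmean (hvar x₁) hε0 hε1
  refine ⟨Var[llr (κ x₁) (κ ∘ₘ PX); κ x₁], isDispersionCost_of_expansion κ hf (variance_nonneg _ _)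
    fun ε hε0 hε1 => (hexp ε hε0 hε1).2, fun x hx => ⟨hkl x hx,
      (hmem x (hfinite x hx)).mono_exponent (by norm_num), ?_⟩, hexp⟩
  -- At blocklength one, the symmetry says that all letters of cost `β` share the same density law,
  -- so the variance does not depend on the letter.
  have h1 := hlaw 1 le_rfl (fun _ => x) (const_mem_costShell hx le_rfl)
  rw [map_llr_memorylessChannel_const κ _ (hac _ (hfinite _ hx)), convPow_one, convPow_one] at h1
  rw [← hvar, ← hvar, h1]
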